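/- \textbf{Geometry.} Let $V=\{x\in\mathbb R^4: x_0>|\mathbf x|\}$ be the open forward light cone in Minkowski space, with $x^2=x_0^2-\mathbf x^2$. For $X\subset V$ let $X^c$ be the interior of the set of all $y\in V$ with $(x-y)^2<0$ for all $x\in X$; the causal completion of $X$ is $X^{cc}$. Double cones are the sets $\mathcal O=(a+V)\cap(b-V)$ with $a\in V$, $b\in a+V$. Fix $\tau>0$ and let $\mathsf H=\{x\in V:x^2=\tau^2\}$, identified with the open unit ball $\mathsf B\subset\mathbb R^3$ by $a\mapsto \mathbf a/a_0$. A hypercone is the causal completion of the subset of $\mathsf H$ corresponding to $K=\mathsf B\cap(v+Q)$, where $v\in \mathsf B$ and $Q\subset\mathbb R^3$ is a pointed open convex cone with apex $0$ and elliptical base; $\mathcal F$ is the family of all hypercones. A funnel is a decreasing sequence of hypercones $\mathcal D_n$ with $\bigcup_n\mathcal D_n^{\,c}=V$. \textbf{Theory.} Let $\mathcal O\mapsto\mathfrak A(\mathcal O)$ be an isotonous net, on the double cones in $V$, of unital C*-algebras of operators on a Hilbert space $\mathcal H$ (with common unit $1$). $\mathfrak A(V)$ and $\mathfrak A(\mathcal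 C)$, $\mathcal C\in\mathcal F$, are the C*-algebras generated by all $\mathfrak A(\mathcal O)$, respectively by those with $\mathcal O\subset\mathcal C$; $\mathfrak A(\mathcal C^c)$ is generated by the $\mathfrak A(\mathcal C_1)$ with $\mathcal C_1\in\mathcal F$, $\mathcal C_1\subset\mathcal C^c$. The weak closure of an algebra is denoted by $^-$, and $\mathfrak R(V)=\mathfrak A(V)^-$, $\mathfrak R(\mathcal C)=\mathfrak A(\mathcal C)^-$, $\mathfrak R(\mathcal C^c)=\mathfrak A(\mathcal C^c)^-$. Assume: (1) $[\mathfrak A(\mathcal O_1),\mathfrak A(\mathcal O_2)]=0$ if $\mathcal O_1\subset\mathcal O_2^{\,c}$. (2) The semigroup $\mathcal S$ of pairs $\lambda=(x,\Lambda)$, $x\in\overline V$ a translation and $\Lambda$ a proper orthochronous Lorentz transformation, acts by unital $*$-endomorphisms $\alpha_\lambda$ of $\mathfrak A(V)$ with $\alpha_\lambda(\mathfrak A(\mathcal O))=\mathfrak A(\lambda\mathcal O)$. (3) $\Omega\in\mathcal H$ is a unit vector inducing a vacuum state $\omega_0=(\Omega,\,\cdot\,\Omega)$: $\omega_0\circ\alpha_\lambda=\omega_0$;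 the functions $\lambda\mapsto\omega_0(A^*\alpha_\lambda(B))$ are continuous; the functions $x\mapsto\omega_0(A^*\alpha_x(B))$ extend continuously to $\overline V+i\overline V$, analytically in the interior, with modulus bounded by $\sqrt{\omega_0(A^*A)\,\omega_0(B^*B)}$. The vacuum is unique: each vector invariant under the unitaries $A\Omega\mapsto\alpha_x(A)\Omega$, $x\in\overline V$, is a multiple of $\Omega$. (4) $\Omega$ is cyclic and separating for each $\mathfrak A(\mathcal O)$. (5) $\mathfrak A(\mathcal C^c)'\cap\mathfrak R(V)=\mathfrak R(\mathcal C)$ and $\mathfrak A(\mathcal C)'\cap\mathfrak R(V)=\mathfrak R(\mathcal C^c)$ for all $\mathcal C\in\mathcal F$. (6) $\mathfrak R(V)$ is a factor of type III$_1$. \textbf{Simple charge classes.} A state $\omega$ of $\mathfrak A(V)$ is elemental if the weak closure of its GNS representation is a factor of type III$_1$; its charge class is the norm closure of the set of states $\omega\circ\mathrm{Ad}\,u$, $u\in\mathfrak A(V)$ unitary. A charge class $\mathscr C$ of elemental states is simple if there are morphisms (unital $*$-homomorphisms) $\sigma_{\mathcal C}:\mathfrak A(V)\to\mathfrak R(V)$,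 $\mathcal C\in\mathcal F$, with $\omega_0\circ\sigma_{\mathcal C}\in\mathscr C$, such that (a) $\sigma_{\mathcal C}(A)=A$ for $A\in\mathfrak A(\mathcal C^c)$; (b) $\sigma_{\mathcal C}(\mathfrak A(\mathcal C_1))^-=\mathfrak R(\mathcal C_1)$ for all $\mathcal C_1\in\mathcal F$ with $\mathcal C_1\supset\mathcal C$; (c) for all $\mathcal C_1,\mathcal C_2\in\mathcal F$, $\mathrm{Ad}\,U_1\circ\sigma_{\mathcal C_1}=\mathrm{Ad}\,U_2\circ\sigma_{\mathcal C_2}$ for some unitaries $U_1,U_2\in\mathfrak R(V)$. We say that such a family $(\sigma_{\mathcal C})_{\mathcal C\in\mathcal F}$ represents $\mathscr C$. $\Sigma(\mathcal C)$ is the set of all morphisms $\sigma_{\mathcal C}$ occurring, with index $\mathcal C$, in families that represent simple charge classes. \textbf{Products.} For a funnel $\{\mathcal D_n\}$ let $\widetilde{\mathfrak A}(V)$ be the norm closure of $\bigcup_n\mathfrak R(\mathcal D_n^{\,c})$. An extension of a morphism $\sigma$ is a $*$-homomorphism $\tilde\sigma:\widetilde{\mathfrak A}(V)\to\mathfrak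 R(V)$ for some funnel with $\widetilde{\mathfrak A}(V)\supset\mathfrak A(V)$, which agrees with $\sigma$ on $\mathfrak A(V)$ and is normal on each $\mathfrak R(\mathcal D_n^{\,c})$. If $\kappa$ is a morphism localized in $\mathcal C$, then $\sigma\bullet\kappa=\rho$ means: there are extensions $\tilde\sigma$ of $\sigma$ with $\mathcal C\subset\mathcal D_m^{\,c}$ for some $m$ (so that $\mathfrak R(\mathcal C)$ lies in their domain), and for each of them $\kappa(\mathfrak A(V))\subset\widetilde{\mathfrak A}(V)$ and $\tilde\sigma\circ\kappa=\rho$. \textbf{Proposition.} Let $\iota$ be the identical morphism of $\mathfrak A(V)$. (i) For each $\mathcal C\in\mathcal F$ and $\sigma_{\mathcal C}\in\Sigma(\mathcal C)$ there is $\bar\sigma_{\mathcal C}\in\Sigma(\mathcal C)$ with $$\bar\sigma_{\mathcal C}\bullet\sigma_{\mathcal C}=\sigma_{\mathcal C}\bullet\bar\sigma_{\mathcal C}=\iota .$$ Moreover $\bar\sigma_{\mathcal C}(A)=\lim_n W_n^{-1}AW_n$ in norm, $A\in\mathfrak A(V)$, for every sequence of unitaries $W_n\in\mathfrak R(V)$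 with $\mathrm{Ad}\,W_n\circ\kappa_n=\sigma_{\mathcal C}$, $\kappa_n\in\Sigma(\mathcal D_n)$, where $\{\mathcal D_n\}$ is a funnel, $\mathcal D_n\subset\mathcal C_n^{\,c}$, and $\mathcal C_n\supset\mathcal C$ is an increasing sequence of hypercones with $\bigcup_n\mathcal C_n=V$; such sequences exist. (ii) Every simple charge class has a simple conjugate charge class: for each family $(\sigma_{\mathcal C})_{\mathcal C\in\mathcal F}$ representing a simple charge class $\mathscr C$ there are a simple charge class $\bar{\mathscr C}$ and a family $(\bar\sigma_{\mathcal C})_{\mathcal C\in\mathcal F}$ representing it, such that $\bar\sigma_{\mathcal C}$ is related to $\sigma_{\mathcal C}$ as in (i) for all $\mathcal C\in\mathcal F$. -/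

import Mathlib

open Filter Topology
open scoped InnerProductSpace

noncomputable section

namespace LightCone

/-! ### Geometry of the forward light cone -/

/-- Minkowski space `ℝ⁴`, with coordinates `(x 0, x 1, x 2, x 3)`. -/
abbrev Spacetime : Type := Fin 4 → ℝ

/-- The Lorentz scalar product, signature `(+,-,-,-)`. -/
def mink (x y : Spacetime) : ℝ := x 0 * y 0 - ∑ i : Fin 3, x i.succ * y i.succ

/-- The open forward light cone `V`. -/
def forwardCone : Set Spacetime := {x | 0 < x 0 ∧ 0 < mink x x}

/-- The closed semigroup of future directed translations. -/
def closedForwardCone : Set Spacetime := {x | 0 ≤ x 0 ∧ 0 ≤ mink x x}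

/-- The spacelike complement in `V`. -/
def spacelikeCompl (X : Set Spacetime) : Set Spacetime :=
  interior {y | y ∈ forwardCone ∧ ∀ x ∈ X, mink (x - y) (x - y) < 0}

/-- The causal completion in `V`. -/
def causalCompletion (X : Set Spacetime) : Set Spacetime := spacelikeCompl (spacelikeCompl X)

/-- Double cones that are relatively compact in `V`: the vertices `a`, `b` are points of `V` and
`b` lies in the chronological future of `a`. -/
def IsDoubleCone (O : Set Spacetime) : Prop :=
  ∃ a ∈ forwardCone, ∃ b, b - a ∈ forwardCone ∧
    O = {x | x - a ∈ forwardCone ∧ b - x ∈ forwardCone}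

/-- The set of double cones in `V`. -/
abbrev DoubleCone : Type := {O : Set Spacetime // IsDoubleCone O}

/-- The hyperboloid (time shell) of parameter `τ`. -/
def hyperboloid (τ : ℝ) : Set Spacetime := {x | 0 < x 0 ∧ mink x x = τ ^ 2}

/-- Projection of `V` through the origin to the Beltrami-Klein ball in the plane `x 0 = 1`. -/
def beltramiKlein (a : Spacetime) : Fin 3 → ℝ := fun i => a i.succ / a 0

/-- The open unit ball of `ℝ³`, i.e. the Beltrami-Klein model. -/
def kleinBall : Set (Fin 3 → ℝ) := {u | ∑ i, u i ^ 2 < 1}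

/-- The open round cone of `ℝ³`; its images under invertible linear maps are the pointed open
convex cones with apex `0` and elliptical base. -/
def roundCone : Set (Fin 3 → ℝ) := {w | Real.sqrt (w 0 ^ 2 + w 1 ^ 2) < w 2}

/-- Pointed open convex cones in the ball, with elliptical base and apex `v` in the ball. -/
def IsKleinCone (K : Set (Fin 3 → ℝ)) : Prop :=
  ∃ v ∈ kleinBall, ∃ T : (Fin 3 → ℝ) ≃ₗ[ℝ] (Fin 3 → ℝ),
    K = {u | u ∈ kleinBall ∧ u - v ∈ T '' roundCone}

/-- Hypercones: causal completions of hyperbolic cones on the hyperboloid of parameter `τ`. -/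
def IsHypercone (τ : ℝ) (C : Set Spacetime) : Prop :=
  ∃ K, IsKleinCone K ∧ C = causalCompletion {a | a ∈ hyperboloid τ ∧ beltramiKlein a ∈ K}

/-- The family of all hypercones based on the hyperboloid of parameter `τ`. -/
abbrev Hypercone (τ : ℝ) : Type := {C : Set Spacetime // IsHypercone τ C}

/-- Funnels: decreasing sequences of hypercones whose spacelike complements exhaust `V`. -/
def IsFunnel {τ : ℝ} (D : ℕ → Hypercone τ) : Prop :=
  (∀ m n, m ≤ n → (D n).1 ⊆ (D m).1) ∧ ⋃ n, spacelikeCompl (D n).1 = forwardCone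

/-- Increasing sequences of hypercones which exhaust `V`. -/
def IsExhaustion {τ : ℝ} (C : ℕ → Hypercone τ) : Prop :=
  (∀ m n, m ≤ n → (C m).1 ⊆ (C n).1) ∧ ⋃ n, (C n).1 = forwardCone

/-- Proper orthochronous Lorentz transformations. -/
def IsLorentz (Λ : Matrix (Fin 4) (Fin 4) ℝ) : Prop :=
  (∀ x y, mink (Λ.mulVec x) (Λ.mulVec y) = mink x y) ∧ Λ.det = 1 ∧ 0 < Λ 0 0

/-- The semigroup of Poincaré transformations `(x, Λ)` with `x` a future directed translation. -/
def poincareSemigroup : Set (Spacetime × Matrix (Fin 4) (Fin 4) ℝ) :=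
  {g | g.1 ∈ closedForwardCone ∧ IsLorentz g.2}

/-- The action of `(x, Λ)` on spacetime. -/
def act (g : poincareSemigroup) (y : Spacetime) : Spacetime := g.1.2.mulVec y + g.1.1

lemma isLorentz_one : IsLorentz 1 := by
  refine ⟨fun x y => by simp, by simp, by simp⟩

/-- A future directed translation, as an element of the semigroup. -/
def translation (x : closedForwardCone) : poincareSemigroup := ⟨(x.1, 1), x.2, isLorentz_one⟩

/-! ### Operator algebras -/

section Algebras

universe u

variable {H : Type u} [NormedAddCommGroup H] [InnerProductSpace ℂ H] [CompleteSpace H]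

/-- The weak closure of a unital `*`-algebra of operators, i.e. (bicommutant theorem) its
double commutant, the von Neumann algebra it generates. -/
def weakClosure (S : StarSubalgebra ℂ (H →L[ℂ] H)) : VonNeumannAlgebra H where
  toStarSubalgebra :=
    StarSubalgebra.centralizer ℂ (StarSubalgebra.centralizer ℂ (S : Set (H →L[ℂ] H)) : Set _)
  centralizer_centralizer' := by
    simp

/-- The Hilbert space of square summable sequences of vectors. Its elements `ξ` give the normal
positive functionals `a ↦ ∑ n, ⟪ξ n, a (ξ n)⟫` of the von Neumann algebras on `H`. -/
abbrev SqSummable (H : Type u) [NormedAddCommGroup H] [InnerProductSpace ℂ H] : Type u :=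
  lp (fun _ : ℕ => H) 2

/-- The normal positive functional given by a square summable sequence of vectors. -/
def normalFunctional (ξ : SqSummable H) (a : H →L[ℂ] H) : ℂ := ∑' n, ⟪ξ n, a (ξ n)⟫_ℂ

lemma memℓp_amplify (a : H →L[ℂ] H) (ξ : SqSummable H) :
    Memℓp (fun n => a (ξ n)) 2 := by
  have h : Memℓp (fun n => ‖a‖ • ξ n) 2 := (lp.memℓp ξ).const_smul ‖a‖
  have h2 : (0 : ℝ) < (2 : ENNReal).toReal := by norm_num
  refine memℓp_gen ?_
  refine Summable.of_nonneg_of_le (fun n => by positivity) (fun n => ?_) (h.summable h2)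
  refine Real.rpow_le_rpow (norm_nonneg _) ?_ h2.le
  rw [norm_smul, norm_norm]
  exact a.le_opNorm _

/-- An operator acting componentwise on sequences of vectors. -/
def amplify (a : H →L[ℂ] H) (ξ : SqSummable H) : SqSummable H :=
  ⟨fun n => a (ξ n), memℓp_amplify a ξ⟩

/-- The corner `p M p` of a von Neumann algebra. -/
def corner (M : VonNeumannAlgebra H) (p : H →L[ℂ] H) : Set (H →L[ℂ] H) :=
  {a | a ∈ M ∧ p * a = a ∧ a * p = a}

/-- The GNS space of the functional given by `ξ` on the algebra `N`: the closure of `N ξ`. -/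
def cyclicSpace (N : Set (H →L[ℂ] H)) (ξ : SqSummable H) : Set (SqSummable H) :=
  closure ((fun a => amplify a ξ) '' N)

/-- The graph of the Tomita operator `S`, the closure of `a ξ ↦ a* ξ`. -/
def tomitaGraph (N : Set (H →L[ℂ] H)) (ξ : SqSummable H) : Set (SqSummable H × SqSummable H) :=
  closure ((fun a => (amplify a ξ, amplify (star a) ξ)) '' N)

/-- The graph of the modular operator `Δ = S* S` on the GNS space: `(x, y)` belongs to it if `x` is
in the domain of `S`, `S x` is in the domain of the adjoint of the antilinear operator `S`,
and `y = S* (S x)`. -/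
def modularGraph (N : Set (H →L[ℂ] H)) (ξ : SqSummable H) : Set (SqSummable H × SqSummable H) :=
  {g | g.2 ∈ cyclicSpace N ξ ∧ ∃ x', (g.1, x') ∈ tomitaGraph N ξ ∧
    ∀ a ∈ N, ⟪amplify a ξ, g.2⟫_ℂ = ⟪x', amplify (star a) ξ⟫_ℂ}

/-- The spectrum of the modular operator: the `t` for which `Δ - t` is not a bijection of the
domain of `Δ` onto the GNS space (`Δ` is closed, so a bijection has a bounded inverse). -/
def modularSpectrum (N : Set (H →L[ℂ] H)) (ξ : SqSummable H) : Set ℂ :=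
  {t | ¬ ∀ y ∈ cyclicSpace N ξ, ∃! g, g ∈ modularGraph N ξ ∧ g.2 - t • g.1 = y}

/-- Factors: the centre consists of the scalars. -/
def IsFactor (M : VonNeumannAlgebra H) : Prop :=
  Nontrivial H ∧ ∀ a, a ∈ M → a ∈ M.commutant → ∃ c : ℂ, a = c • 1

/-- Factors of type III₁, by Connes' invariant: the modular operator of every faithful normal
positive functional has spectrum `[0, ∞)`. Functionals on corners are included, so that factors
without a faithful normal state are covered, too. -/
def IsTypeIIIOne (M : VonNeumannAlgebra H) : Prop :=
  IsFactor M ∧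
  ∀ p ∈ M, IsStarProjection p → p ≠ 0 → ∀ ξ : SqSummable H, amplify p ξ = ξ →
    (∀ a ∈ corner M p, amplify a ξ = 0 → a = 0) →
    ∀ t : ℝ, 0 ≤ t → (t : ℂ) ∈ modularSpectrum (corner M p) ξ

end Algebras

/-! ### Nets of observables -/

universe u

/-- Local nets of unital C*-algebras on the double cones of `V`, acting on a Hilbert space. -/
structure Net (H : Type u) [NormedAddCommGroup H] [InnerProductSpace ℂ H] [CompleteSpace H] where
  /-- the algebra of a double cone -/
  alg : DoubleCone → StarSubalgebra ℂ (H →L[ℂ] H)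
  isClosed_alg : ∀ O, IsClosed (alg O : Set (H →L[ℂ] H))
  isotony : ∀ O₁ O₂ : DoubleCone, O₁.1 ⊆ O₂.1 → alg O₁ ≤ alg O₂
  locality : ∀ O₁ O₂ : DoubleCone, O₁.1 ⊆ spacelikeCompl O₂.1 →
    ∀ a ∈ alg O₁, ∀ b ∈ alg O₂, a * b = b * a

namespace Net

variable {H : Type u} [NormedAddCommGroup H] [InnerProductSpace ℂ H] [CompleteSpace H]

/-- The C*-algebra generated by the algebras of all double cones in the region `X`. -/
def region (N : Net H) (X : Set Spacetime) : StarSubalgebra ℂ (H →L[ℂ] H) :=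
  (⨆ O : {O : DoubleCone // O.1 ⊆ X}, N.alg O.1).topologicalClosure

/-- The global algebra, the C*-inductive limit of the algebras of all double cones in `V`. -/
def global (N : Net H) : StarSubalgebra ℂ (H →L[ℂ] H) :=
  (⨆ O : DoubleCone, N.alg O).topologicalClosure

/-- The C*-algebra of the spacelike complement of `C`, generated by the algebras of all hypercones
contained in that complement. -/
def compl (N : Net H) {τ : ℝ} (C : Hypercone τ) : StarSubalgebra ℂ (H →L[ℂ] H) :=
  (⨆ C₁ : {C₁ : Hypercone τ // C₁.1 ⊆ spacelikeCompl C.1}, N.region C₁.1.1).topologicalClosure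

end Net

/-- Theories on the light cone in their vacuum representation: a local net with an endomorphic
action of the semigroup of Poincaré transformations, a unique vacuum given by the vector `Ω`, the
Reeh-Schlieder property, hypercone duality for the hypercones based on a hyperboloid, and
a global von Neumann algebra which is a factor of type III₁. -/
structure Theory (τ : ℝ) (H : Type u) [NormedAddCommGroup H] [InnerProductSpace ℂ H]
    [CompleteSpace H] extends Net H where
  tau_pos : 0 < τ
  /-- the endomorphisms induced by Poincaré transformations -/
  α : poincareSemigroup → (toNet.global →⋆ₐ[ℂ] toNet.global)
  α_one : α (translation ⟨0, by simp [closedForwardCone, mink]⟩) = StarAlgHom.id ℂ _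
  α_mul : ∀ g h k : poincareSemigroup,
    k.1 = (g.1.1 + g.1.2.mulVec h.1.1, g.1.2 * h.1.2) → α k = (α g).comp (α h)
  covariance : ∀ (g : poincareSemigroup) (O O' : DoubleCone), O'.1 = act g '' O.1 →
    (fun a => (α g a : H →L[ℂ] H)) '' {a | (a : H →L[ℂ] H) ∈ alg O} = alg O'
  /-- the vacuum vector -/
  Ω : H
  norm_Ω : ‖Ω‖ = 1
  vacuum_invariant : ∀ g (a : toNet.global),
    ⟪Ω, (α g a : H →L[ℂ] H) Ω⟫_ℂ = ⟪Ω, (a : H →L[ℂ] H) Ω⟫_ℂ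
  vacuum_continuous : ∀ a b : toNet.global,
    Continuous fun g => ⟪Ω, ((star a * α g b : toNet.global) : H →L[ℂ] H) Ω⟫_ℂ
  vacuum_analytic : ∀ a b : toNet.global, ∃ F : (Fin 4 → ℂ) → ℂ,
    let D : Set (Fin 4 → ℂ) :=
      {z | (fun i => (z i).re) ∈ closedForwardCone ∧ (fun i => (z i).im) ∈ closedForwardCone}
    ContinuousOn F D ∧ DifferentiableOn ℂ F (interior D) ∧
    (∀ x : closedForwardCone, F (fun i => (x.1 i : ℂ)) =
      ⟪Ω, ((star a * α (translation x) b : toNet.global) : H →L[ℂ] H) Ω⟫_ℂ) ∧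
    ∀ z ∈ D, ‖F z‖ ≤ Real.sqrt
      ((⟪Ω, ((star a * a : toNet.global) : H →L[ℂ] H) Ω⟫_ℂ).re *
        (⟪Ω, ((star b * b : toNet.global) : H →L[ℂ] H) Ω⟫_ℂ).re)
  /-- Uniqueness: every translation invariant vector is a multiple of `Ω`; translations act by the
  unitaries `a Ω ↦ α a Ω`, whose invariant vectors are those of their adjoints. -/
  vacuum_unique : ∀ ψ : H,
    (∀ (x : closedForwardCone) (a : toNet.global),
      ⟪ψ, (α (translation x) a : H →L[ℂ] H) Ω⟫_ℂ = ⟪ψ, (a : H →L[ℂ] H) Ω⟫_ℂ) →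
    ∃ c : ℂ, ψ = c • Ω
  cyclic : ∀ O, Dense ((fun a : H →L[ℂ] H => a Ω) '' (alg O : Set (H →L[ℂ] H)))
  separating : ∀ O, ∀ a ∈ alg O, a Ω = 0 → a = 0
  duality : ∀ C : Hypercone τ,
    Set.centralizer (toNet.compl C : Set (H →L[ℂ] H)) ∩ weakClosure toNet.global =
      weakClosure (toNet.region C.1)
  duality' : ∀ C : Hypercone τ,
    Set.centralizer (toNet.region C.1 : Set (H →L[ℂ] H)) ∩ weakClosure toNet.global =
      weakClosure (toNet.compl C)
  typeIIIOne : IsTypeIIIOne (weakClosure toNet.global)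

namespace Theory

variable {τ : ℝ} {H : Type u} [NormedAddCommGroup H] [InnerProductSpace ℂ H] [CompleteSpace H]

/-- The weak closure of the global algebra. -/
def globalVN (T : Theory τ H) : VonNeumannAlgebra H := weakClosure T.global

/-- Unital `*`-homomorphisms of the global algebra into the operators on `H`. -/
abbrev Mor (T : Theory τ H) : Type u := T.global →⋆ₐ[ℂ] (H →L[ℂ] H)

/-- The identical morphism. -/
def idMor (T : Theory τ H) : T.Mor := T.global.subtype

/-- The unitaries of the weak closure of the global algebra. -/
def IsUnitaryVN (T : Theory τ H) (W : H →L[ℂ] H) : Prop :=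
  W ∈ unitary (H →L[ℂ] H) ∧ W ∈ T.globalVN

/-- `W` is a unitary intertwiner from `σ₁` to `σ₂`. -/
def Intertwines (T : Theory τ H) (W : H →L[ℂ] H) (σ₁ σ₂ : T.Mor) : Prop :=
  T.IsUnitaryVN W ∧ ∀ a, W * σ₁ a * star W = σ₂ a

/-! ### Charge classes -/

/-- The functional `ω₀ ∘ σ`, where `ω₀` is the vacuum state. -/
def vacuumComp (T : Theory τ H) (σ : T.Mor) : T.global →ₗ[ℂ] ℂ where
  toFun a := ⟪T.Ω, σ a T.Ω⟫_ℂ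
  map_add' a b := by simp
  map_smul' c a := by simp

/-- Elemental states: the weak closure of the GNS representation is a factor of type III₁. -/
def IsElemental (T : Theory τ H) (ω : T.global →ₗ[ℂ] ℂ) : Prop :=
  ∃ (E : Type u) (_ : NormedAddCommGroup E) (_ : InnerProductSpace ℂ E) (_ : CompleteSpace E)
    (π : T.global →⋆ₐ[ℂ] (E →L[ℂ] E)) (ξ : E),
    ‖ξ‖ = 1 ∧ Dense (Set.range fun a => π a ξ) ∧ (∀ a, ω a = ⟪ξ, π a ξ⟫_ℂ) ∧
    IsTypeIIIOne (weakClosure π.range)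

/-- The norm closure of the set of all `ω ∘ Ad u`, with `u` a unitary of the global algebra. -/
def chargeClass (T : Theory τ H) (ω : T.global →ₗ[ℂ] ℂ) : Set (T.global →ₗ[ℂ] ℂ) :=
  {φ | ∀ ε > 0, ∃ u ∈ unitary T.global, ∀ a, ‖φ a - ω (u * a * star u)‖ ≤ ε * ‖a‖}

/-- Charge classes of elemental states. -/
def IsChargeClass (T : Theory τ H) (Q : Set (T.global →ₗ[ℂ] ℂ)) : Prop :=
  ∃ ω, T.IsElemental ω ∧ Q = T.chargeClass ω

/-- A morphism acts trivially on the algebra of the spacelike complement of `C`. -/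
def TrivialOnCompl (T : Theory τ H) (σ : T.Mor) (C : Hypercone τ) : Prop :=
  ∀ a : T.global, (a : H →L[ℂ] H) ∈ T.compl C → σ a = a

/-- The image of the algebra of `C` under a morphism. -/
def image (T : Theory τ H) (σ : T.Mor) (C : Hypercone τ) : StarSubalgebra ℂ (H →L[ℂ] H) :=
  ((T.region C.1).comap T.global.subtype).map σ

/-- The simplicity criterion: `Q` is a charge class of elemental states, and the morphisms
`σ C`, one for each hypercone `C`, belong to `Q`, act trivially on the spacelike complement
of `C`, satisfy `σ C (𝔄 C₁)⁻ = ℜ C₁` for all larger hypercones `C₁`, and are mutually equivalent by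
inner automorphisms of the weak closure of the global algebra. -/
structure IsSimpleFamily (T : Theory τ H) (Q : Set (T.global →ₗ[ℂ] ℂ))
    (σ : Hypercone τ → T.Mor) : Prop where
  isChargeClass : T.IsChargeClass Q
  range_mem : ∀ C a, σ C a ∈ T.globalVN
  mem_class : ∀ C, T.vacuumComp (σ C) ∈ Q
  trivial_compl : ∀ C, T.TrivialOnCompl (σ C) C
  weakClosure_image : ∀ C C₁ : Hypercone τ, C.1 ⊆ C₁.1 →
    weakClosure (T.image (σ C) C₁) = weakClosure (T.region C₁.1)
  equivalent : ∀ C₁ C₂, ∃ U₁ U₂, T.IsUnitaryVN U₁ ∧ T.IsUnitaryVN U₂ ∧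
    ∀ a, U₁ * σ C₁ a * star U₁ = U₂ * σ C₂ a * star U₂

/-- The morphisms localized in the hypercone `C` which correspond to simple charge classes. -/
def Sigma (T : Theory τ H) (C : Hypercone τ) : Set T.Mor :=
  {ρ | ∃ Q σ, T.IsSimpleFamily Q σ ∧ σ C = ρ}

/-! ### Extensions and products of morphisms -/

/-- The C*-inductive limit of the von Neumann algebras of the spacelike complements of the
hypercones of a funnel. -/
def funnelAlg (T : Theory τ H) (D : ℕ → Hypercone τ) : StarSubalgebra ℂ (H →L[ℂ] H) :=
  (⨆ n, (weakClosure (T.compl (D n))).toStarSubalgebra).topologicalClosure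

/-- `ρ` extends the morphism `σ` to the algebra of a funnel, and is normal on the von Neumann
algebras of the spacelike complements of its hypercones. -/
structure IsExtension (T : Theory τ H) (σ : T.Mor) (D : ℕ → Hypercone τ)
    (ρ : T.funnelAlg D →⋆ₐ[ℂ] (H →L[ℂ] H)) : Prop where
  isFunnel : IsFunnel D
  le : T.global ≤ T.funnelAlg D
  extends_mor : ∀ a : T.global, ρ ⟨a, le a.2⟩ = σ a
  range_mem : ∀ a, ρ a ∈ T.globalVN
  normal : ∀ n, ∀ η : H, ∃ ξ : SqSummable H, ∀ a : T.funnelAlg D,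
    (a : H →L[ℂ] H) ∈ weakClosure (T.compl (D n)) → ⟪η, ρ a η⟫_ℂ = normalFunctional ξ a

/-- The product of `σ` and of the morphism `κ` localized in `C` is `ρ`: there are extensions
of `σ` to algebras of funnels with `C` in the spacelike complement of one of its hypercones (so
that the von Neumann algebra of `C` is in the domain), and for each of them the composition of the
extension with `κ` is well defined and equal to `ρ`. -/
def IsProduct (T : Theory τ H) (σ κ : T.Mor) (C : Hypercone τ) (ρ : T.Mor) : Prop :=
  (∃ D ς, T.IsExtension σ D ς ∧ ∃ m, C.1 ⊆ spacelikeCompl (D m).1) ∧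
  ∀ D ς, T.IsExtension σ D ς → (∃ m, C.1 ⊆ spacelikeCompl (D m).1) →
    ∀ a, ∃ h : κ a ∈ T.funnelAlg D, ς ⟨κ a, h⟩ = ρ a

/-- `W n` are unitary intertwiners to `σ`, localized in `C`, from morphisms in `Σ(D n)`, where
the `D n` form a funnel and lie in the spacelike complements of hypercones which contain
`C` and increase to `V`. -/
def IsTransport (T : Theory τ H) (C : Hypercone τ) (σ : T.Mor) (W : ℕ → H →L[ℂ] H) : Prop :=
  ∃ B D : ℕ → Hypercone τ, IsExhaustion B ∧ (∀ n, C.1 ⊆ (B n).1) ∧ IsFunnel D ∧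
    (∀ n, (D n).1 ⊆ spacelikeCompl (B n).1) ∧
    ∃ κ : ℕ → T.Mor, ∀ n, κ n ∈ T.Sigma (D n) ∧ T.Intertwines (W n) (κ n) σ

/-- `σ'`, localized in `C` like `σ`, is the pointwise norm limit of `Ad W n⁻¹` for sequences of
intertwiners `W n` as above; such sequences exist, and all of them have this limit. -/
def IsTransportLimit (T : Theory τ H) (C : Hypercone τ) (σ σ' : T.Mor) : Prop :=
  (∃ W, T.IsTransport C σ W) ∧
  ∀ W, T.IsTransport C σ W → ∀ a : T.global,
    Tendsto (fun n => star (W n) * (a : H →L[ℂ] H) * W n) atTop (𝓝 (σ' a))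

end Theory

end LightCone

end

noncomputable section

namespace LightCone

/-! ### Causal structure of the light cone -/

/-! Fix a simple family `σ` and a hypercone `C`. If `D` is a hypercone spacelike to `C` and `W` is a
unitary intertwiner from `σ D` to `σ C`, then `σ D` is trivial on every double cone `O` spacelike to
`D`, so `σ C` acts on the algebra of `O` as `Ad W`. This forces the local form of the conjugate: it
must be `a ↦ W* a W`. What has to be shown is that this prescription is consistent, defines a
morphism, and yields a simple family again.

Consistency combines an algebraic and a topological fact. Algebraically, shrinking `D` or changing
`W` replaces `W` by `W V` with `V` in the von Neumann algebra of `D` (hypercone duality), and `W* a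
W` commutes with that algebra, because it is the weak closure of the image of `σ D`
(`Intertwines.transport_eq`). Topologically, the hypercones spacelike to both `C` and `O` are linked
by chains of inclusions. Each hypercone contains a neighbourhood of a point at infinity, i.e. of the
unit sphere bounding the Beltrami-Klein ball, and the points at infinity away from `C` form a
connected set (`isPreconnected_pointsAway`, `eq_of_locally_constant`). Along a funnel, `W n* a W n`
is then eventually constant for local `a`, so it converges in norm on the global algebra. The
property `IsConj` records the outcome for all localized `κ` equivalent to `σ C`, whichever family
they come from, and so covers every admissible sequence of intertwiners.

The conjugates form a simple family. On the algebra of a hypercone containing `C`, the morphism and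
its conjugate are inverse inner automorphisms with a common unitary, which gives localization. If
`U` intertwines `σ C₁` and `σ C₂` and `D` is spacelike to both, then `W* U* W` intertwines the
conjugates. For the charge class, a unitary of the global von Neumann algebra must be approximated,
on the vacuum vector, by unitaries of the C*-algebra: this is Kaplansky's theorem for unitaries
(`exists_unitary_approx`), derived from the double commutant theorem by Cayley transforms.

For the products, a normal extension of a morphism that equals `Ad W` on the algebra of the
spacelike complement of `D n` equals `Ad W` on its weak closure (`IsExtension.apply_eq_conj`). The
composition with the other morphism is therefore `Ad W` after `Ad W*`, or the reverse, on local
operators, and the identity everywhere by continuity. -/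

lemma mink_eq (x y : Spacetime) :
    mink x y = x 0 * y 0 - (x 1 * y 1 + x 2 * y 2 + x 3 * y 3) := by
  simp [mink, Fin.sum_univ_three]

lemma mink_sub_comm (x y : Spacetime) : mink (x - y) (x - y) = mink (y - x) (y - x) := by
  simp only [mink_eq, Pi.sub_apply]; ring

lemma forwardCone_subset_closed {x : Spacetime} (hx : x ∈ forwardCone) :
    x ∈ closedForwardCone := ⟨hx.1.le, hx.2.le⟩

lemma mink_nonneg {x y : Spacetime} (hx : x ∈ closedForwardCone) (hy : y ∈ closedForwardCone) :
    0 ≤ mink x y := by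
  obtain ⟨hx0, hx⟩ := hx
  obtain ⟨hy0, hy⟩ := hy
  rw [mink_eq] at *
  have key : (x 1 * y 1 + x 2 * y 2 + x 3 * y 3) ^ 2 ≤ (x 0 * y 0) ^ 2 := by
    have h1 : (x 1 * y 1 + x 2 * y 2 + x 3 * y 3) ^ 2 ≤
        (x 1 ^ 2 + x 2 ^ 2 + x 3 ^ 2) * (y 1 ^ 2 + y 2 ^ 2 + y 3 ^ 2) := by
      nlinarith [sq_nonneg (x 1 * y 2 - x 2 * y 1), sq_nonneg (x 1 * y 3 - x 3 * y 1),
        sq_nonneg (x 2 * y 3 - x 3 * y 2)]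
    have h2 : (x 1 ^ 2 + x 2 ^ 2 + x 3 ^ 2) * (y 1 ^ 2 + y 2 ^ 2 + y 3 ^ 2) ≤
        x 0 ^ 2 * y 0 ^ 2 :=
      mul_le_mul (by nlinarith) (by nlinarith) (by positivity) (by positivity)
    nlinarith
  have := abs_le_of_sq_le_sq' key (by positivity)
  linarith [this.2]

lemma closedForwardCone_add {x y : Spacetime} (hx : x ∈ closedForwardCone)
    (hy : y ∈ closedForwardCone) : x + y ∈ closedForwardCone := by
  refine ⟨add_nonneg hx.1 hy.1, ?_⟩
  have h := mink_nonneg hx hy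
  have h1 := hx.2
  have h2 := hy.2
  simp only [mink_eq, Pi.add_apply] at *
  nlinarith

lemma forwardCone_add_closed {x y : Spacetime} (hx : x ∈ forwardCone)
    (hy : y ∈ closedForwardCone) : x + y ∈ forwardCone := by
  refine ⟨add_pos_of_pos_of_nonneg hx.1 hy.1, ?_⟩
  have h := mink_nonneg (forwardCone_subset_closed hx) hy
  have h1 := hx.2
  have h2 := hy.2
  simp only [mink_eq, Pi.add_apply] at *
  nlinarith

lemma smul_mem_closedForwardCone {x : Spacetime} (hx : x ∈ closedForwardCone) {t : ℝ}
    (ht : 0 ≤ t) : t • x ∈ closedForwardCone := by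
  refine ⟨mul_nonneg ht hx.1, ?_⟩
  have : mink (t • x) (t • x) = t ^ 2 * mink x x := by
    simp only [mink_eq, Pi.smul_apply, smul_eq_mul]; ring
  rw [this]
  exact mul_nonneg (sq_nonneg t) hx.2

lemma smul_mem_forwardCone {x : Spacetime} (hx : x ∈ forwardCone) {t : ℝ}
    (ht : 0 < t) : t • x ∈ forwardCone := by
  refine ⟨mul_pos ht hx.1, ?_⟩
  have : mink (t • x) (t • x) = t ^ 2 * mink x x := by
    simp only [mink_eq, Pi.smul_apply, smul_eq_mul]; ring
  rw [this]
  exact mul_pos (pow_pos ht 2) hx.2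

lemma mem_closedForwardCone_or {x : Spacetime} (hx : 0 ≤ mink x x) :
    x ∈ closedForwardCone ∨ -x ∈ closedForwardCone := by
  rcases le_total 0 (x 0) with h | h
  · exact Or.inl ⟨h, hx⟩
  · refine Or.inr ⟨by simpa using h, ?_⟩
    simpa [mink_eq] using hx

@[fun_prop]
lemma continuous_mink {X : Type*} [TopologicalSpace X] {f g : X → Spacetime}
    (hf : Continuous f) (hg : Continuous g) : Continuous fun x => mink (f x) (g x) := by
  simp only [mink_eq]; fun_prop

lemma isOpen_forwardCone : IsOpen forwardCone :=
  (isOpen_lt continuous_const (continuous_apply 0)).inter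
    (isOpen_lt continuous_const (continuous_mink continuous_id continuous_id))

lemma isClosed_closedForwardCone : IsClosed closedForwardCone :=
  (isClosed_le continuous_const (continuous_apply 0)).inter
    (isClosed_le continuous_const (continuous_mink continuous_id continuous_id))

/-- The time component of a causal vector is controlled by its product with a timelike one. -/
lemma exists_mul_time_le_mink {a : Spacetime} (ha : a ∈ forwardCone) :
    ∃ c > 0, ∀ z ∈ closedForwardCone, c * z 0 ≤ mink z a := by
  obtain ⟨h0, h1⟩ := ha
  -- This `c` gives `a - c e₀` the square `c²`, so `a - c e₀` is still causal. Its product with `z`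
  -- is nonnegative, and `e₀` contributes `c * z 0`.
  refine ⟨mink a a / (2 * a 0), by positivity, fun z hz => ?_⟩
  set c := mink a a / (2 * a 0) with hc
  have hcm : 2 * a 0 * c = mink a a := by rw [hc]; field_simp
  have hc0 : 0 < c := by rw [hc]; positivity
  have hb : a - c • Pi.single 0 1 ∈ closedForwardCone := by
    constructor
    · simp
      rw [mink_eq] at hcm
      nlinarith [sq_nonneg (a 1), sq_nonneg (a 2), sq_nonneg (a 3)]
    · simp [mink_eq] at hcm ⊢
      nlinarith
  have := mink_nonneg hz hb
  simp [mink_eq] at this ⊢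
  linarith

lemma hyperboloid_subset {τ : ℝ} (hτ : 0 < τ) {z : Spacetime} (hz : z ∈ hyperboloid τ) :
    z ∈ forwardCone := ⟨hz.1, by rw [hz.2]; positivity⟩

lemma isOpen_doubleCone {O : Set Spacetime} (hO : IsDoubleCone O) : IsOpen O := by
  obtain ⟨a, -, b, -, rfl⟩ := hO
  exact (isOpen_forwardCone.preimage (by fun_prop : Continuous fun x : Spacetime => x - a)).inter
    (isOpen_forwardCone.preimage (by fun_prop : Continuous fun x : Spacetime => b - x))

lemma doubleCone_subset {O : Set Spacetime} (hO : IsDoubleCone O) : O ⊆ forwardCone := by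
  obtain ⟨a, ha, b, -, rfl⟩ := hO
  intro x hx
  have := forwardCone_add_closed ha (forwardCone_subset_closed hx.1)
  simpa using this

lemma exists_doubleCone_mem {y : Spacetime} (hy : y ∈ forwardCone) :
    ∃ O : DoubleCone, y ∈ O.1 := by
  have h2 : (1 / 2 : ℝ) • y ∈ forwardCone := smul_mem_forwardCone hy (by norm_num)
  refine ⟨⟨_, (1 / 2 : ℝ) • y, h2, (2 : ℝ) • y, ?_, rfl⟩, ?_, ?_⟩
  · rw [← sub_smul]; exact smul_mem_forwardCone hy (by norm_num)
  · nth_rewrite 1 [← one_smul ℝ y]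
    rw [← sub_smul]; exact smul_mem_forwardCone hy (by norm_num)
  · nth_rewrite 2 [← one_smul ℝ y]
    rw [← sub_smul]; exact smul_mem_forwardCone hy (by norm_num)

/-- Points of the hyperboloid in causal contact with a double cone have bounded time component. -/
lemma exists_time_bound {τ : ℝ} (hτ : 0 < τ) (O : DoubleCone) :
    ∃ M > 0, ∀ y ∈ O.1, ∀ z ∈ hyperboloid τ, 0 ≤ mink (y - z) (y - z) → z 0 ≤ M := by
  obtain ⟨O, a, ha, b, hb, rfl⟩ := O
  obtain ⟨c, hc, hca⟩ := exists_mul_time_le_mink ha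
  refine ⟨max (b 0) (τ ^ 2 / c), lt_max_of_lt_right (by positivity), ?_⟩
  rintro y ⟨hy1, hy2⟩ z hz hyz
  have hz' := forwardCone_subset_closed (hyperboloid_subset hτ hz)
  -- If `z` is in the past of `y`, its time is below that of `b`. Otherwise `z` is in the future of
  -- `a`, and `0 ≤ z·(z - a) = τ² - z·a` bounds `c * z 0` by `τ²`.
  rcases mem_closedForwardCone_or hyz with h | h
  · have h1 := h.1
    have h2 := hy2.1
    simp at h1 h2
    exact le_max_of_le_left (by linarith)
  · have h1 : z - a ∈ closedForwardCone := by
      have := closedForwardCone_add (forwardCone_subset_closed hy1) h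
      simpa using this
    have h2 := mink_nonneg hz' h1
    have h3 := hca z hz'
    have h4 := hz.2
    refine le_max_of_le_right ?_
    rw [le_div_iff₀ hc]
    have : mink z (z - a) = mink z z - mink z a := by
      simp only [mink_eq, Pi.sub_apply]; ring
    linarith

/-- The closed double cone serves as `J`. Compactness inside `V` is what places a double cone in a
single member of an increasing open exhaustion. -/
lemma exists_compact_superset (O : DoubleCone) : ∃ J, IsCompact J ∧ O.1 ⊆ J ∧ J ⊆ forwardCone := by
  obtain ⟨O, a, ha, b, hb, rfl⟩ := O
  refine ⟨{x | x - a ∈ closedForwardCone ∧ b - x ∈ closedForwardCone}, ?_,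
    fun x hx => ⟨forwardCone_subset_closed hx.1, forwardCone_subset_closed hx.2⟩,
    fun x hx => by simpa using forwardCone_add_closed ha hx.1⟩
  refine IsCompact.of_isClosed_subset
    (isCompact_univ_pi (fun _ : Fin 4 => isCompact_Icc (a := -(b 0)) (b := b 0))) ?_ ?_
  · exact (isClosed_closedForwardCone.preimage
      (by fun_prop : Continuous fun x : Spacetime => x - a)).inter
      (isClosed_closedForwardCone.preimage (by fun_prop : Continuous fun x : Spacetime => b - x))
  · intro x hx
    have h1 : x ∈ forwardCone := by simpa using forwardCone_add_closed ha hx.1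
    have h2 := hx.2.1
    simp at h2
    obtain ⟨h3, h4⟩ := h1
    rw [mink_eq] at h4
    have key : ∀ i, x i ^ 2 ≤ b 0 ^ 2 := by
      have : x 0 ^ 2 ≤ b 0 ^ 2 := by gcongr
      intro i
      fin_cases i <;> simp <;> nlinarith [sq_nonneg (x 1), sq_nonneg (x 2), sq_nonneg (x 3)]
    intro i _
    exact abs_le_of_sq_le_sq' (key i) (by linarith)

/-- The hyperboloid is a Cauchy surface of the cone: causal curves between points of the cone
can be replaced by curves meeting the hyperboloid. -/
lemma exists_mem_hyperboloid_between {τ : ℝ} (hτ : 0 < τ) {y w : Spacetime}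
    (hy : y ∈ forwardCone) (hw : w ∈ forwardCone) (h : 0 ≤ mink (y - w) (y - w)) :
    ∃ z ∈ hyperboloid τ, 0 ≤ mink (y - z) (y - z) ∧ 0 ≤ mink (w - z) (w - z) := by
  wlog hyw : w - y ∈ closedForwardCone generalizing y w
  · obtain ⟨z, hz, h1, h2⟩ := this hw hy (by rwa [mink_sub_comm]) (by
      rcases mem_closedForwardCone_or h with h | h
      · exact h
      · exact absurd (by simpa using h) hyw)
    exact ⟨z, hz, h2, h1⟩
  have ray : ∀ {x : Spacetime}, x ∈ forwardCone → (τ / √(mink x x)) • x ∈ hyperboloid τ := by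
    intro x hx
    have hs : 0 < √(mink x x) := Real.sqrt_pos.2 hx.2
    refine ⟨(smul_mem_forwardCone hx (by positivity)).1, ?_⟩
    have : mink ((τ / √(mink x x)) • x) ((τ / √(mink x x)) • x)
        = τ ^ 2 * (mink x x / √(mink x x) ^ 2) := by
      simp only [mink_eq, Pi.smul_apply, smul_eq_mul]; field_simp
    rw [this, Real.sq_sqrt hx.2.le, div_self hx.2.ne', mul_one]
  -- If `y` lies above the hyperboloid, scale it down; if `w` lies below, scale it up. Otherwise the
  -- segment from `y` to `w` crosses the hyperboloid.
  rcases le_total (τ ^ 2) (mink y y) with h1 | h1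
  · have hs : 0 < √(mink y y) := Real.sqrt_pos.2 hy.2
    have hle : τ / √(mink y y) ≤ 1 := by
      rw [div_le_one hs]; exact Real.le_sqrt_of_sq_le h1
    have h3 : y - (τ / √(mink y y)) • y ∈ closedForwardCone := by
      nth_rewrite 1 [← one_smul ℝ y]
      rw [← sub_smul]
      exact smul_mem_closedForwardCone (forwardCone_subset_closed hy) (by linarith)
    refine ⟨_, ray hy, h3.2, ?_⟩
    have := (closedForwardCone_add hyw h3).2
    simpa using this
  rcases le_total (mink w w) (τ ^ 2) with h2 | h2
  · have hs : 0 < √(mink w w) := Real.sqrt_pos.2 hw.2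
    have hle : 1 ≤ τ / √(mink w w) := by
      rw [one_le_div hs]; exact Real.sqrt_le_iff.2 ⟨hτ.le, h2⟩
    have h3 : (τ / √(mink w w)) • w - w ∈ closedForwardCone := by
      rw [show (τ / √(mink w w)) • w - w = (τ / √(mink w w) - 1) • w by rw [sub_smul, one_smul]]
      exact smul_mem_closedForwardCone (forwardCone_subset_closed hw) (by linarith)
    refine ⟨_, ray hw, ?_, ?_⟩
    · rw [mink_sub_comm]
      have := (closedForwardCone_add h3 hyw).2
      simpa using this
    · rw [mink_sub_comm]; exact h3.2
  · have hcont : ContinuousOn (fun t : ℝ => mink (y + t • (w - y)) (y + t • (w - y)))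
        (Set.Icc 0 1) := by fun_prop
    obtain ⟨t, ht, hmt⟩ := intermediate_value_Icc zero_le_one hcont
      (show τ ^ 2 ∈ Set.Icc _ _ by simpa using ⟨h1, h2⟩)
    refine ⟨y + t • (w - y), ⟨?_, hmt⟩, ?_, ?_⟩
    · exact (forwardCone_add_closed hy (smul_mem_closedForwardCone hyw ht.1)).1
    · rw [mink_sub_comm, add_sub_cancel_left]
      exact (smul_mem_closedForwardCone hyw ht.1).2
    · have : w - (y + t • (w - y)) = (1 - t) • (w - y) := by
        rw [sub_smul, one_smul]; abel
      rw [this]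
      exact (smul_mem_closedForwardCone hyw (by linarith [ht.2])).2

/-! ### Spacelike complements -/

lemma isOpen_spacelikeCompl (X : Set Spacetime) : IsOpen (spacelikeCompl X) := isOpen_interior

lemma spacelikeCompl_subset (X : Set Spacetime) : spacelikeCompl X ⊆ forwardCone :=
  fun _ hx => (interior_subset hx).1

lemma spacelike_of_mem {X : Set Spacetime} {x y : Spacetime} (hy : y ∈ spacelikeCompl X)
    (hx : x ∈ X) : mink (x - y) (x - y) < 0 := (interior_subset hy).2 x hx

lemma spacelikeCompl_anti {X Y : Set Spacetime} (h : X ⊆ Y) :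
    spacelikeCompl Y ⊆ spacelikeCompl X :=
  interior_mono fun _ hy => ⟨hy.1, fun x hx => hy.2 x (h hx)⟩

lemma mem_spacelikeCompl_of_open {X O : Set Spacetime} (hO : IsOpen O) (hOV : O ⊆ forwardCone)
    (h : ∀ y ∈ O, ∀ x ∈ X, mink (x - y) (x - y) < 0) : O ⊆ spacelikeCompl X :=
  interior_maximal (fun y hy => ⟨hOV hy, h y hy⟩) hO

lemma subset_causalCompletion_of_isOpen {X : Set Spacetime} (hX : IsOpen X)
    (hXV : X ⊆ forwardCone) : X ⊆ causalCompletion X :=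
  mem_spacelikeCompl_of_open hX hXV fun y hy x hx => by
    rw [mink_sub_comm]; exact spacelike_of_mem hx hy

lemma subset_spacelikeCompl_symm {X Y : Set Spacetime} (hX : IsOpen X) (hXV : X ⊆ forwardCone)
    (h : Y ⊆ spacelikeCompl X) : X ⊆ spacelikeCompl Y :=
  (subset_causalCompletion_of_isOpen hX hXV).trans (spacelikeCompl_anti h)

/-- If all points of the hyperboloid in causal contact with `O` belong to `X`, then `O` belongs to
the domain of dependence of `X`. -/
lemma subset_causalCompletion_of_shadow {τ : ℝ} (hτ : 0 < τ) {X O : Set Spacetime} (hO : IsOpen O)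
    (hOV : O ⊆ forwardCone)
    (h : ∀ y ∈ O, ∀ z ∈ hyperboloid τ, 0 ≤ mink (y - z) (y - z) → z ∈ X) :
    O ⊆ causalCompletion X := by
  refine mem_spacelikeCompl_of_open hO hOV fun y hy w hw => ?_
  by_contra! hyw
  obtain ⟨z, hz, h1, h2⟩ := exists_mem_hyperboloid_between hτ (hOV hy)
    (spacelikeCompl_subset X hw) (by rwa [mink_sub_comm])
  have h3 := spacelike_of_mem hw (h y hy z hz h1)
  rw [mink_sub_comm] at h3
  linarith

/-- Different points of the hyperboloid are spacelike separated. -/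
lemma spacelike_of_hyperboloid {τ : ℝ} (hτ : 0 < τ) {x z : Spacetime} (hx : x ∈ hyperboloid τ)
    (hz : z ∈ hyperboloid τ) (hne : x ≠ z) : mink (x - z) (x - z) < 0 := by
  by_contra! h
  wlog hc : x - z ∈ closedForwardCone generalizing x z
  · rcases mem_closedForwardCone_or h with h' | h'
    · exact hc h'
    · exact this hz hx hne.symm (by rwa [mink_sub_comm]) (by simpa using h')
  obtain ⟨c, hc0, hcz⟩ := exists_mul_time_le_mink (hyperboloid_subset hτ hz)
  have h1 := hcz _ hc
  have hxx := hx.2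
  have hzz := hz.2
  -- Since `x² = z²`, a causal difference `x - z` has nonpositive product with the timelike `z`.
  -- This product dominates a positive multiple of its time component, which therefore vanishes.
  have h2 : mink (x - z) z = - mink (x - z) (x - z) / 2 := by
    simp only [mink_eq, Pi.sub_apply] at *; linarith
  have h3 : (x - z) 0 = 0 := le_antisymm (by nlinarith) hc.1
  apply hne
  have h4 := hc.2
  rw [mink_eq, h3] at h4
  have h5 : (x - z) 1 = 0 := by nlinarith [sq_nonneg ((x - z) 1), sq_nonneg ((x - z) 2), sq_nonneg ((x - z) 3)]
  have h6 : (x - z) 2 = 0 := by nlinarith [sq_nonneg ((x - z) 1), sq_nonneg ((x - z) 2), sq_nonneg ((x - z) 3)]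
  have h7 : (x - z) 3 = 0 := by nlinarith [sq_nonneg ((x - z) 1), sq_nonneg ((x - z) 2), sq_nonneg ((x - z) 3)]
  rw [← sub_eq_zero]
  ext i
  fin_cases i <;> assumption

lemma isClosed_hyperboloid {τ : ℝ} (hτ : 0 < τ) : IsClosed (hyperboloid τ) := by
  have : hyperboloid τ = {x | 0 ≤ x 0 ∧ mink x x = τ ^ 2} := by
    ext x
    refine ⟨fun h => ⟨h.1.le, h.2⟩, fun h => ⟨lt_of_le_of_ne h.1 fun h0 => ?_, h.2⟩⟩
    have h2 := h.2
    rw [mink_eq, ← h0] at h2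
    nlinarith [sq_nonneg (x 1), sq_nonneg (x 2), sq_nonneg (x 3), pow_pos hτ 2]
  rw [this]
  exact (isClosed_le continuous_const (continuous_apply 0)).inter
    (isClosed_eq (continuous_mink continuous_id continuous_id) continuous_const)

/-- The points of the hyperboloid in causal contact with points near `x` are near `x`. -/
lemma exists_open_shadow_subset {τ : ℝ} (hτ : 0 < τ) {x : Spacetime} (hx : x ∈ hyperboloid τ)
    {N : Set Spacetime} (hN : IsOpen N) (hxN : x ∈ N) :
    ∃ O, IsOpen O ∧ x ∈ O ∧ O ⊆ forwardCone ∧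
      ∀ y ∈ O, ∀ z ∈ hyperboloid τ, 0 ≤ mink (y - z) (y - z) → z ∈ N := by
  obtain ⟨O, hxO⟩ := exists_doubleCone_mem (hyperboloid_subset hτ hx)
  obtain ⟨M, hM, hMO⟩ := exists_time_bound hτ O
  have hK : IsCompact ((hyperboloid τ ∩ {z | z 0 ≤ M}) \ N) := by
    refine IsCompact.of_isClosed_subset
      (isCompact_univ_pi (fun _ : Fin 4 => isCompact_Icc (a := -M) (b := M)))
      (((isClosed_hyperboloid hτ).inter
        (isClosed_le (continuous_apply 0) continuous_const)).sdiff hN) ?_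
    rintro z ⟨⟨⟨h0, h1⟩, h2⟩, -⟩
    rw [mink_eq] at h1
    simp only [Set.mem_ofPred_eq] at h2
    have key : ∀ i, z i ^ 2 ≤ M ^ 2 := by
      have : z 0 ^ 2 ≤ M ^ 2 := by gcongr
      intro i
      fin_cases i <;> simp <;>
        nlinarith [sq_nonneg (z 1), sq_nonneg (z 2), sq_nonneg (z 3), pow_pos hτ 2]
    intro i _
    exact abs_le_of_sq_le_sq' (key i) hM.le
  -- The shell points outside `N` that `O` can reach causally lie in a compact set, and all its
  -- points are strictly spacelike to `x`. The tube lemma keeps them spacelike to every point near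
  -- `x`.
  obtain ⟨u, v, hu, -, hxu, hKv, huv⟩ := generalized_tube_lemma (isCompact_singleton (x := x)) hK
    (n := {p : Spacetime × Spacetime | mink (p.1 - p.2) (p.1 - p.2) < 0})
    (isOpen_lt (by fun_prop) continuous_const) (by
      rintro ⟨p, z⟩ ⟨rfl, hz⟩
      exact spacelike_of_hyperboloid hτ hx hz.1.1 (fun h => hz.2 (h ▸ hxN)))
  refine ⟨u ∩ O.1, hu.inter (isOpen_doubleCone O.2), ⟨hxu rfl, hxO⟩,
    fun y hy => doubleCone_subset O.2 hy.2, fun y hy z hz hyz => ?_⟩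
  by_contra hzN
  have hzM : z ∈ {z : Spacetime | z 0 ≤ M} := by simpa using hMO y hy.2 z hz hyz
  have := huv (Set.mk_mem_prod hy.1 (hKv ⟨⟨hz, hzM⟩, hzN⟩))
  simp only [Set.mem_ofPred_eq] at this
  linarith

/-! ### The Beltrami-Klein model -/

/-- The part of the hyperboloid over a subset of the Beltrami-Klein ball. -/
def shell (τ : ℝ) (K : Set (Fin 3 → ℝ)) : Set Spacetime :=
  {a | a ∈ hyperboloid τ ∧ beltramiKlein a ∈ K}

/-- The cap of the ball around the point `q` of the unit sphere. -/
def cap (q : Fin 3 → ℝ) (δ : ℝ) : Set (Fin 3 → ℝ) :=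
  {u | u ∈ kleinBall ∧ 1 - δ < dotProduct u q}

lemma mem_kleinBall {u : Fin 3 → ℝ} : u ∈ kleinBall ↔ dotProduct u u < 1 := by
  simp [kleinBall, dotProduct, pow_two]

lemma cap_mono {q : Fin 3 → ℝ} {δ δ' : ℝ} (h : δ ≤ δ') : cap q δ ⊆ cap q δ' :=
  fun _ hu => ⟨hu.1, by linarith [hu.2]⟩

lemma isOpen_kleinBall : IsOpen kleinBall :=
  isOpen_lt (by fun_prop) continuous_const

lemma dotProduct_sq_le (u q : Fin 3 → ℝ) :
    dotProduct u q ^ 2 ≤ dotProduct u u * dotProduct q q := by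
  simp only [dotProduct, Fin.sum_univ_three]
  nlinarith [sq_nonneg (u 0 * q 1 - u 1 * q 0), sq_nonneg (u 0 * q 2 - u 2 * q 0),
    sq_nonneg (u 1 * q 2 - u 2 * q 1)]

lemma dotProduct_self_nonneg' (u : Fin 3 → ℝ) : 0 ≤ dotProduct u u := by
  simp only [dotProduct, Fin.sum_univ_three]; nlinarith [sq_nonneg (u 0), sq_nonneg (u 1), sq_nonneg (u 2)]

lemma dotProduct_self_pos' {u : Fin 3 → ℝ} (h : u ≠ 0) : 0 < dotProduct u u := by
  refine lt_of_le_of_ne (dotProduct_self_nonneg' u) fun h0 => h ?_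
  simp only [dotProduct, Fin.sum_univ_three] at h0
  ext i
  fin_cases i <;> simp <;> nlinarith [sq_nonneg (u 0), sq_nonneg (u 1), sq_nonneg (u 2)]

lemma continuous_dotProduct_left (q : Fin 3 → ℝ) :
    Continuous fun u : Fin 3 → ℝ => dotProduct u q := by
  simp only [dotProduct]; fun_prop

/-- Turns bounds on time components into a positive distance from the unit sphere, the set of points
at infinity of the hyperboloid. -/
lemma one_sub_beltramiKlein {τ : ℝ} {z : Spacetime} (hz : z ∈ hyperboloid τ) :
    1 - dotProduct (beltramiKlein z) (beltramiKlein z) = τ ^ 2 / z 0 ^ 2 := by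
  obtain ⟨h0, h1⟩ := hz
  rw [mink_eq] at h1
  simp only [dotProduct, beltramiKlein, Fin.sum_univ_three, Fin.succ_zero_eq_one,
    Fin.succ_one_eq_two, show (2 : Fin 3).succ = (3 : Fin 4) from rfl]
  rw [← h1]
  field_simp

lemma beltramiKlein_mem {τ : ℝ} (hτ : 0 < τ) {z : Spacetime} (hz : z ∈ hyperboloid τ) :
    beltramiKlein z ∈ kleinBall := by
  rw [mem_kleinBall]
  have h := one_sub_beltramiKlein hz
  have h0 := hz.1
  have : 0 < τ ^ 2 / z 0 ^ 2 := by positivity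
  linarith

lemma exists_beltramiKlein_eq {τ : ℝ} (hτ : 0 < τ) {u : Fin 3 → ℝ} (hu : u ∈ kleinBall) :
    ∃ z ∈ hyperboloid τ, beltramiKlein z = u := by
  rw [mem_kleinBall] at hu
  set s := √(1 - dotProduct u u) with hs
  have hs0 : 0 < s := Real.sqrt_pos.2 (by linarith)
  have hs2 : s ^ 2 = 1 - dotProduct u u := Real.sq_sqrt (by linarith)
  refine ⟨Fin.cons (τ / s) (fun i => τ / s * u i), ⟨by simp; positivity, ?_⟩, ?_⟩
  · simp only [mink, Fin.cons_zero, Fin.cons_succ, Fin.sum_univ_three]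
    simp only [dotProduct, Fin.sum_univ_three] at hs2
    have : τ / s * (τ / s) - (τ / s * u 0 * (τ / s * u 0) + τ / s * u 1 * (τ / s * u 1)
      + τ / s * u 2 * (τ / s * u 2)) = τ ^ 2 * ((1 - (u 0 * u 0 + u 1 * u 1 + u 2 * u 2)) / s ^ 2)
      := by field_simp
    rw [this, ← hs2, div_self (by positivity), mul_one]
  · ext i
    simp [beltramiKlein]
    field_simp

lemma shell_mono {τ : ℝ} {K L : Set (Fin 3 → ℝ)} (h : K ⊆ L) : shell τ K ⊆ shell τ L :=
  fun _ hz => ⟨hz.1, h hz.2⟩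

/-- The hypercone over a subset of the ball. -/
def coneOver (τ : ℝ) (K : Set (Fin 3 → ℝ)) : Set Spacetime := causalCompletion (shell τ K)

lemma coneOver_mono {τ : ℝ} {K L : Set (Fin 3 → ℝ)} (h : K ⊆ L) : coneOver τ K ⊆ coneOver τ L :=
  spacelikeCompl_anti (spacelikeCompl_anti (shell_mono h))

lemma isOpen_coneOver (τ : ℝ) (K : Set (Fin 3 → ℝ)) : IsOpen (coneOver τ K) := isOpen_interior

lemma coneOver_subset (τ : ℝ) (K : Set (Fin 3 → ℝ)) : coneOver τ K ⊆ forwardCone :=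
  spacelikeCompl_subset _

lemma exists_shadow_subset_shell {τ : ℝ} (hτ : 0 < τ) {K : Set (Fin 3 → ℝ)} (hK : IsOpen K)
    {x : Spacetime} (hx : x ∈ shell τ K) :
    ∃ O, IsOpen O ∧ x ∈ O ∧ O ⊆ forwardCone ∧
      ∀ y ∈ O, ∀ z ∈ hyperboloid τ, 0 ≤ mink (y - z) (y - z) → z ∈ shell τ K := by
  have hcont : ContinuousOn beltramiKlein {z : Spacetime | 0 < z 0} := by
    unfold beltramiKlein
    refine continuousOn_pi.2 fun i => ContinuousOn.div (by fun_prop) (by fun_prop) ?_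
    intro z hz
    exact (show 0 < z 0 from hz).ne'
  have hopen := hcont.isOpen_inter_preimage (isOpen_lt continuous_const (continuous_apply 0)) hK
  obtain ⟨O, h1, h2, h3, h4⟩ := exists_open_shadow_subset hτ hx.1 hopen ⟨hx.1.1, hx.2⟩
  exact ⟨O, h1, h2, h3, fun y hy z hz hyz => ⟨hz, (h4 y hy z hz hyz).2⟩⟩

lemma shell_subset_coneOver {τ : ℝ} (hτ : 0 < τ) {K : Set (Fin 3 → ℝ)} (hK : IsOpen K) :
    shell τ K ⊆ coneOver τ K := by
  intro x hx
  obtain ⟨O, h1, h2, h3, h4⟩ := exists_shadow_subset_shell hτ hK hx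
  exact subset_causalCompletion_of_shadow hτ h1 h3 h4 h2

/-- Complements reverse inclusions, so only the shell over `K` has to be compared with that over
`L`. Points near the former have their shadow over `K`, hence no causal contact with the latter. -/
lemma coneOver_subset_compl_of_disjoint {τ : ℝ} (hτ : 0 < τ) {K L : Set (Fin 3 → ℝ)} (hK : IsOpen K)
    (h : Disjoint K L) : coneOver τ K ⊆ spacelikeCompl (coneOver τ L) := by
  refine spacelikeCompl_anti (spacelikeCompl_anti ?_)
  intro x hx
  obtain ⟨O, h1, h2, h3, h4⟩ := exists_shadow_subset_shell hτ hK hx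
  refine mem_spacelikeCompl_of_open h1 h3 (fun y hy z hz => ?_) h2
  by_contra! hzy
  exact h.le_bot ⟨(h4 y hy z hz.1 (by rwa [mink_sub_comm])).2, hz.2⟩

/-- A common point would lift to a point of the hyperboloid that is spacelike to itself. -/
lemma disjoint_of_coneOver_subset_compl {τ : ℝ} (hτ : 0 < τ) {K L : Set (Fin 3 → ℝ)} (hK : IsOpen K)
    (hL : IsOpen L) (hKb : K ⊆ kleinBall) (h : coneOver τ K ⊆ spacelikeCompl (coneOver τ L)) :
    Disjoint K L := by
  refine Set.disjoint_left.2 fun u hu hu' => ?_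
  obtain ⟨z, hz, rfl⟩ := exists_beltramiKlein_eq hτ (hKb hu)
  have h1 := spacelike_of_mem (h (shell_subset_coneOver hτ hK ⟨hz, hu⟩))
    (shell_subset_coneOver hτ hL ⟨hz, hu'⟩)
  simp [mink_eq] at h1

/-- The shadow of a double cone on the hyperboloid stays away from infinity. -/
lemma exists_shadow_bound {τ : ℝ} (hτ : 0 < τ) (O : DoubleCone) :
    ∃ ε > 0, ∀ q : Fin 3 → ℝ, dotProduct q q = 1 → ∀ y ∈ O.1, ∀ z ∈ hyperboloid τ,
      0 ≤ mink (y - z) (y - z) → dotProduct (beltramiKlein z) q ≤ 1 - ε := by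
  obtain ⟨M, hM, h⟩ := exists_time_bound hτ O
  -- With `s` the scalar product in question, `s² ≤ 1 - τ²/M²`. The factor `1/2` comes from `s ≤ (1
  -- + s²)/2`, and the bound does not depend on `q`.
  refine ⟨τ ^ 2 / M ^ 2 / 2, by positivity, fun q hq y hy z hz hyz => ?_⟩
  have h1 := h y hy z hz hyz
  have h2 := one_sub_beltramiKlein hz
  have h0 := hz.1
  have h3 : τ ^ 2 / M ^ 2 ≤ τ ^ 2 / z 0 ^ 2 := by gcongr
  have h4 := dotProduct_sq_le (beltramiKlein z) q
  rw [hq, mul_one] at h4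
  nlinarith [sq_nonneg (dotProduct (beltramiKlein z) q - 1)]

lemma doubleCone_subset_compl_coneOver {τ : ℝ} {O : DoubleCone} {ε : ℝ} {q : Fin 3 → ℝ}
    (h : ∀ y ∈ O.1, ∀ z ∈ hyperboloid τ,
      0 ≤ mink (y - z) (y - z) → dotProduct (beltramiKlein z) q ≤ 1 - ε)
    {K : Set (Fin 3 → ℝ)} (hK : K ⊆ cap q ε) : O.1 ⊆ spacelikeCompl (coneOver τ K) := by
  have h1 : O.1 ⊆ spacelikeCompl (shell τ K) := by
    refine mem_spacelikeCompl_of_open (isOpen_doubleCone O.2) (doubleCone_subset O.2) ?_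
    intro y hy z hz
    by_contra! hzy
    have h2 := h y hy z hz.1 (by rwa [mink_sub_comm])
    have h3 := (hK hz.2).2
    linarith
  exact h1.trans (subset_causalCompletion_of_isOpen (isOpen_spacelikeCompl _)
    (spacelikeCompl_subset _))

lemma doubleCone_subset_coneOver {τ : ℝ} (hτ : 0 < τ) {O : DoubleCone} {ε ε' : ℝ} {q : Fin 3 → ℝ}
    (h : ∀ y ∈ O.1, ∀ z ∈ hyperboloid τ,
      0 ≤ mink (y - z) (y - z) → dotProduct (beltramiKlein z) q ≤ 1 - ε) (hε : ε' < ε)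
    {K : Set (Fin 3 → ℝ)} (hK : ∀ u ∈ kleinBall, dotProduct u q < 1 - ε' → u ∈ K) :
    O.1 ⊆ coneOver τ K :=
  subset_causalCompletion_of_shadow hτ (isOpen_doubleCone O.2) (doubleCone_subset O.2)
    fun y hy z hz hyz => ⟨hz, hK _ (beltramiKlein_mem hτ hz) (by linarith [h y hy z hz hyz])⟩

/-! ### Cones in the Beltrami-Klein ball -/

/-- The caps form a neighbourhood basis. -/
lemma exists_cap_subset {q : Fin 3 → ℝ} (hq : dotProduct q q = 1) {G : Set (Fin 3 → ℝ)}
    (hG : IsOpen G) (hqG : q ∈ G) : ∃ δ > 0, cap q δ ⊆ G := by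
  obtain ⟨r, hr, hrG⟩ := Metric.isOpen_iff.1 hG q hqG
  -- In the cap, `|u - q|² = |u|² + 1 - 2 u·q < 2δ`, which is `r²`.
  refine ⟨r ^ 2 / 2, by positivity, fun u hu => hrG ?_⟩
  obtain ⟨h1, h2⟩ := hu
  rw [mem_kleinBall] at h1
  rw [Metric.mem_ball, dist_pi_lt_iff hr]
  simp only [dotProduct, Fin.sum_univ_three] at *
  have key : ∀ i, (u i - q i) ^ 2 < r ^ 2 := by
    intro i
    fin_cases i <;> simp <;>
      nlinarith [sq_nonneg (u 0 - q 0), sq_nonneg (u 1 - q 1), sq_nonneg (u 2 - q 2)]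
  intro i
  rw [Real.dist_eq]
  exact abs_lt_of_sq_lt_sq (key i) hr.le

lemma isOpen_roundCone : IsOpen roundCone :=
  isOpen_lt (by fun_prop) (by fun_prop)

lemma isOpen_coneAt (v : Fin 3 → ℝ) (T : (Fin 3 → ℝ) ≃ₗ[ℝ] (Fin 3 → ℝ)) {S : Set (Fin 3 → ℝ)}
    (hS : IsOpen S) : IsOpen {u | u - v ∈ T '' S} := by
  have : {u | u - v ∈ T '' S} = (fun u => T.symm (u - v)) ⁻¹' S := by
    ext u
    simp only [Set.mem_ofPred_eq, Set.mem_preimage]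
    constructor
    · rintro ⟨w, hw, h⟩
      rw [← h]; simpa using hw
    · intro h
      exact ⟨_, h, by simp⟩
  rw [this]
  refine hS.preimage ?_
  exact (LinearMap.continuous_of_finiteDimensional (T.symm : (Fin 3 → ℝ) →ₗ[ℝ] (Fin 3 → ℝ))).comp
    (by fun_prop : Continuous fun u : Fin 3 → ℝ => u - v)

lemma IsKleinCone.isOpen {K : Set (Fin 3 → ℝ)} (hK : IsKleinCone K) : IsOpen K := by
  obtain ⟨v, -, T, rfl⟩ := hK
  exact isOpen_kleinBall.inter (isOpen_coneAt v T isOpen_roundCone)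

lemma IsKleinCone.subset {K : Set (Fin 3 → ℝ)} (hK : IsKleinCone K) : K ⊆ kleinBall := by
  obtain ⟨v, -, T, rfl⟩ := hK
  exact fun _ h => h.1

/-- Every unit vector is the image of the third basis vector under an isometry. -/
lemma exists_isometry {q : Fin 3 → ℝ} (hq : dotProduct q q = 1) :
    ∃ R : (Fin 3 → ℝ) ≃ₗ[ℝ] (Fin 3 → ℝ), R (Pi.single 2 1) = q ∧
      (∀ w, dotProduct (R w) q = w 2) ∧ ∀ w, dotProduct (R w) (R w) = dotProduct w w := by
  let e := WithLp.linearEquiv 2 ℝ (Fin 3 → ℝ)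
  let a : EuclideanSpace ℝ (Fin 3) := WithLp.toLp 2 (Pi.single 2 1)
  let b : EuclideanSpace ℝ (Fin 3) := WithLp.toLp 2 q
  have hin : ∀ x y : EuclideanSpace ℝ (Fin 3), ⟪x, y⟫_ℝ = dotProduct (e x) (e y) := by
    intro x y
    simp [PiLp.inner_apply, dotProduct, e, mul_comm]
  have hab : ‖a‖ = ‖b‖ := by
    rw [@norm_eq_sqrt_real_inner _ _ _ a, @norm_eq_sqrt_real_inner _ _ _ b, hin, hin]
    simp [e, a, b, hq]
  let r := (ℝ ∙ (a - b))ᗮ.reflection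
  have hr : r a = b := Submodule.reflection_sub hab
  have hR : ∀ w w', dotProduct ((e.symm ≪≫ₗ r.toLinearEquiv ≪≫ₗ e) w)
      ((e.symm ≪≫ₗ r.toLinearEquiv ≪≫ₗ e) w') = dotProduct w w' := by
    intro w w'
    have := r.inner_map_map (e.symm w) (e.symm w')
    rw [hin, hin] at this
    simpa using this
  have ha : (e.symm ≪≫ₗ r.toLinearEquiv ≪≫ₗ e) (Pi.single 2 1) = q := by
    change e (r a) = q
    rw [hr]; rfl
  refine ⟨e.symm ≪≫ₗ r.toLinearEquiv ≪≫ₗ e, ha, fun w => ?_, fun w => hR w w⟩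
  have := hR w (Pi.single 2 1)
  rw [ha] at this
  simpa using this

lemma roundCone_pos {w : Fin 3 → ℝ} (hw : w ∈ roundCone) : 0 < w 2 :=
  lt_of_le_of_lt (Real.sqrt_nonneg _) hw

/-- Cones opening towards a point at infinity. -/
lemma exists_kleinCones_cap {q : Fin 3 → ℝ} (hq : dotProduct q q = 1) :
    ∃ K : ℝ → Set (Fin 3 → ℝ), ∀ δ, 0 < δ → δ < 1 → IsKleinCone (K δ) ∧ K δ ⊆ cap q δ ∧
      (∃ δ' > 0, cap q δ' ⊆ K δ) ∧ ∀ δ' ≤ δ, K δ' ⊆ K δ := by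
  obtain ⟨R, hRq, hRd, -⟩ := exists_isometry hq
  refine ⟨fun δ => {u | u ∈ kleinBall ∧ u - (1 - δ) • q ∈ R '' roundCone}, fun δ h0 h1 =>
    ⟨⟨(1 - δ) • q, ?_, R, rfl⟩, ?_, ?_, ?_⟩⟩
  · rw [mem_kleinBall]
    simp [hq]
    nlinarith
  · rintro u ⟨hu, w, hw, huw⟩
    refine ⟨hu, ?_⟩
    have h2 := hRd w
    rw [huw, sub_dotProduct, smul_dotProduct, hq, smul_eq_mul] at h2
    linarith [roundCone_pos hw]
  · obtain ⟨δ', h2, h3⟩ := exists_cap_subset hq (isOpen_coneAt ((1 - δ) • q) R isOpen_roundCone)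
      ⟨δ • Pi.single 2 1, by simpa [roundCone] using h0, by rw [map_smul, hRq, sub_smul]; simp⟩
    exact ⟨δ', h2, fun u hu => ⟨hu.1, h3 hu⟩⟩
  · rintro δ' hδ u ⟨hu, w, hw, huw⟩
    -- The apexes lie on a common axis, so passing from one to the other only lengthens the axial
    -- component.
    refine ⟨hu, w + (δ - δ') • Pi.single 2 1, ?_, ?_⟩
    · simp only [roundCone, Set.mem_ofPred_eq] at hw ⊢
      simp
      linarith
    · rw [map_add, map_smul, hRq, huw]
      simp only [sub_smul, one_smul]
      abel

/-- Wide cones which almost fill a half ball. -/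
lemma exists_kleinCone_big {q : Fin 3 → ℝ} (hq : dotProduct q q = 1) {ε : ℝ} (h0 : 0 < ε)
    (h1 : ε < 1) : ∃ K, IsKleinCone K ∧ (∀ u ∈ kleinBall, dotProduct u q < 1 - ε → u ∈ K) ∧
      ∀ u ∈ K, dotProduct u q < 1 - ε / 2 := by
  obtain ⟨R, hRq, hRd, hRn⟩ := exists_isometry hq
  -- The cone has its apex at `(1 - ε/2) q` and opens away from `q`. Points with `u·q < 1 - ε` have
  -- depth greater than `ε/2`, while the stretching by `4/ε` turns transverse distances of at most
  -- `1` into at most `ε/4`.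
  have hd : ∀ i : Fin 3, IsUnit ((![4 / ε, 4 / ε, -1] : Fin 3 → ℝ) i) := by
    intro i; fin_cases i <;> simp <;> positivity
  let S : (Fin 3 → ℝ) ≃ₗ[ℝ] (Fin 3 → ℝ) :=
    LinearEquiv.piCongrRight fun i => LinearEquiv.smulOfUnit (hd i).unit
  have hS : ∀ w i, S w i = (![4 / ε, 4 / ε, -1] : Fin 3 → ℝ) i * w i := fun w i => rfl
  refine ⟨_, ⟨(1 - ε / 2) • q, ?_, S ≪≫ₗ R, rfl⟩, ?_, ?_⟩
  · rw [mem_kleinBall]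
    simp [hq]
    nlinarith
  · intro u hu hlt
    refine ⟨hu, (S ≪≫ₗ R).symm (u - (1 - ε / 2) • q), ?_, by simp⟩
    obtain ⟨w, hw⟩ := (S ≪≫ₗ R).surjective (u - (1 - ε / 2) • q)
    rw [← hw, LinearEquiv.symm_apply_apply]
    have h2 := hRd (S w)
    have h3 := hRn (S w)
    have hw' : R (S w) = u - (1 - ε / 2) • q := hw
    rw [hw', sub_dotProduct, smul_dotProduct, hq, hS, smul_eq_mul] at h2
    rw [hw'] at h3
    simp only [sub_dotProduct, dotProduct_sub, smul_dotProduct, dotProduct_smul, hq,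
      smul_eq_mul] at h3
    rw [dotProduct_comm q u] at h3
    rw [mem_kleinBall] at hu
    simp at h2
    have h4 : dotProduct (S w) (S w) = (4 / ε) ^ 2 * (w 0 ^ 2 + w 1 ^ 2) + w 2 ^ 2 := by
      simp [dotProduct, Fin.sum_univ_three, hS]; ring
    rw [h4] at h3
    have hw2 : ε / 2 < w 2 := by linarith
    have h5 : (4 / ε) ^ 2 * (w 0 ^ 2 + w 1 ^ 2) ≤ 1 := by
      have : w 2 = (1 - ε / 2) - dotProduct u q := by linarith
      rw [this] at h3
      nlinarith [sq_nonneg (dotProduct u q)]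
    have h6 : w 0 ^ 2 + w 1 ^ 2 ≤ (ε / 4) ^ 2 := by
      have : w 0 ^ 2 + w 1 ^ 2 = (ε / 4) ^ 2 * ((4 / ε) ^ 2 * (w 0 ^ 2 + w 1 ^ 2)) := by
        field_simp
      rw [this]
      nlinarith [sq_nonneg (ε / 4)]
    change √(w 0 ^ 2 + w 1 ^ 2) < w 2
    rw [Real.sqrt_lt' (by linarith)]
    nlinarith
  · rintro u ⟨hu, w, hw, huw⟩
    have h2 := hRd (S w)
    have huw' : R (S w) = u - (1 - ε / 2) • q := huw
    rw [huw', sub_dotProduct, smul_dotProduct, hq, hS, smul_eq_mul] at h2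
    simp at h2
    linarith [roundCone_pos hw]

/-- The time at which the ray from `v` in the direction `w` leaves the ball. -/
def exitTime (v w : Fin 3 → ℝ) : ℝ :=
  (-dotProduct v w + √(dotProduct v w ^ 2 + dotProduct w w * (1 - dotProduct v v))) /
    dotProduct w w

lemma exitTime_pos {v w : Fin 3 → ℝ} (hv : v ∈ kleinBall) (hw : w ≠ 0) : 0 < exitTime v w := by
  rw [mem_kleinBall] at hv
  have hA := dotProduct_self_pos' hw
  refine div_pos ?_ hA
  have : |dotProduct v w| < √(dotProduct v w ^ 2 + dotProduct w w * (1 - dotProduct v v)) := by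
    rw [← Real.sqrt_sq_eq_abs]
    exact Real.sqrt_lt_sqrt (sq_nonneg _) (by nlinarith)
  linarith [le_abs_self (dotProduct v w)]

/-- `exitTime` is the larger root of the quadratic equation `|v + t w|² = 1`. The equation is
verified after multiplication by `|w|²`. -/
lemma exit_unit {v w : Fin 3 → ℝ} (hv : v ∈ kleinBall) (hw : w ≠ 0) :
    dotProduct (v + exitTime v w • w) (v + exitTime v w • w) = 1 := by
  rw [mem_kleinBall] at hv
  have hA := dotProduct_self_pos' hw
  have hs := Real.sq_sqrt (show 0 ≤ dotProduct v w ^ 2 + dotProduct w w * (1 - dotProduct v v) by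
    nlinarith [sq_nonneg (dotProduct v w)])
  set s := √(dotProduct v w ^ 2 + dotProduct w w * (1 - dotProduct v v)) with hsdef
  have ht : dotProduct w w * exitTime v w = -dotProduct v w + s := by
    rw [exitTime, ← hsdef]; field_simp
  simp only [add_dotProduct, dotProduct_add, smul_dotProduct, dotProduct_smul, smul_eq_mul]
  rw [dotProduct_comm w v]
  have h2 : dotProduct w w * (dotProduct w w * exitTime v w ^ 2 + 2 * exitTime v w * dotProduct v w
      - (1 - dotProduct v v)) = 0 := by
    have : dotProduct w w * (dotProduct w w * exitTime v w ^ 2 + 2 * exitTime v w * dotProduct v w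
      - (1 - dotProduct v v)) = (dotProduct w w * exitTime v w) ^ 2
        + 2 * (dotProduct w w * exitTime v w) * dotProduct v w
        - dotProduct w w * (1 - dotProduct v v) := by ring
    rw [this, ht]; nlinarith
  have h3 := (mul_eq_zero.1 h2).resolve_left hA.ne'
  nlinarith

/-- For a direction pointing at `q` on the sphere, the discriminant is the square of `1 - v·q ≥ 0`.
Hence every point of the sphere is the exit point of the ray from `v` towards it. -/
lemma exitTime_eq_one {v q : Fin 3 → ℝ} (hv : v ∈ kleinBall) (hq : dotProduct q q = 1)
    (hne : q - v ≠ 0) : exitTime v (q - v) = 1 := by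
  rw [mem_kleinBall] at hv
  have hA := dotProduct_self_pos' hne
  rw [exitTime, div_eq_one_iff_eq hA.ne']
  have h1 : dotProduct (q - v) (q - v) = 1 - 2 * dotProduct v q + dotProduct v v := by
    simp only [sub_dotProduct, dotProduct_sub, hq]; rw [dotProduct_comm q v]; ring
  have h2 : dotProduct v (q - v) = dotProduct v q - dotProduct v v := by rw [dotProduct_sub]
  have h4 := dotProduct_sq_le v q
  rw [hq, mul_one] at h4
  have h5 : √(dotProduct v (q - v) ^ 2 + dotProduct (q - v) (q - v) * (1 - dotProduct v v))
      = 1 - dotProduct v q := by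
    rw [Real.sqrt_eq_iff_mul_self_eq (by nlinarith) (by nlinarith)]
    rw [h1, h2]; ring
  rw [h5, h1, h2]; ring

/-- The directions outside of a closed round cone. -/
def outerDirections : Set (Fin 3 → ℝ) := {w | w 2 < √(w 0 ^ 2 + w 1 ^ 2)}

lemma isOpen_outerDirections : IsOpen outerDirections :=
  isOpen_lt (by fun_prop) (by fun_prop)

lemma ne_zero_of_outer {w : Fin 3 → ℝ} (hw : w ∈ outerDirections) : w ≠ 0 := by
  rintro rfl
  simp [outerDirections] at hw

lemma smul_mem_outer {w : Fin 3 → ℝ} (hw : w ∈ outerDirections) {t : ℝ} (ht : 0 < t) :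
    t • w ∈ outerDirections := by
  have hw' : w 2 < √(w 0 ^ 2 + w 1 ^ 2) := hw
  change t * w 2 < √((t * w 0) ^ 2 + (t * w 1) ^ 2)
  rw [show (t * w 0) ^ 2 + (t * w 1) ^ 2 = t ^ 2 * (w 0 ^ 2 + w 1 ^ 2) by ring,
    Real.sqrt_mul (sq_nonneg t), Real.sqrt_sq ht.le]
  exact mul_lt_mul_of_pos_left hw' ht

lemma single_mem_outer : (Pi.single 2 (-1) : Fin 3 → ℝ) ∈ outerDirections := by
  simp [outerDirections]

/-- The set is not convex, but it is star-shaped about the direction opposite to the axis. -/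
lemma isPreconnected_outerDirections : IsPreconnected outerDirections := by
  refine (StarConvex.isPathConnected ?_ single_mem_outer).isConnected.isPreconnected
  rw [starConvex_iff_forall_pos single_mem_outer]
  intro w hw a b ha hb hab
  have hw' : w 2 < √(w 0 ^ 2 + w 1 ^ 2) := hw
  have h1 := smul_mem_outer hw hb
  have h1' : b * w 2 < √((b * w 0) ^ 2 + (b * w 1) ^ 2) := h1
  simp [outerDirections]
  linarith

/-- The points at infinity which are not in the closure of `K`. -/
def pointsAway (K : Set (Fin 3 → ℝ)) : Set (Fin 3 → ℝ) :=
  {q | dotProduct q q = 1 ∧ ∃ δ > 0, Disjoint (cap q δ) K}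

/-- Rays from the apex parametrize the sphere. A ray strictly outside the closed cone exits at a
point with a neighbourhood missing the cone; a ray in the closed cone exits at a limit of points of
the cone. -/
lemma pointsAway_eq_image {v : Fin 3 → ℝ} (hv : v ∈ kleinBall)
    (T : (Fin 3 → ℝ) ≃ₗ[ℝ] (Fin 3 → ℝ)) :
    pointsAway {u | u ∈ kleinBall ∧ u - v ∈ T '' roundCone} =
      (fun w => v + exitTime v (T w) • T w) '' outerDirections := by
  ext q
  constructor
  · rintro ⟨hq, δ, hδ, hdis⟩
    have hqv : q - v ≠ 0 := by
      rw [mem_kleinBall] at hv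
      intro h
      rw [sub_eq_zero.1 h] at hq
      linarith
    refine ⟨T.symm (q - v), ?_, by simp [exitTime_eq_one hv hq hqv]⟩
    by_contra hout
    set w := T.symm (q - v) with hw
    have hTw : T w = q - v := by simp [hw]
    have hw2 : √(w 0 ^ 2 + w 1 ^ 2) ≤ w 2 := not_lt.1 hout
    have hopen : IsOpen (kleinBall ∩ {u | 1 - δ < dotProduct u q}) :=
      isOpen_kleinBall.inter (isOpen_lt continuous_const (continuous_dotProduct_left q))
    have hev : ∀ᶠ t in 𝓝[<] (1 : ℝ), 1 - δ < dotProduct (v + t • (q - v)) q := by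
      have hc : Continuous fun t : ℝ => dotProduct (v + t • (q - v)) q :=
        (continuous_dotProduct_left q).comp (by fun_prop)
      refine nhdsWithin_le_nhds ((hc.tendsto 1).eventually_const_lt ?_)
      simp [hq, hδ]
    have hev2 : ∀ᶠ t in 𝓝[<] (1 : ℝ), t ∈ Set.Ioo (0 : ℝ) 1 :=
      Ioo_mem_nhdsLT zero_lt_one
    obtain ⟨t, ht1, ht2⟩ := (hev.and hev2).exists
    have htb : v + t • (q - v) ∈ kleinBall := by
      rw [mem_kleinBall] at hv ⊢
      have h4 := dotProduct_sq_le v q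
      rw [hq, mul_one] at h4
      simp only [add_dotProduct, dotProduct_add, smul_dotProduct, dotProduct_smul, smul_eq_mul,
        sub_dotProduct, dotProduct_sub, hq]
      rw [dotProduct_comm q v]
      have h5 : dotProduct v q ≤ 1 := by nlinarith
      obtain ⟨h6, h7⟩ := ht2
      nlinarith [mul_pos h6 (sub_pos.2 h7), mul_pos (sub_pos.2 h7) (sub_pos.2 h7),
        mul_nonneg (mul_pos h6 (sub_pos.2 h7)).le (sub_nonneg.2 h5),
        mul_pos (mul_pos (sub_pos.2 h7) (sub_pos.2 h7)) (sub_pos.2 hv)]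
    -- The chosen point of the segment is only in the closed cone. A small push along the axis moves
    -- it into the open cone without leaving the ball or the cap, contradicting disjointness.
    have hc : Continuous fun s : ℝ => v + t • (q - v) + s • T (Pi.single 2 1) := by fun_prop
    have hev3 : ∀ᶠ s in 𝓝[>] (0 : ℝ), v + t • (q - v) + s • T (Pi.single 2 1) ∈
        kleinBall ∩ {u | 1 - δ < dotProduct u q} :=
      nhdsWithin_le_nhds (hc.continuousAt (hopen.mem_nhds (by
        simp only [zero_smul, add_zero]; exact ⟨htb, ht1⟩)))
    obtain ⟨s, hs1, hs2⟩ := (hev3.and self_mem_nhdsWithin).exists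
    refine hdis.le_bot ⟨hs1, hs1.1, t • w + s • Pi.single 2 1, ?_, ?_⟩
    · have hs0 : 0 < s := hs2
      simp only [roundCone, Set.mem_ofPred_eq]
      simp
      rw [show (t * w 0) ^ 2 + (t * w 1) ^ 2 = t ^ 2 * (w 0 ^ 2 + w 1 ^ 2) by ring,
        Real.sqrt_mul (sq_nonneg t), Real.sqrt_sq ht2.1.le]
      nlinarith [mul_le_mul_of_nonneg_left hw2 ht2.1.le]
    · rw [map_add, map_smul, map_smul, hTw]; abel
  · rintro ⟨w, hw, rfl⟩
    have hTw : T w ≠ 0 := by simpa using ne_zero_of_outer hw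
    have hq := exit_unit hv hTw
    have ht := exitTime_pos hv hTw
    refine ⟨hq, ?_⟩
    obtain ⟨δ, hδ, h⟩ := exists_cap_subset hq (isOpen_coneAt v T isOpen_outerDirections)
      ⟨exitTime v (T w) • w, smul_mem_outer hw ht, by simp⟩
    refine ⟨δ, hδ, Set.disjoint_left.2 ?_⟩
    rintro u hu ⟨-, w1, hw1, h1⟩
    obtain ⟨w2, hw2, h2⟩ := h hu
    obtain rfl : w1 = w2 := T.injective (h1.trans h2.symm)
    exact lt_asymm (show √(w1 0 ^ 2 + w1 1 ^ 2) < w1 2 from hw1) hw2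

/-- The exit point depends continuously on the direction. This connectedness is why the transport to
spacelike infinity does not depend on the direction chosen. -/
lemma isPreconnected_pointsAway {K : Set (Fin 3 → ℝ)} (hK : IsKleinCone K) :
    IsPreconnected (pointsAway K) := by
  obtain ⟨v, hv, T, rfl⟩ := hK
  rw [pointsAway_eq_image hv T]
  refine isPreconnected_outerDirections.image _ ?_
  have hT : Continuous T :=
    LinearMap.continuous_of_finiteDimensional (T : (Fin 3 → ℝ) →ₗ[ℝ] (Fin 3 → ℝ))
  have h1 : Continuous fun w => dotProduct v (T w) := by
    simp only [dotProduct]; fun_prop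
  have h2 : Continuous fun w => dotProduct (T w) (T w) := by
    simp only [dotProduct]; fun_prop
  have h3 : ContinuousOn (fun w => exitTime v (T w)) outerDirections := by
    refine ContinuousOn.div (by fun_prop) h2.continuousOn fun w hw => ?_
    exact (dotProduct_self_pos' (by simpa using ne_zero_of_outer hw)).ne'
  fun_prop

lemma pointsAway_nonempty {K : Set (Fin 3 → ℝ)} (hK : IsKleinCone K) : (pointsAway K).Nonempty := by
  obtain ⟨v, hv, T, rfl⟩ := hK
  rw [pointsAway_eq_image hv T]
  exact ⟨_, _, single_mem_outer, rfl⟩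

/-- Every cone contains a neighbourhood of a point at infinity. -/
lemma IsKleinCone.exists_cap_subset {K : Set (Fin 3 → ℝ)} (hK : IsKleinCone K) :
    ∃ q, dotProduct q q = 1 ∧ ∃ δ > 0, cap q δ ⊆ K := by
  obtain ⟨v, hv, T, rfl⟩ := hK
  have hne : T (Pi.single 2 1) ≠ 0 := by simp
  have hq := exit_unit hv hne
  have ht := exitTime_pos hv hne
  obtain ⟨δ, hδ, h⟩ := LightCone.exists_cap_subset hq (isOpen_coneAt v T isOpen_roundCone)
    ⟨exitTime v (T (Pi.single 2 1)) • Pi.single 2 1, by simpa [roundCone] using ht, by simp⟩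
  exact ⟨_, hq, δ, hδ, fun u hu => ⟨hu.1, h hu⟩⟩

/-! ### Hypercones -/

lemma Hypercone.exists_eq {τ : ℝ} (C : Hypercone τ) :
    ∃ K, IsKleinCone K ∧ C.1 = coneOver τ K := C.2

/-- The hypercone over a cone in the ball. -/
def IsKleinCone.hypercone (τ : ℝ) {K : Set (Fin 3 → ℝ)} (hK : IsKleinCone K) : Hypercone τ :=
  ⟨coneOver τ K, K, hK, rfl⟩

lemma Hypercone.isOpen {τ : ℝ} (C : Hypercone τ) : IsOpen C.1 := by
  obtain ⟨K, -, h⟩ := C.exists_eq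
  rw [h]; exact isOpen_coneOver τ K

lemma Hypercone.subset {τ : ℝ} (C : Hypercone τ) : C.1 ⊆ forwardCone := by
  obtain ⟨K, -, h⟩ := C.exists_eq
  rw [h]; exact coneOver_subset τ K

lemma Hypercone.subset_compl_symm {τ : ℝ} {C D : Hypercone τ} (h : D.1 ⊆ spacelikeCompl C.1) :
    C.1 ⊆ spacelikeCompl D.1 :=
  subset_spacelikeCompl_symm C.isOpen C.subset h

/-- Small hypercones near a point at infinity. -/
lemma exists_small_cone {q : Fin 3 → ℝ} (hq : dotProduct q q = 1) {δ : ℝ} (hδ : 0 < δ) :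
    ∃ K, IsKleinCone K ∧ K ⊆ cap q δ ∧ ∃ δ' > 0, cap q δ' ⊆ K := by
  obtain ⟨K, hK⟩ := exists_kleinCones_cap hq
  obtain ⟨h1, h2, h3, -⟩ := hK (min δ (1 / 2)) (by positivity)
    (min_lt_of_right_lt (by norm_num))
  exact ⟨_, h1, h2.trans (cap_mono (min_le_left _ _)), h3⟩

/-- A compact set containing `O` is covered by one of the increasing open complements. Sequences
transported along a funnel thus become constant on each local algebra. -/
lemma IsFunnel.eventually_subset {τ : ℝ} {D : ℕ → Hypercone τ} (hD : IsFunnel D) (O : DoubleCone) :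
    ∃ n, ∀ m ≥ n, O.1 ⊆ spacelikeCompl (D m).1 := by
  obtain ⟨J, hJ, hOJ, hJV⟩ := exists_compact_superset O
  have hmono : Monotone fun n => spacelikeCompl (D n).1 :=
    fun m n hmn => spacelikeCompl_anti (hD.1 m n hmn)
  obtain ⟨n, hn⟩ := hJ.elim_directed_cover _ (fun n => isOpen_spacelikeCompl (D n).1)
    (by rw [hD.2]; exact hJV) hmono.directed_le
  exact ⟨n, fun m hm => (hOJ.trans hn).trans (hmono hm)⟩

lemma IsExhaustion.eventually_subset {τ : ℝ} {B : ℕ → Hypercone τ} (hB : IsExhaustion B)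
    (O : DoubleCone) : ∃ n, ∀ m ≥ n, O.1 ⊆ (B m).1 := by
  obtain ⟨J, hJ, hOJ, hJV⟩ := exists_compact_superset O
  have hmono : Monotone fun n => (B n).1 := fun m n hmn => hB.1 m n hmn
  obtain ⟨n, hn⟩ := hJ.elim_directed_cover _ (fun n => (B n).isOpen)
    (by rw [hB.2]; exact hJV) hmono.directed_le
  exact ⟨n, fun m hm => (hOJ.trans hn).trans (hmono hm)⟩

/-- Every hypercone is contained in the members of an exhaustion whose spacelike complements
contain the members of a funnel. -/
lemma exists_exhaustion_funnel {τ : ℝ} (hτ : 0 < τ) (C : Hypercone τ) :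
    ∃ B D : ℕ → Hypercone τ, IsExhaustion B ∧ (∀ n, C.1 ⊆ (B n).1) ∧ IsFunnel D ∧
      ∀ n, (D n).1 ⊆ spacelikeCompl (B n).1 := by
  obtain ⟨K, hK, hC⟩ := C.exists_eq
  obtain ⟨q, hq, δ₀, hδ₀, hdis⟩ := pointsAway_nonempty hK
  obtain ⟨L, hL⟩ := exists_kleinCones_cap hq
  set δ := min δ₀ 1 with hδdef
  have hδ : 0 < δ := by positivity
  have hδ1 : δ ≤ 1 := min_le_right _ _
  -- The halving makes the levels fit: the `n`-th wide cone ends below `1 - e n / 2`, where the next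
  -- one contains everything and the `n`-th small cone begins.
  let e : ℕ → ℝ := fun n => δ / 2 ^ (n + 1)
  have he0 : ∀ n, 0 < e n := fun n => by positivity
  have he1 : ∀ n, e n < δ := fun n =>
    div_lt_self hδ (one_lt_pow₀ one_lt_two (Nat.succ_ne_zero n))
  have hes : ∀ n, e (n + 1) = e n / 2 := fun n => by
    simp only [e]; rw [pow_succ 2 (n + 1)]; field_simp
  have hanti : Antitone e := antitone_nat_of_succ_le fun n => by rw [hes]; linarith [he0 n]
  have hlim : ∀ ε > 0, ∃ n, e n < ε := by
    intro ε hε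
    obtain ⟨n, hn⟩ := pow_unbounded_of_one_lt (δ / ε) one_lt_two
    refine ⟨n, ?_⟩
    rw [div_lt_iff₀ hε] at hn
    rw [div_lt_iff₀ (by positivity), pow_succ]
    nlinarith
  choose M hM1 hM2 hM3 using fun n => exists_kleinCone_big hq (he0 n) ((he1 n).trans_le hδ1)
  have hLn := fun n => hL (e n / 2) (by linarith [he0 n]) (by linarith [he0 n, he1 n])
  -- The factor `2` leaves the strict margin needed to place `O` inside the wide hypercone of level
  -- `e n`.
  have shadow : ∀ y ∈ forwardCone, ∃ O : DoubleCone, y ∈ O.1 ∧ ∃ n, ∀ y ∈ O.1,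
      ∀ z ∈ hyperboloid τ, 0 ≤ mink (y - z) (y - z) →
        dotProduct (beltramiKlein z) q ≤ 1 - 2 * e n := by
    intro y hy
    obtain ⟨O, hyO⟩ := exists_doubleCone_mem hy
    obtain ⟨ε, hε, h⟩ := exists_shadow_bound hτ O
    obtain ⟨n, hn⟩ := hlim (ε / 2) (by positivity)
    exact ⟨O, hyO, n, fun y hy z hz hyz => by linarith [h q hq y hy z hz hyz]⟩
  refine ⟨fun n => (hM1 n).hypercone τ, fun n => (hLn n).1.hypercone τ, ⟨?_, ?_⟩, ?_, ⟨?_, ?_⟩, ?_⟩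
  · have : Monotone fun n => coneOver τ (M n) := monotone_nat_of_le_succ fun n =>
      coneOver_mono fun u hu => hM2 (n + 1) u ((hM1 n).subset hu) (by rw [hes]; exact hM3 n u hu)
    exact fun m n hmn => this hmn
  · refine Set.Subset.antisymm (Set.iUnion_subset fun n => coneOver_subset τ _) fun y hy => ?_
    obtain ⟨O, hyO, n, h⟩ := shadow y hy
    exact Set.mem_iUnion.2 ⟨n, doubleCone_subset_coneOver hτ h (by linarith [he0 n]) (hM2 n) hyO⟩
  · intro n
    rw [hC]
    refine coneOver_mono fun u hu => hM2 n u (hK.subset hu) ?_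
    by_contra! hlt
    exact hdis.le_bot ⟨⟨hK.subset hu, by linarith [he1 n, min_le_left δ₀ 1]⟩, hu⟩
  · exact fun m n hmn => coneOver_mono ((hLn m).2.2.2 _ (by linarith [hanti hmn]))
  · refine Set.Subset.antisymm (Set.iUnion_subset fun n => spacelikeCompl_subset _) fun y hy => ?_
    obtain ⟨O, hyO, n, h⟩ := shadow y hy
    exact Set.mem_iUnion.2 ⟨n, doubleCone_subset_compl_coneOver h
      ((hLn n).2.1.trans (cap_mono (by linarith [he0 n]))) hyO⟩
  · refine fun n => coneOver_subset_compl_of_disjoint hτ (hLn n).1.isOpen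
      (Set.disjoint_left.2 fun u hu hu' => ?_)
    linarith [((hLn n).2.1 hu).2, hM3 n u hu']

lemma exists_subset_compl {τ : ℝ} (hτ : 0 < τ) (C : Hypercone τ) :
    ∃ D : Hypercone τ, D.1 ⊆ spacelikeCompl C.1 := by
  obtain ⟨B, D, -, h1, -, h2⟩ := exists_exhaustion_funnel hτ C
  exact ⟨D 0, (h2 0).trans (spacelikeCompl_anti (h1 0))⟩

/-- Hypercones contain hypercones which are separated from a given double cone. -/
lemma exists_separated {τ : ℝ} (hτ : 0 < τ) (D : Hypercone τ) (O : DoubleCone) :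
    ∃ D' B : Hypercone τ, D'.1 ⊆ D.1 ∧ O.1 ⊆ B.1 ∧ D'.1 ⊆ spacelikeCompl B.1 := by
  obtain ⟨K, hK, hD⟩ := D.exists_eq
  obtain ⟨q, hq, δ, hδ, hcap⟩ := hK.exists_cap_subset
  obtain ⟨ε, hε, h⟩ := exists_shadow_bound hτ O
  set e := min (ε / 2) (1 / 2) with he
  have he0 : 0 < e := by positivity
  have he1 : e ≤ ε / 2 := min_le_left _ _
  have he2 : e ≤ 1 / 2 := min_le_right _ _
  obtain ⟨M, hM1, hM2, hM3⟩ := exists_kleinCone_big hq he0 (by linarith)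
  -- Size `δ` keeps the small cone inside that of `D`, and size `e / 2` keeps it off the wide cone
  -- `M`.
  obtain ⟨L, hL1, hL2, -⟩ := exists_small_cone hq (lt_min hδ (half_pos he0))
  refine ⟨hL1.hypercone τ, hM1.hypercone τ, ?_,
    doubleCone_subset_coneOver hτ (h q hq) (by linarith) hM2,
    coneOver_subset_compl_of_disjoint hτ hL1.isOpen (Set.disjoint_left.2 fun u hu hu' => ?_)⟩
  · rw [hD]
    exact coneOver_mono ((hL2.trans (cap_mono (min_le_left _ _))).trans hcap)
  · linarith [(hL2 hu).2, hM3 u hu', min_le_right δ (e / 2)]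

/-- Any two hypercones contain smaller ones which have a common spacelike complement. -/
lemma exists_common_compl {τ : ℝ} (hτ : 0 < τ) (C₁ C₂ : Hypercone τ) :
    ∃ E₁ E₂ D : Hypercone τ, E₁.1 ⊆ C₁.1 ∧ E₂.1 ⊆ C₂.1 ∧ D.1 ⊆ spacelikeCompl E₁.1 ∧
      D.1 ⊆ spacelikeCompl E₂.1 := by
  obtain ⟨K₁, hK₁, hC₁⟩ := C₁.exists_eq
  obtain ⟨K₂, hK₂, hC₂⟩ := C₂.exists_eq
  obtain ⟨q₁, hq₁, δ₁, hδ₁, hcap₁⟩ := hK₁.exists_cap_subset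
  obtain ⟨q₂, hq₂, δ₂, hδ₂, hcap₂⟩ := hK₂.exists_cap_subset
  obtain ⟨q, hq, h1, h2⟩ : ∃ q : Fin 3 → ℝ, dotProduct q q = 1 ∧ q ≠ q₁ ∧ q ≠ q₂ := by
    -- Of the three distinct basis vectors, one differs from both `q₁` and `q₂`.
    by_contra! hcon
    have hs : ∀ i : Fin 3, dotProduct (Pi.single i 1 : Fin 3 → ℝ) (Pi.single i 1) = 1 := by simp
    have hne : ∀ i j : Fin 3, i ≠ j → (Pi.single i 1 : Fin 3 → ℝ) ≠ Pi.single j 1 := by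
      intro i j hij h
      have := congrFun h i
      simp [hij] at this
    have h0 := hcon _ (hs 0)
    have h1 := hcon _ (hs 1)
    have h2 := hcon _ (hs 2)
    have := hne 0 1 (by decide)
    have := hne 0 2 (by decide)
    have := hne 1 2 (by decide)
    grind
  have sep : ∀ {p : Fin 3 → ℝ}, dotProduct p p = 1 → q ≠ p →
      ∃ δ > 0, Disjoint (cap q δ) (cap p δ) := by
    intro p hp hne
    have hpos := dotProduct_self_pos' (sub_ne_zero.2 hne)
    simp only [sub_dotProduct, dotProduct_sub, hp, hq] at hpos
    rw [dotProduct_comm p q] at hpos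
    have hlt : dotProduct p q < 1 := by rw [dotProduct_comm]; linarith
    obtain ⟨δ, hδ, h⟩ := exists_cap_subset hp
      (isOpen_lt (continuous_dotProduct_left q) (continuous_const (y := (1 + dotProduct p q) / 2)))
      (by simp only [Set.mem_ofPred_eq]; linarith)
    refine ⟨min δ ((1 - dotProduct p q) / 2), lt_min hδ (by linarith),
      Set.disjoint_left.2 fun u hu hu' => ?_⟩
    have h3 : dotProduct u q < (1 + dotProduct p q) / 2 := h (cap_mono (min_le_left _ _) hu')
    linarith [hu.2, min_le_right δ ((1 - dotProduct p q) / 2)]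
  obtain ⟨ε₁, hε₁, hd₁⟩ := sep hq₁ h1
  obtain ⟨ε₂, hε₂, hd₂⟩ := sep hq₂ h2
  obtain ⟨L, hL, hLq, -⟩ := exists_small_cone hq (lt_min hε₁ hε₂)
  obtain ⟨L₁, hL₁, hLq₁, -⟩ := exists_small_cone hq₁ (lt_min hδ₁ hε₁)
  obtain ⟨L₂, hL₂, hLq₂, -⟩ := exists_small_cone hq₂ (lt_min hδ₂ hε₂)
  refine ⟨hL₁.hypercone τ, hL₂.hypercone τ, hL.hypercone τ, ?_, ?_, ?_, ?_⟩
  · rw [hC₁]; exact coneOver_mono ((hLq₁.trans (cap_mono (min_le_left _ _))).trans hcap₁)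
  · rw [hC₂]; exact coneOver_mono ((hLq₂.trans (cap_mono (min_le_left _ _))).trans hcap₂)
  · exact coneOver_subset_compl_of_disjoint hτ hL.isOpen
      (hd₁.mono (hLq.trans (cap_mono (min_le_left _ _))) (hLq₁.trans (cap_mono (min_le_right _ _))))
  · exact coneOver_subset_compl_of_disjoint hτ hL.isOpen
      (hd₂.mono (hLq.trans (cap_mono (min_le_right _ _)))
        (hLq₂.trans (cap_mono (min_le_right _ _))))

/-- The hypercones in the spacelike complement of a hypercone and of a double cone are connected by
inclusions. -/
lemma eq_of_locally_constant {τ : ℝ} (hτ : 0 < τ) (C : Hypercone τ) (O : DoubleCone) {α : Type*}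
    (f : Hypercone τ → α)
    (hf : ∀ D₁ D₂ : Hypercone τ, D₁.1 ⊆ D₂.1 → D₂.1 ⊆ spacelikeCompl C.1 →
      O.1 ⊆ spacelikeCompl D₂.1 → f D₁ = f D₂)
    {D D' : Hypercone τ} (hD : D.1 ⊆ spacelikeCompl C.1) (hOD : O.1 ⊆ spacelikeCompl D.1)
    (hD' : D'.1 ⊆ spacelikeCompl C.1) (hOD' : O.1 ⊆ spacelikeCompl D'.1) : f D = f D' := by
  obtain ⟨K, hK, hC⟩ := C.exists_eq
  obtain ⟨ε, hε, hshadow⟩ := exists_shadow_bound hτ O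
  let good : Hypercone τ → Prop := fun D => D.1 ⊆ spacelikeCompl C.1 ∧ O.1 ⊆ spacelikeCompl D.1
  -- A hypercone is labelled by points at infinity of which it contains a neighbourhood. Admissible
  -- hypercones with a common label share a smaller one, so `f` descends to a function of the label.
  let near : (Fin 3 → ℝ) → Hypercone τ → Prop := fun q D =>
    ∃ L, IsKleinCone L ∧ D.1 = coneOver τ L ∧ ∃ δ > 0, cap q δ ⊆ L
  have joint : ∀ {q : Fin 3 → ℝ}, dotProduct q q = 1 → ∀ {D₁ D₂ : Hypercone τ}, near q D₁ →
      near q D₂ → good D₁ → good D₂ → f D₁ = f D₂ := by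
    rintro q hq D₁ D₂ ⟨L₁, -, e₁, δ₁, hδ₁, h₁⟩ ⟨L₂, -, e₂, δ₂, hδ₂, h₂⟩ g₁ g₂
    obtain ⟨L, hL, hLq, -⟩ := exists_small_cone hq (lt_min hδ₁ hδ₂)
    rw [← hf (hL.hypercone τ) D₁ _ g₁.1 g₁.2, hf (hL.hypercone τ) D₂ _ g₂.1 g₂.2]
    · rw [e₂]; exact coneOver_mono ((hLq.trans (cap_mono (min_le_right _ _))).trans h₂)
    · rw [e₁]; exact coneOver_mono ((hLq.trans (cap_mono (min_le_left _ _))).trans h₁)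
  have exists_good : ∀ q ∈ pointsAway K, ∃ D, near q D ∧ good D := by
    rintro q ⟨hq, δ, hδ, hdis⟩
    obtain ⟨L, hL, hLq, hLn⟩ := exists_small_cone hq (lt_min hδ hε)
    refine ⟨hL.hypercone τ, ⟨L, hL, rfl, hLn⟩, ?_, ?_⟩
    · rw [hC]
      exact coneOver_subset_compl_of_disjoint hτ hL.isOpen
        (hdis.mono_left (hLq.trans (cap_mono (min_le_left _ _))))
    · exact doubleCone_subset_compl_coneOver (hshadow q hq) (hLq.trans (cap_mono (min_le_right _ _)))
  have exists_near : ∀ D : Hypercone τ, D.1 ⊆ spacelikeCompl C.1 → ∃ q ∈ pointsAway K, near q D := by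
    intro D hDC
    obtain ⟨L, hL, hDL⟩ := D.exists_eq
    obtain ⟨q, hq, δ, hδ, hcap⟩ := hL.exists_cap_subset
    rw [hDL, hC] at hDC
    exact ⟨q, ⟨hq, δ, hδ, (disjoint_of_coneOver_subset_compl hτ hL.isOpen hK.isOpen hL.subset
      hDC).mono_left hcap⟩, L, hL, hDL, δ, hδ, hcap⟩
  obtain ⟨q, hq, hqD⟩ := exists_near D hD
  obtain ⟨q', hq', hqD'⟩ := exists_near D' hD'
  -- As a function of the label, `f` is locally constant: an admissible hypercone that is near `q`
  -- is near all labels close to `q`. Connectedness of `pointsAway K` does the rest.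
  have main : ∀ D D', near q D → near q' D' → good D → good D' → f D = f D' := by
    refine (isPreconnected_pointsAway hK).induction₂
      (fun q q' => ∀ D D', near q D → near q' D' → good D → good D' → f D = f D') ?_ ?_ ?_ hq hq'
    · intro q hq
      obtain ⟨D₀, ⟨L, hL, hDL, δ, hδ, hcap⟩, hg⟩ := exists_good q hq
      have hopen : IsOpen {u : Fin 3 → ℝ | 1 - δ < dotProduct u q} :=
        isOpen_lt continuous_const (continuous_dotProduct_left q)
      have hmem : q ∈ {u : Fin 3 → ℝ | 1 - δ < dotProduct u q} := by simp [hq.1, hδ]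
      filter_upwards [nhdsWithin_le_nhds (hopen.mem_nhds hmem), self_mem_nhdsWithin]
        with q' hq'1 hq'2
      intro D D' hn hn' hD hD'
      obtain ⟨δ', hδ', hcap'⟩ := exists_cap_subset hq'2.1 hopen hq'1
      have hn0' : near q' D₀ :=
        ⟨L, hL, hDL, δ', hδ', fun u hu => hcap ⟨hu.1, hcap' hu⟩⟩
      rw [joint hq.1 hn ⟨L, hL, hDL, δ, hδ, hcap⟩ hD hg, joint hq'2.1 hn0' hn' hg hD']
    · intro x y z hx hy hz h1 h2 D D' hn hn' hD hD'
      obtain ⟨D₀, hn₀, hg₀⟩ := exists_good y hy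
      rw [h1 D D₀ hn hn₀ hD hg₀, h2 D₀ D' hn₀ hn' hg₀ hD']
    · intro x y hx hy h D D' hn hn' hD hD'
      exact (h D' D hn' hn hD' hD).symm
  exact main D D' hqD hqD' ⟨hD, hOD⟩ ⟨hD', hOD'⟩

lemma nonempty_hypercone (τ : ℝ) : Nonempty (Hypercone τ) := by
  obtain ⟨K, hK, -⟩ := exists_small_cone (q := Pi.single 2 1) (by simp) one_pos
  exact ⟨hK.hypercone τ⟩

universe u

set_option linter.unusedSectionVars false

variable {H : Type u} [NormedAddCommGroup H] [InnerProductSpace ℂ H] [CompleteSpace H]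

/-! ### The double commutant theorem -/

/-- The conditions on adjoints in the star centralizers are redundant, since `S` and its commutant
are closed under `star`. -/
lemma mem_weakClosure_iff {S : StarSubalgebra ℂ (H →L[ℂ] H)} {x : H →L[ℂ] H} :
    x ∈ weakClosure S ↔ ∀ y, (∀ s ∈ S, s * y = y * s) → y * x = x * y := by
  change x ∈ StarSubalgebra.centralizer ℂ
    (StarSubalgebra.centralizer ℂ (S : Set (H →L[ℂ] H)) : Set (H →L[ℂ] H)) ↔ _
  have h : ∀ y, y ∈ StarSubalgebra.centralizer ℂ (S : Set (H →L[ℂ] H)) ↔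
      ∀ s ∈ S, s * y = y * s := fun y => by
    rw [StarSubalgebra.mem_centralizer_iff]
    exact ⟨fun h s hs => (h s hs).1, fun h s hs => ⟨h s hs, h _ (star_mem hs)⟩⟩
  rw [StarSubalgebra.mem_centralizer_iff]
  constructor
  · exact fun hx y hy => (hx y ((h y).2 hy)).1
  · exact fun hx y hy => ⟨hx y ((h y).1 hy), hx _ ((h _).1 (star_mem hy))⟩

lemma mem_weakClosure_of_mem {S : StarSubalgebra ℂ (H →L[ℂ] H)} {x : H →L[ℂ] H} (hx : x ∈ S) :
    x ∈ weakClosure S :=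
  mem_weakClosure_iff.2 fun _ hy => (hy x hx).symm

/-- An operator which commutes with an algebra commutes with its weak closure. -/
lemma commute_weakClosure {S : StarSubalgebra ℂ (H →L[ℂ] H)} {y : H →L[ℂ] H}
    (hy : ∀ s ∈ S, s * y = y * s) {x : H →L[ℂ] H} (hx : x ∈ weakClosure S) : x * y = y * x :=
  (mem_weakClosure_iff.1 hx y hy).symm

lemma weakClosure_le {S R : StarSubalgebra ℂ (H →L[ℂ] H)} (h : ∀ s ∈ S, s ∈ weakClosure R)
    {x : H →L[ℂ] H} (hx : x ∈ weakClosure S) : x ∈ weakClosure R :=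
  mem_weakClosure_iff.2 fun _ hy =>
    mem_weakClosure_iff.1 hx _ fun s hs => commute_weakClosure hy (h s hs)

lemma weakClosure_mono {S R : StarSubalgebra ℂ (H →L[ℂ] H)} (h : S ≤ R)
    {x : H →L[ℂ] H} (hx : x ∈ weakClosure S) : x ∈ weakClosure R :=
  weakClosure_le (fun _ hs => mem_weakClosure_of_mem (h hs)) hx

lemma isClosed_weakClosure (S : StarSubalgebra ℂ (H →L[ℂ] H)) :
    IsClosed {x : H →L[ℂ] H | x ∈ weakClosure S} := by
  simp only [mem_weakClosure_iff, Set.ofPred_forall]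
  exact isClosed_iInter fun y => isClosed_iInter fun _ =>
    isClosed_eq (continuous_const.mul continuous_id) (continuous_id.mul continuous_const)

/-- Operators which, with their adjoints, leave a closed subspace invariant commute with the
projection onto the subspace. -/
lemma starProjection_commute {E : Type*} [NormedAddCommGroup E] [InnerProductSpace ℂ E]
    [CompleteSpace E] (K : Submodule ℂ E) [K.HasOrthogonalProjection] {y y' : E →L[ℂ] E}
    (hadj : ∀ v w, ⟪y' v, w⟫_ℂ = ⟪v, y w⟫_ℂ) (h : ∀ v ∈ K, y v ∈ K) (h' : ∀ v ∈ K, y' v ∈ K)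
    (v : E) : K.starProjection (y v) = y (K.starProjection v) := by
  refine Submodule.eq_starProjection_of_mem_orthogonal
    (h _ (Submodule.starProjection_apply_mem K v)) ?_
  rw [← map_sub, Submodule.mem_orthogonal]
  intro w hw
  rw [← hadj]
  exact (Submodule.mem_orthogonal K _).1 (K.sub_starProjection_mem_orthogonal v) _ (h' w hw)

/-- The componentwise action on sequences, as a bounded operator. -/
def amplifyL (a : H →L[ℂ] H) : SqSummable H →L[ℂ] SqSummable H :=
  LinearMap.mkContinuous
    { toFun := amplify a
      map_add' := fun ξ η => by ext n; exact map_add a (ξ n) (η n)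
      map_smul' := fun c ξ => by ext n; exact map_smul a c (ξ n) } ‖a‖ (fun ξ => by
    have h2 : (2 : ENNReal).toReal = 2 := by norm_num
    refine lp.norm_le_of_forall_sum_le (by norm_num) (by positivity) fun s => ?_
    have h := lp.sum_rpow_le_norm_rpow (p := 2) (by norm_num) ξ s
    rw [h2] at h ⊢
    rw [Real.mul_rpow (norm_nonneg _) (norm_nonneg _)]
    refine le_trans ?_ (mul_le_mul_of_nonneg_left h (by positivity))
    rw [Finset.mul_sum]
    refine Finset.sum_le_sum fun n _ => ?_
    rw [← Real.mul_rpow (norm_nonneg _) (norm_nonneg _)]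
    exact Real.rpow_le_rpow (norm_nonneg _) (a.le_opNorm _) (by norm_num))

@[simp] lemma amplifyL_apply (a : H →L[ℂ] H) (ξ : SqSummable H) : amplifyL a ξ = amplify a ξ := rfl

@[simp] lemma amplify_coe (a : H →L[ℂ] H) (ξ : SqSummable H) (n : ℕ) :
    amplify a ξ n = a (ξ n) := rfl

lemma inner_amplify_left (a : H →L[ℂ] H) (ξ η : SqSummable H) :
    ⟪amplify (star a) ξ, η⟫_ℂ = ⟪ξ, amplify a η⟫_ℂ := by
  simp only [lp.inner_eq_tsum, amplify_coe, ContinuousLinearMap.star_eq_adjoint,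
    ContinuousLinearMap.adjoint_inner_left]

/-- Inclusion of a component. -/
def component (H : Type u) [NormedAddCommGroup H] [InnerProductSpace ℂ H] (n : ℕ) :
    H →L[ℂ] SqSummable H := lp.singleContinuousLinearMap ℂ (fun _ : ℕ => H) 2 n

lemma inner_component (n : ℕ) (v : H) (ξ : SqSummable H) :
    ⟪component H n v, ξ⟫_ℂ = ⟪v, ξ n⟫_ℂ := lp.inner_single_left n v ξ

lemma adjoint_component (n : ℕ) (ξ : SqSummable H) :
    ContinuousLinearMap.adjoint (component H n) ξ = ξ n :=
  ext_inner_left ℂ fun v => by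
    rw [ContinuousLinearMap.adjoint_inner_right, inner_component]

lemma amplify_component (a : H →L[ℂ] H) (n : ℕ) (v : H) :
    amplify a (component H n v) = component H n (a v) := by
  ext m
  rw [amplify_coe]
  simp only [component, lp.singleContinuousLinearMap_apply, lp.single_apply]
  by_cases h : m = n
  · subst h; simp
  · simp [Pi.single_eq_of_ne h]

/-- Operators on sequences which commute with the action of an algebra commute with the action of
its weak closure. -/
lemma amplify_commute {S : StarSubalgebra ℂ (H →L[ℂ] H)}
    {P : SqSummable H →L[ℂ] SqSummable H}
    (hP : ∀ s ∈ S, ∀ ξ, P (amplify s ξ) = amplify s (P ξ)) {x : H →L[ℂ] H}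
    (hx : x ∈ weakClosure S) (ξ : SqSummable H) : P (amplify x ξ) = amplify x (P ξ) := by
  have key : P ∘L amplifyL x = amplifyL x ∘L P := by
    refine lp.ext_continuousLinearMap (𝕜 := ℂ) (by norm_num) fun n => ?_
    ext v m
    -- This is a matrix element of `P`. All matrix elements lie in the commutant of `S`, so they
    -- commute with `x`.
    let y : H →L[ℂ] H := ContinuousLinearMap.adjoint (component H m) ∘L P ∘L component H n
    have hy : ∀ v, y v = P (component H n v) m := fun v => adjoint_component m _
    have hys : ∀ s ∈ S, s * y = y * s := by
      intro s hs
      ext v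
      simp only [mul_apply_eq_comp, hy]
      rw [← amplify_component, hP s hs, amplify_coe]
    have := congrArg (fun z => z v) (mem_weakClosure_iff.1 hx y hys)
    simp only [mul_apply_eq_comp, hy] at this
    change P (amplify x (component H n v)) m = amplify x (P (component H n v)) m
    rw [amplify_component, this, amplify_coe]
  exact congrArg (fun z => z ξ) key

/-- The double commutant theorem: the weak closure of an algebra is contained in its ultrastrong
closure. -/
theorem amplify_mem_closure {S : StarSubalgebra ℂ (H →L[ℂ] H)} {x : H →L[ℂ] H}
    (hx : x ∈ weakClosure S) (ξ : SqSummable H) :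
    amplify x ξ ∈ closure ((fun a => amplify a ξ) '' (S : Set (H →L[ℂ] H))) := by
  let K₀ : Submodule ℂ (SqSummable H) :=
    { carrier := (fun a => amplify a ξ) '' (S : Set (H →L[ℂ] H))
      add_mem' := by
        rintro _ _ ⟨a, ha, rfl⟩ ⟨b, hb, rfl⟩
        exact ⟨a + b, add_mem ha hb, by ext n; simp⟩
      zero_mem' := ⟨0, zero_mem _, by ext n; simp⟩
      smul_mem' := by
        rintro c _ ⟨a, ha, rfl⟩
        exact ⟨c • a, S.smul_mem ha c, by ext n; simp⟩ }
  let K := K₀.topologicalClosure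
  have hKc : (K : Set (SqSummable H)) =
      closure ((fun a => amplify a ξ) '' (S : Set (H →L[ℂ] H))) := K₀.topologicalClosure_coe
  have : CompleteSpace K := K₀.isClosed_topologicalClosure.completeSpace_coe
  have inv : ∀ s ∈ S, ∀ v ∈ K, amplifyL s v ∈ K := by
    intro s hs v hv
    rw [← SetLike.mem_coe, hKc] at hv ⊢
    refine map_mem_closure (amplifyL s).continuous hv ?_
    rintro _ ⟨a, ha, rfl⟩
    exact ⟨s * a, mul_mem hs ha, by ext n; simp⟩
  have hP : ∀ s ∈ S, ∀ η, K.starProjection (amplify s η) = amplify s (K.starProjection η) :=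
    fun s hs η => starProjection_commute K (y := amplifyL s) (y' := amplifyL (star s))
      (inner_amplify_left s) (inv s hs) (inv _ (star_mem hs)) η
  -- The projection onto the closure of `S ξ` commutes with `x`, and it fixes `ξ` because `S` is
  -- unital. So `x ξ` stays in that subspace.
  have h1 := amplify_commute hP hx ξ
  have hξ : ξ ∈ K := K₀.le_topologicalClosure ⟨1, one_mem S, by ext n; simp⟩
  rw [Submodule.starProjection_eq_self_iff.2 hξ] at h1
  rw [← hKc, SetLike.mem_coe, ← h1]
  exact Submodule.starProjection_apply_mem K _

/-- Prepending a vector to a sequence. -/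
def consSq (η : H) (ξ : SqSummable H) : SqSummable H :=
  ⟨fun n => Nat.casesOn n η ξ, by
    refine memℓp_gen ((summable_nat_add_iff 1).1 ?_)
    exact (lp.memℓp ξ).summable (by norm_num)⟩

@[simp] lemma consSq_zero (η : H) (ξ : SqSummable H) : consSq η ξ 0 = η := rfl

@[simp] lemma consSq_succ (η : H) (ξ : SqSummable H) (n : ℕ) : consSq η ξ (n + 1) = ξ n := rfl

lemma amplify_consSq (a : H →L[ℂ] H) (η : H) (ξ : SqSummable H) :
    amplify a (consSq η ξ) = consSq (a η) (amplify a ξ) := by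
  ext n; cases n <;> rfl

lemma inner_consSq (η η' : H) (ξ ξ' : SqSummable H) :
    ⟪consSq η ξ, consSq η' ξ'⟫_ℂ = ⟪η, η'⟫_ℂ + ⟪ξ, ξ'⟫_ℂ := by
  have hs : Summable fun n => ⟪(consSq η ξ : SqSummable H) n, (consSq η' ξ' : SqSummable H) n⟫_ℂ :=
    lp.summable_inner (consSq η ξ) (consSq η' ξ')
  have h := hs.tsum_eq_zero_add
  simp only [consSq_zero, consSq_succ] at h
  exact (lp.inner_eq_tsum _ _).trans (h.trans (congrArg _ (lp.inner_eq_tsum ξ ξ').symm))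

/-- A normal functional which vanishes on an algebra vanishes on its weak closure. -/
lemma inner_amplify_eq_zero {S : StarSubalgebra ℂ (H →L[ℂ] H)} {ξ ζ : SqSummable H}
    (h : ∀ a ∈ S, ⟪ζ, amplify a ξ⟫_ℂ = 0) {x : H →L[ℂ] H} (hx : x ∈ weakClosure S) :
    ⟪ζ, amplify x ξ⟫_ℂ = 0 := by
  have hc : IsClosed {θ : SqSummable H | ⟪ζ, θ⟫_ℂ = 0} :=
    isClosed_eq (by fun_prop) continuous_const
  refine hc.closure_subset_iff.2 ?_ (amplify_mem_closure hx ξ)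
  rintro _ ⟨a, ha, rfl⟩
  exact h a ha

/-- The difference of the two functionals is again given by a pair of sequences: prepend `-η` on one
side and `η` on the other. -/
lemma normalFunctional_eq_inner {S : StarSubalgebra ℂ (H →L[ℂ] H)} {ξ : SqSummable H} {η : H}
    (h : ∀ a ∈ S, normalFunctional ξ a = ⟪η, a η⟫_ℂ) {x : H →L[ℂ] H} (hx : x ∈ weakClosure S) :
    normalFunctional ξ x = ⟪η, x η⟫_ℂ := by
  have key : ∀ a, ⟪consSq (-η) ξ, amplify a (consSq η ξ)⟫_ℂ =
      normalFunctional ξ a - ⟪η, a η⟫_ℂ := by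
    intro a
    rw [amplify_consSq, inner_consSq, inner_neg_left, lp.inner_eq_tsum, normalFunctional]
    simp only [amplify_coe]
    ring
  refine sub_eq_zero.1 ?_
  rw [← key]
  exact inner_amplify_eq_zero (fun a ha => by rw [key, h a ha, sub_self]) hx

/-! ### Density of the unitary group -/

/-- Selfadjoint elements of the weak closure are strongly approximated by selfadjoint elements. -/
lemma exists_isSelfAdjoint_approx {A : Type*} [CStarAlgebra A] (π : A →⋆ₐ[ℂ] (H →L[ℂ] H))
    {k : H →L[ℂ] H} (hk : k ∈ weakClosure π.range) (hks : IsSelfAdjoint k) (η : H) {ε : ℝ}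
    (hε : 0 < ε) : ∃ a : A, IsSelfAdjoint a ∧ ‖π a η - k η‖ < ε := by
  let R : Submodule ℝ H :=
    { carrier := {v | ∃ a : A, IsSelfAdjoint a ∧ π a η = v}
      add_mem' := by
        rintro _ _ ⟨a, ha, rfl⟩ ⟨b, hb, rfl⟩
        exact ⟨a + b, ha.add hb, by simp⟩
      zero_mem' := ⟨0, .zero A, by simp⟩
      smul_mem' := by
        rintro c _ ⟨a, ha, rfl⟩
        refine ⟨(c : ℂ) • a, ?_, by rw [map_smul, smul_apply, Complex.coe_smul]⟩
        rw [IsSelfAdjoint, star_smul, ha.star_eq]; simp }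
  have hmem : k η ∈ closure (R : Set H) := by
    by_contra hnot
    obtain ⟨f, u, h1, h2⟩ := RCLike.geometric_hahn_banach_closed_point (𝕜 := ℂ)
      R.convex.closure isClosed_closure hnot
    obtain ⟨ζ, rfl⟩ := (InnerProductSpace.toDual ℂ H).surjective f
    simp only [InnerProductSpace.toDual_apply_apply] at h1 h2
    have hu : 0 < u := by simpa using h1 0 (subset_closure R.zero_mem)
    have hzero : ∀ a : A, IsSelfAdjoint a → RCLike.re ⟪ζ, π a η⟫_ℂ = 0 := by
      intro a ha
      by_contra hne
      have hr : ((u / RCLike.re ⟪ζ, π a η⟫_ℂ : ℝ)) • π a η ∈ R := R.smul_mem _ ⟨a, ha, rfl⟩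
      have h3 := h1 _ (subset_closure hr)
      rw [← Complex.coe_smul, inner_smul_right] at h3
      simp only [RCLike.re_to_complex, Complex.re_ofReal_mul] at h3 hne
      rw [div_mul_cancel₀ _ hne] at h3
      exact lt_irrefl _ h3
    -- Hahn-Banach only controls real parts on selfadjoint elements. This functional is complex
    -- linear and normal, and on selfadjoint `x` it is twice the real part, so it vanishes on the
    -- algebra and hence at `k`.
    have key : ∀ x : H →L[ℂ] H, ⟪consSq ζ (consSq η 0), amplify x (consSq η (consSq ζ 0))⟫_ℂ =
        ⟪ζ, x η⟫_ℂ + ⟪η, x ζ⟫_ℂ := by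
      intro x
      rw [amplify_consSq, amplify_consSq, inner_consSq, inner_consSq, inner_zero_left, add_zero]
    have hre : ∀ x : H →L[ℂ] H, IsSelfAdjoint x →
        ⟪ζ, x η⟫_ℂ + ⟪η, x ζ⟫_ℂ = ((2 * RCLike.re ⟪ζ, x η⟫_ℂ : ℝ) : ℂ) := by
      intro x hx
      have h3 : ⟪η, x ζ⟫_ℂ = (starRingEnd ℂ) ⟪ζ, x η⟫_ℂ := by
        rw [inner_conj_symm, ← ContinuousLinearMap.adjoint_inner_left,
          ← ContinuousLinearMap.star_eq_adjoint, hx.star_eq]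
      rw [h3, Complex.add_conj]; simp
    have hsa : ∀ a : A, IsSelfAdjoint a →
        ⟪consSq ζ (consSq η 0), amplify (π a) (consSq η (consSq ζ 0))⟫_ℂ = 0 := by
      intro a ha
      rw [key, hre _ (ha.map π), hzero a ha]; simp
    have hall : ∀ x ∈ π.range,
        ⟪consSq ζ (consSq η 0), amplify x (consSq η (consSq ζ 0))⟫_ℂ = 0 := by
      rintro _ ⟨a, rfl⟩
      have hR := hsa _ (realPart a).2
      have hI := hsa _ (imaginaryPart a).2
      rw [key] at hR hI
      change ⟪consSq ζ (consSq η 0), amplify (π a) (consSq η (consSq ζ 0))⟫_ℂ = 0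
      rw [key, ← realPart_add_I_smul_imaginaryPart a]
      simp only [map_add, map_smul, add_apply, smul_apply,
        inner_add_right, inner_smul_right]
      linear_combination hR + Complex.I * hI
    have h3 := inner_amplify_eq_zero hall hk
    rw [key, hre k hks] at h3
    have h4 : RCLike.re ⟪ζ, k η⟫_ℂ = 0 := by
      have := Complex.ofReal_eq_zero.1 h3; linarith
    linarith
  obtain ⟨_, ⟨a, ha, rfl⟩, h⟩ := Metric.mem_closure_iff.1 hmem ε hε
  exact ⟨a, ha, by rwa [← dist_eq_norm, dist_comm]⟩

/-- Cayley transforms of selfadjoint elements of the weak closure are strongly approximated by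
unitaries. -/
lemma exists_unitary_approx_cayley {A : Type*} [CStarAlgebra A] (π : A →⋆ₐ[ℂ] (H →L[ℂ] H))
    {k V : H →L[ℂ] H} (hk : k ∈ weakClosure π.range) (hks : IsSelfAdjoint k)
    (hV : V * (k + Complex.I • 1) = k - Complex.I • 1)
    (hsurj : Function.Surjective (k + Complex.I • (1 : H →L[ℂ] H))) (ξ : H) {ε : ℝ}
    (hε : 0 < ε) : ∃ u ∈ unitary A, ‖π u ξ - V ξ‖ < ε := by
  obtain ⟨η, rfl⟩ := hsurj ξ
  obtain ⟨a, ha, hlt⟩ := exists_isSelfAdjoint_approx π hk hks η (half_pos hε)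
  have hunit : IsUnit (a + Complex.I • (1 : A)) := by
    have h1 : (-Complex.I) ∉ spectrum ℂ a := by
      intro h
      have := ha.im_eq_zero_of_mem_spectrum h
      simp at this
    rw [spectrum.notMem_iff] at h1
    rw [← IsUnit.neg_iff]
    convert h1 using 1
    rw [Algebra.algebraMap_eq_smul_one]; simp [add_comm, sub_eq_add_neg]
  obtain ⟨b, hb⟩ := hunit
  have hsb : star (b : A) = a - Complex.I • 1 := by
    rw [hb, star_add, ha.star_eq, star_smul]; simp [sub_eq_add_neg]
  have hcomm : star (b : A) * b = b * star (b : A) := by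
    rw [hsb, hb]
    simp only [mul_add, add_mul, sub_mul, mul_sub, smul_mul_assoc, mul_smul_comm, one_mul, mul_one,
      smul_add, smul_sub]
    abel
  have hub : (star (b : A) * (↑b⁻¹ : A)) * b = star (b : A) := by
    rw [mul_assoc, Units.inv_mul, mul_one]
  have hstarinv : star (↑b⁻¹ : A) * star (b : A) = 1 := by
    rw [← star_mul, Units.mul_inv, star_one]
  have hstarinv' : star (b : A) * star (↑b⁻¹ : A) = 1 := by
    rw [← star_mul, Units.inv_mul, star_one]
  set u : A := star (b : A) * (↑b⁻¹ : A) with hu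
  have hu1 : star u * u = 1 := by
    rw [hu, star_mul, star_star]
    calc star (↑b⁻¹ : A) * b * (star (b : A) * ↑b⁻¹)
        = star (↑b⁻¹ : A) * (b * star (b : A)) * ↑b⁻¹ := by noncomm_ring
      _ = (star (↑b⁻¹ : A) * star (b : A)) * (b * ↑b⁻¹) := by rw [← hcomm]; noncomm_ring
      _ = 1 := by rw [hstarinv, Units.mul_inv, one_mul]
  have hinvcomm : (↑b⁻¹ : A) * star (b : A) = star (b : A) * ↑b⁻¹ := by
    calc (↑b⁻¹ : A) * star (b : A) = ↑b⁻¹ * (star (b : A) * b) * ↑b⁻¹ := by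
          rw [mul_assoc (↑b⁻¹ : A), mul_assoc (star (b : A)), Units.mul_inv, mul_one]
      _ = (↑b⁻¹ * b) * star (b : A) * ↑b⁻¹ := by rw [hcomm]; noncomm_ring
      _ = _ := by rw [Units.inv_mul, one_mul]
  have hu2 : u * star u = 1 := by
    rw [hu, star_mul, star_star, ← hinvcomm]
    calc (↑b⁻¹ : A) * star (b : A) * (star (↑b⁻¹ : A) * b)
        = ↑b⁻¹ * (star (b : A) * star (↑b⁻¹ : A)) * b := by noncomm_ring
      _ = 1 := by rw [hstarinv', mul_one, Units.inv_mul]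
  refine ⟨u, ⟨hu1, hu2⟩, ?_⟩
  have hiso : ∀ v, ‖π u v‖ = ‖v‖ := by
    intro v
    have h3 : star (π u) * π u = 1 := by rw [← map_star, ← map_mul, hu1, map_one]
    have h4 : ⟪π u v, π u v⟫_ℂ = ⟪v, v⟫_ℂ := by
      rw [← ContinuousLinearMap.adjoint_inner_right, ← ContinuousLinearMap.star_eq_adjoint,
        ← mul_apply_eq_comp, h3, one_apply_eq_self]
    rw [@norm_eq_sqrt_re_inner ℂ, h4, ← @norm_eq_sqrt_re_inner ℂ]
  have e1 : V ((k + Complex.I • (1 : H →L[ℂ] H)) η) = k η - Complex.I • η := by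
    rw [← mul_apply_eq_comp, hV]; simp
  have e2 : π u (π a η + Complex.I • η) = π a η - Complex.I • η := by
    have : π u * π (b : A) = π (star (b : A)) := by rw [← map_mul, hub]
    rw [hsb, hb] at this
    have := congrArg (fun z => z η) this
    simpa using this
  -- The Cayley transforms differ on `(k + i) η` by at most twice the error on `η`, since `π u` is
  -- isometric. This is why `a` was chosen up to `ε / 2`.
  have e3 : π u ((k + Complex.I • (1 : H →L[ℂ] H)) η) - V ((k + Complex.I • (1 : H →L[ℂ] H)) η) =
      (π a η - k η) - π u (π a η - k η) := by
    rw [e1]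
    have : (k + Complex.I • (1 : H →L[ℂ] H)) η = (π a η + Complex.I • η) - (π a η - k η) := by
      simp
      abel
    rw [this, map_sub, e2]; abel
  rw [e3]
  calc _ ≤ ‖π a η - k η‖ + ‖π u (π a η - k η)‖ := norm_sub_le _ _
    _ < ε := by rw [hiso]; linarith

/-- The phase of a selfadjoint operator, as a symmetry. -/
lemma exists_symmetry {b c : H →L[ℂ] H} (hb : IsSelfAdjoint b) (hc : IsSelfAdjoint c)
    (hcomm : c * b = b * c) (hsq : c * c = b * b) :
    ∃ s : H →L[ℂ] H, IsSelfAdjoint s ∧ s * s = 1 ∧ s * c = b ∧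
      ∀ y, y * (c + b) = (c + b) * y → star y * (c + b) = (c + b) * star y → y * s = s * y := by
  -- With `P` the projection onto `K`, `P (c + b) = c + b`, and `P (c - b) = 0` because `(c - b)(c +
  -- b) = 0`. Adding up, `2 P c = c + b`, so `s = 2 P - 1` satisfies `s c = b`.
  let K : Submodule ℂ H := ((c + b : H →L[ℂ] H) : H →ₗ[ℂ] H).range.topologicalClosure
  have hKc : (K : Set H) = closure (Set.range (c + b)) := by
    rw [Submodule.topologicalClosure_coe]; rfl
  have : CompleteSpace K := (Submodule.isClosed_topologicalClosure _).completeSpace_coe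
  set P : H →L[ℂ] H := K.starProjection with hPdef
  have hmem : ∀ v, (c + b) v ∈ K := fun v => Submodule.le_topologicalClosure _ ⟨v, rfl⟩
  have h1 : P * (c + b) = c + b := by
    ext v
    exact Submodule.starProjection_eq_self_iff.2 (hmem v)
  have h2 : (c - b) * P = 0 := by
    ext v
    have hcl : IsClosed {w : H | (c - b) w = 0} := isClosed_eq (c - b).continuous continuous_const
    have hv : P v ∈ closure (Set.range (c + b)) := by
      rw [← hKc]; exact Submodule.starProjection_apply_mem K v
    refine hcl.closure_subset_iff.2 ?_ hv
    rintro _ ⟨w, rfl⟩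
    have : (c - b) * (c + b) = 0 := by
      rw [sub_mul, mul_add, mul_add, hsq, hcomm]; abel
    exact congrArg (fun z => z w) this
  have hPs : star P = P := (isStarProjection_starProjection (U := K)).isSelfAdjoint
  have hPi : P * P = P := (isStarProjection_starProjection (U := K)).isIdempotentElem
  have h3 : P * (c - b) = 0 := by
    have := congrArg star h2
    rwa [star_mul, hPs, star_sub, hc.star_eq, hb.star_eq, star_zero] at this
  refine ⟨P + P - 1, ?_, ?_, ?_, fun y hy hy' => ?_⟩
  · rw [IsSelfAdjoint, star_sub, star_add, hPs, star_one]
  · simp only [sub_mul, mul_sub, add_mul, mul_add, hPi, one_mul, mul_one]; abel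
  · rw [mul_add] at h1
    rw [mul_sub, sub_eq_zero] at h3
    rw [sub_mul, add_mul, one_mul]
    nth_rewrite 2 [h3]
    rw [h1]; abel
  · have hinv : ∀ y : H →L[ℂ] H, y * (c + b) = (c + b) * y → ∀ v ∈ K, y v ∈ K := by
      intro y hy v hv
      rw [← SetLike.mem_coe, hKc] at hv ⊢
      refine map_mem_closure y.continuous hv ?_
      rintro _ ⟨w, rfl⟩
      exact ⟨y w, (congrArg (fun z => z w) hy).symm⟩
    have hyP : P * y = y * P := by
      ext v
      exact starProjection_commute K (y := y) (y' := star y) (fun v w => by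
        rw [ContinuousLinearMap.star_eq_adjoint, ContinuousLinearMap.adjoint_inner_left])
        (hinv y hy) (hinv _ hy') v
    rw [mul_sub, mul_add, sub_mul, add_mul, hyP, mul_one, one_mul]

/-- Kaplansky's density theorem for unitaries: the unitaries of the weak closure are strongly
approximated by unitaries of the algebra. -/
theorem exists_unitary_approx {A : Type*} [CStarAlgebra A] (π : A →⋆ₐ[ℂ] (H →L[ℂ] H))
    {U : H →L[ℂ] H} (hUM : U ∈ weakClosure π.range) (hU : U ∈ unitary (H →L[ℂ] H)) (ξ : H) {ε : ℝ}
    (hε : 0 < ε) : ∃ u ∈ unitary A, ‖π u ξ - U ξ‖ < ε := by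
  rcases subsingleton_or_nontrivial H with hH | hH
  · exact ⟨1, one_mem _, by rw [Subsingleton.elim (π 1 ξ) (U ξ), sub_self, norm_zero]; exact hε⟩
  have hU1 : star U * U = 1 := hU.1
  have hU2 : U * star U = 1 := hU.2
  obtain ⟨a, ha⟩ : ∃ a, a = (1 / 2 : ℂ) • (U + star U) := ⟨_, rfl⟩
  obtain ⟨b, hb⟩ : ∃ b, b = (-Complex.I / 2 : ℂ) • (U - star U) := ⟨_, rfl⟩
  have has : IsSelfAdjoint a := by
    rw [IsSelfAdjoint, ha, star_smul, star_add, star_star, add_comm]; simp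
  have hbs : IsSelfAdjoint b := by
    rw [IsSelfAdjoint, hb, star_smul, star_sub, star_star, ← neg_sub U, smul_neg, ← neg_smul]
    congr 1; simp; ring
  have hUab : U = a + Complex.I • b := by
    rw [ha, hb, smul_smul, show Complex.I * (-Complex.I / 2) = 1 / 2 by
      rw [mul_div_assoc', mul_neg, Complex.I_mul_I]; norm_num, ← smul_add]
    rw [show U + star U + (U - star U) = (2 : ℂ) • U by rw [two_smul]; abel, smul_smul]
    norm_num
  have hab : a * b = b * a := by
    rw [ha, hb]
    simp only [smul_mul_assoc, mul_smul_comm, mul_sub, sub_mul, add_mul, mul_add, hU1, hU2]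
    module
  have hsq : a * a + b * b = 1 := by
    rw [ha, hb]
    simp only [smul_mul_assoc, mul_smul_comm, mul_sub, sub_mul, add_mul, mul_add, hU1, hU2,
      smul_add, smul_sub, smul_smul]
    rw [show (-Complex.I / 2 : ℂ) * (-Complex.I / 2) = -(1 / 4) by
      rw [div_mul_div_comm, neg_mul_neg, Complex.I_mul_I]; norm_num]
    module
  have hnorm : ‖a‖ ≤ 1 := by
    have h1 : ‖U‖ ≤ 1 := CStarRing.norm_of_mem_unitary hU |>.le
    have h2 : ‖star U‖ ≤ 1 := by rwa [norm_star]
    rw [ha, norm_smul]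
    have := norm_add_le U (star U)
    norm_num
    linarith
  have hspec : ∀ x ∈ spectrum ℝ a, -1 ≤ x ∧ x ≤ 1 := fun x hx => by
    have := (spectrum.norm_le_norm_of_mem hx).trans hnorm
    rwa [Real.norm_eq_abs, abs_le] at this
  -- Writing `U = e^{iθ}` with `|θ| ≤ π`, so that `a = cos θ` and `b = sin θ`, these functions are
  -- `cos (θ/2)`, `|sin (θ/2)|` and `|tan (θ/4)|`. They depend continuously on `a`.
  let fp : ℝ → ℝ := fun x => √((1 + x) / 2)
  let fq : ℝ → ℝ := fun x => √((1 - x) / 2)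
  let ft : ℝ → ℝ := fun x => fq x / (1 + fp x)
  have hfp0 : ∀ x, 0 < 1 + fp x := fun x => by positivity
  have hfpc : Continuous fp := by fun_prop
  have hfqc : Continuous fq := by fun_prop
  have hftc : Continuous ft := hfqc.div (by fun_prop) fun x => (hfp0 x).ne'
  have hfp : ∀ x ∈ spectrum ℝ a, fp x * fp x = (1 + x) / 2 := fun x hx =>
    Real.mul_self_sqrt (by linarith [(hspec x hx).1])
  have hfq : ∀ x ∈ spectrum ℝ a, fq x * fq x = (1 - x) / 2 := fun x hx =>
    Real.mul_self_sqrt (by linarith [(hspec x hx).2])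
  have hft : ∀ x, ft x + ft x * fp x = fq x := fun x => by
    have := (hfp0 x).ne'
    simp only [ft]; field_simp
  have hfpt : ∀ x ∈ spectrum ℝ a, fp x + fq x * ft x = 1 := fun x hx => by
    have h1 := hfp x hx
    have h2 := hfq x hx
    have h3 : (1 + fp x) * (fp x + fq x * ft x) = (1 + fp x) * 1 := by
      have : (1 + fp x) * (fp x + fq x * ft x) =
        fp x + fp x * fp x + fq x * (ft x + ft x * fp x) := by ring
      rw [this, hft, h1, h2]; ring
    exact mul_left_cancel₀ (hfp0 x).ne' h3
  set p := cfc fp a with hp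
  set q := cfc fq a with hq
  set t := cfc ft a with ht
  have hps : IsSelfAdjoint p := cfc_predicate fp a
  have hqs : IsSelfAdjoint q := cfc_predicate fq a
  have hts : IsSelfAdjoint t := cfc_predicate ft a
  have e1 : p * p - q * q = a := by
    rw [hp, hq, ← cfc_mul fp fp a hfpc.continuousOn hfpc.continuousOn,
      ← cfc_mul fq fq a hfqc.continuousOn hfqc.continuousOn,
      ← cfc_sub _ _ a (by fun_prop) (by fun_prop)]
    conv_rhs => rw [← cfc_id ℝ a]
    exact cfc_congr fun x hx => by simp only [hfp x hx, hfq x hx, id]; ring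
  have e2 : (p * q + p * q) * (p * q + p * q) + a * a = 1 := by
    have h1 : p * q + p * q = cfc (fun x => fp x * fq x + fp x * fq x) a := by
      rw [hp, hq, ← cfc_mul fp fq a hfpc.continuousOn hfqc.continuousOn,
        ← cfc_add a _ _ (by fun_prop) (by fun_prop)]
    have h2 : a * a = cfc (fun x : ℝ => x * x) a := by
      rw [cfc_mul (fun x : ℝ => x) (fun x : ℝ => x) a (by fun_prop) (by fun_prop), cfc_id' ℝ a]
    rw [h1, h2, ← cfc_mul _ _ a (by fun_prop) (by fun_prop),
      ← cfc_add a _ _ (by fun_prop) (by fun_prop), ← cfc_one ℝ a]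
    refine cfc_congr fun x hx => ?_
    have h3 : (fp x * fq x + fp x * fq x) * (fp x * fq x + fp x * fq x) =
      4 * (fp x * fp x) * (fq x * fq x) := by ring
    simp only [h3, hfp x hx, hfq x hx, Pi.one_apply]; ring
  have e3 : t + t * p = q := by
    rw [hp, hq, ht, ← cfc_mul ft fp a hftc.continuousOn hfpc.continuousOn,
      ← cfc_add a _ _ hftc.continuousOn (by fun_prop)]
    exact cfc_congr fun x _ => hft x
  have e4 : p + q * t = 1 := by
    rw [hp, hq, ht, ← cfc_mul fq ft a hfqc.continuousOn hftc.continuousOn,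
      ← cfc_add a _ _ hfpc.continuousOn (by fun_prop), ← cfc_one ℝ a]
    exact cfc_congr fun x hx => hfpt x hx
  have hpq : p * q = q * p := (cfc_commute_cfc fp fq a).eq
  have hpt : p * t = t * p := (cfc_commute_cfc fp ft a).eq
  have hqt : q * t = t * q := (cfc_commute_cfc fq ft a).eq
  have comm : ∀ y : H →L[ℂ] H, y * a = a * y → y * p = p * y ∧ y * q = q * y ∧ y * t = t * y :=
    fun y hy => ⟨(Commute.cfc_real (show Commute a y from hy.symm) fp).eq.symm,
      (Commute.cfc_real (show Commute a y from hy.symm) fq).eq.symm,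
      (Commute.cfc_real (show Commute a y from hy.symm) ft).eq.symm⟩
  obtain ⟨hbp, hbq, -⟩ := comm b hab.symm
  have hcs : IsSelfAdjoint (p * q + p * q) := by
    rw [IsSelfAdjoint, star_add, star_mul, hps.star_eq, hqs.star_eq, hpq]
  -- Here `2 p q = |sin θ|`, so `s` is a sign of `θ`. It need not be a continuous function of `U`,
  -- but it lies in the von Neumann algebra generated by `U`.
  obtain ⟨s, hsa, hss, hsc, hsy⟩ := exists_symmetry hbs hcs (by
      simp only [add_mul, mul_add]
      rw [← mul_assoc, hbp, mul_assoc, mul_assoc, hbq])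
    (add_right_cancel (e2.trans (by rw [← hsq]; abel) : _ = b * b + a * a))
  have hys : ∀ y : H →L[ℂ] H, y * a = a * y → y * b = b * y → star y * a = a * star y →
      star y * b = b * star y → y * s = s * y := by
    have : ∀ y : H →L[ℂ] H, y * a = a * y → y * b = b * y →
        y * (p * q + p * q + b) = (p * q + p * q + b) * y := by
      intro y h1 h2
      obtain ⟨h3, h4, -⟩ := comm y h1
      simp only [mul_add, add_mul, h2]
      rw [← mul_assoc, h3, mul_assoc, h4, mul_assoc]
    exact fun y h1 h2 h3 h4 => hsy y (this y h1 h2) (this _ h3 h4)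
  have hcfc : ∀ f : ℝ → ℝ, cfc f a * s = s * cfc f a := by
    intro f
    have hs : star (cfc f a) = cfc f a := (cfc_predicate f a : IsSelfAdjoint (cfc f a)).star_eq
    have h1 : cfc f a * a = a * cfc f a := (Commute.cfc_real (Commute.refl a) f).eq
    have h2 : cfc f a * b = b * cfc f a := (Commute.cfc_real (show Commute a b from hab) f).eq
    exact hys _ h1 h2 (by rwa [hs]) (by rwa [hs])
  have hps' : p * s = s * p := hcfc fp
  have hqs' : q * s = s * q := hcfc fq
  have hts' : t * s = s * t := hcfc ft
  have hkM : t * s ∈ weakClosure π.range := by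
    refine mem_weakClosure_iff.2 fun y hy => ?_
    have hyab : ∀ y, (∀ s ∈ π.range, s * y = y * s) → y * a = a * y ∧ y * b = b * y := by
      intro y hy
      have h1 := commute_weakClosure hy hUM
      have h2 := commute_weakClosure hy (star_mem hUM)
      rw [ha, hb]
      simp only [mul_smul_comm, smul_mul_assoc, mul_add, add_mul, mul_sub, sub_mul, h1, h2,
        and_self]
    obtain ⟨h1, h2⟩ := hyab y hy
    obtain ⟨h3, h4⟩ := hyab (star y) fun s hs => by
      have := congrArg star (hy _ (star_mem hs))
      simpa using this.symm
    rw [← mul_assoc, (comm y h1).2.2, mul_assoc, hys y h1 h2 h3 h4, mul_assoc]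
  -- `V = e^{iθ/2}` has nonnegative real part, so `-V` is the Cayley transform of the bounded
  -- operator `t s = tan (θ/4)`. Taking the square root avoids the unbounded transform that `U`
  -- itself might need.
  obtain ⟨V, hV⟩ : ∃ V, V = p + Complex.I • (q * s) := ⟨_, rfl⟩
  have hqsts : q * s * (t * s) = q * t := by
    rw [mul_assoc, ← mul_assoc s, ← hts', mul_assoc t, hss, mul_one]
  have htsqs : t * s * (q * s) = t * q := by
    rw [mul_assoc, ← mul_assoc s, ← hqs', mul_assoc q, hss, mul_one]
  have hqsqs : q * s * (q * s) = q * q := by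
    rw [mul_assoc, ← mul_assoc s, ← hqs', mul_assoc q, hss, mul_one]
  have hVV : V * V = U := by
    have h1 : p * (q * s) + q * s * p = b := by
      have hpqs : s * (p * q) = p * q * s := by
        rw [← mul_assoc, ← hps', mul_assoc, ← hqs', mul_assoc]
      rw [← hsc, mul_add, hpqs, mul_assoc q, ← hps', ← mul_assoc q, ← hpq, ← mul_assoc]
    rw [hV, hUab, ← h1, ← e1]
    simp only [mul_add, add_mul, smul_mul_assoc, mul_smul_comm, hqsqs, smul_smul, smul_add,
      Complex.I_mul_I, neg_smul, one_smul]
    abel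
  have hcay : (-V) * (t * s + Complex.I • 1) = t * s - Complex.I • 1 := by
    have h1 : t * s = q * s - p * (t * s) := by
      rw [← mul_assoc, hpt, ← sub_mul, ← e3]; simp
    have h2 : (1 : H →L[ℂ] H) = p + q * t := e4.symm
    rw [hV]
    simp only [neg_mul, neg_add, smul_neg, mul_add, add_mul, smul_mul_assoc, mul_smul_comm, hqsts,
      smul_add, smul_smul,
      Complex.I_mul_I, neg_smul, one_smul, mul_one]
    nth_rewrite 2 [h1]
    nth_rewrite 1 [h2]
    rw [smul_add]
    abel
  have hinv : (t * s + Complex.I • 1) * ((1 / (2 * Complex.I)) • (1 + V)) = 1 := by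
    have h1 : (t * s + Complex.I • 1) * (1 + V) = (2 * Complex.I) • (1 : H →L[ℂ] H) := by
      have h3 : t * s * p = q * s - t * s := by
        rw [mul_assoc, ← hps', ← mul_assoc, ← e3, add_mul]; simp
      rw [hV]
      simp only [mul_add, add_mul, smul_mul_assoc, mul_smul_comm, htsqs, smul_add, smul_smul,
        Complex.I_mul_I, neg_smul, one_smul, mul_one, one_mul, h3]
      rw [← hqt, eq_sub_of_add_eq' e4, smul_sub, two_mul, add_smul]
      abel
    rw [mul_smul_comm, h1, smul_smul, one_div_mul_cancel (by simp), one_smul]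
  have hks : IsSelfAdjoint (t * s) := by
    rw [IsSelfAdjoint, star_mul, hts.star_eq, hsa.star_eq, hts']
  have hsurj : Function.Surjective (t * s + Complex.I • (1 : H →L[ℂ] H)) := fun v =>
    ⟨_, congrArg (fun z => z v) hinv⟩
  -- `U = (-V)(-V)`: the right factor is approximated on `ξ`, the left one on `(-V) ξ`.
  obtain ⟨u₂, hu₂, h₂⟩ := exists_unitary_approx_cayley π hkM hks hcay hsurj ξ (half_pos hε)
  obtain ⟨u₁, hu₁, h₁⟩ :=
    exists_unitary_approx_cayley π hkM hks hcay hsurj ((-V) ξ) (half_pos hε)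
  refine ⟨u₁ * u₂, mul_mem hu₁ hu₂, ?_⟩
  have hUξ : U ξ = (-V) ((-V) ξ) := by rw [← hVV]; simp
  have hn : ‖π u₁‖ ≤ 1 :=
    (CStarRing.norm_of_mem_unitary (Unitary.map_mem π hu₁)).le
  rw [map_mul, mul_apply_eq_comp, hUξ]
  calc ‖π u₁ (π u₂ ξ) - (-V) ((-V) ξ)‖
      = ‖π u₁ (π u₂ ξ - (-V) ξ) + (π u₁ ((-V) ξ) - (-V) ((-V) ξ))‖ := by
        rw [map_sub]; congr 1; abel
    _ ≤ ‖π u₁ (π u₂ ξ - (-V) ξ)‖ + ‖π u₁ ((-V) ξ) - (-V) ((-V) ξ)‖ := norm_add_le _ _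
    _ ≤ 1 * ‖π u₂ ξ - (-V) ξ‖ + ‖π u₁ ((-V) ξ) - (-V) ((-V) ξ)‖ := by
        gcongr; exact (π u₁).le_of_opNorm_le hn _
    _ < ε := by linarith

/-! ### Homomorphisms of concrete C*-algebras -/

section Homomorphisms

variable {S : StarSubalgebra ℂ (H →L[ℂ] H)}

lemma norm_starAlgHom_le (hS : IsClosed (S : Set (H →L[ℂ] H))) (σ : S →⋆ₐ[ℂ] (H →L[ℂ] H)) (a : S) :
    ‖σ a‖ ≤ ‖a‖ := by
  have : IsClosed (S : Set (H →L[ℂ] H)) := hS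
  exact NonUnitalStarAlgHom.norm_apply_le σ a

lemma continuous_starAlgHom (hS : IsClosed (S : Set (H →L[ℂ] H))) (σ : S →⋆ₐ[ℂ] (H →L[ℂ] H)) :
    Continuous σ :=
  AddMonoidHomClass.continuous_of_bound σ 1 fun a => by
    rw [one_mul]; exact norm_starAlgHom_le hS σ a

/-- The algebra on which two homomorphisms are equal. -/
def eqAlg (σ σ' : S →⋆ₐ[ℂ] (H →L[ℂ] H)) : StarSubalgebra ℂ (H →L[ℂ] H) :=
  (StarAlgHom.equalizer σ σ').map S.subtype

lemma mem_eqAlg {σ σ' : S →⋆ₐ[ℂ] (H →L[ℂ] H)} {x : H →L[ℂ] H} :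
    x ∈ eqAlg σ σ' ↔ ∃ h : x ∈ S, σ ⟨x, h⟩ = σ' ⟨x, h⟩ := by
  rw [eqAlg, StarSubalgebra.mem_map]
  constructor
  · rintro ⟨a, ha, rfl⟩
    exact ⟨a.2, ha⟩
  · rintro ⟨h, hx⟩
    exact ⟨⟨x, h⟩, hx, rfl⟩

lemma isClosed_eqAlg (hS : IsClosed (S : Set (H →L[ℂ] H))) (σ σ' : S →⋆ₐ[ℂ] (H →L[ℂ] H)) :
    IsClosed (eqAlg σ σ' : Set (H →L[ℂ] H)) := by
  have h : (eqAlg σ σ' : Set (H →L[ℂ] H)) = Subtype.val '' {a : S | σ a = σ' a} := rfl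
  rw [h]
  exact hS.isClosedEmbedding_subtypeVal.isClosedMap _
    (isClosed_eq (continuous_starAlgHom hS σ) (continuous_starAlgHom hS σ'))

/-- The algebra which is mapped by a homomorphism into a given one. -/
def preAlg (σ : S →⋆ₐ[ℂ] (H →L[ℂ] H)) (R : StarSubalgebra ℂ (H →L[ℂ] H)) :
    StarSubalgebra ℂ (H →L[ℂ] H) :=
  (R.comap σ).map S.subtype

lemma mem_preAlg {σ : S →⋆ₐ[ℂ] (H →L[ℂ] H)} {R : StarSubalgebra ℂ (H →L[ℂ] H)} {x : H →L[ℂ] H} :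
    x ∈ preAlg σ R ↔ ∃ h : x ∈ S, σ ⟨x, h⟩ ∈ R := by
  rw [preAlg, StarSubalgebra.mem_map]
  constructor
  · rintro ⟨a, ha, rfl⟩
    exact ⟨a.2, ha⟩
  · rintro ⟨h, hx⟩
    exact ⟨⟨x, h⟩, hx, rfl⟩

lemma isClosed_preAlg (hS : IsClosed (S : Set (H →L[ℂ] H))) (σ : S →⋆ₐ[ℂ] (H →L[ℂ] H))
    {R : StarSubalgebra ℂ (H →L[ℂ] H)} (hR : IsClosed (R : Set (H →L[ℂ] H))) :
    IsClosed (preAlg σ R : Set (H →L[ℂ] H)) := by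
  have h : (preAlg σ R : Set (H →L[ℂ] H)) = Subtype.val '' (σ ⁻¹' (R : Set (H →L[ℂ] H))) := rfl
  rw [h]
  exact hS.isClosedEmbedding_subtypeVal.isClosedMap _
    (hR.preimage (continuous_starAlgHom hS σ))

lemma isClosed_centralizer (X : Set (H →L[ℂ] H)) :
    IsClosed (StarSubalgebra.centralizer ℂ X : Set (H →L[ℂ] H)) := by
  rw [StarSubalgebra.coe_centralizer]
  exact Set.isClosed_centralizer _

lemma le_centralizer_iff {y : H →L[ℂ] H} :
    S ≤ StarSubalgebra.centralizer ℂ {y} ↔ ∀ s ∈ S, s * y = y * s := by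
  constructor
  · intro h s hs
    exact ((StarSubalgebra.mem_centralizer_iff ℂ).1 (h hs) y rfl).1.symm
  · intro h s hs
    rw [StarSubalgebra.mem_centralizer_iff]
    rintro g rfl
    refine ⟨(h s hs).symm, ?_⟩
    have := congrArg star (h _ (star_mem hs))
    simpa using this

end Homomorphisms

/-! ### Limits of inner automorphisms -/

section Limits

lemma conj_mul_conj {w : H →L[ℂ] H} (hw : w ∈ unitary (H →L[ℂ] H)) (x y : H →L[ℂ] H) :
    w * (x * y) * star w = (w * x * star w) * (w * y * star w) := by
  have h : star w * w = 1 := hw.1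
  calc w * (x * y) * star w = w * x * 1 * y * star w := by noncomm_ring
    _ = _ := by rw [← h]; noncomm_ring

lemma norm_conj_le {w : H →L[ℂ] H} (hw : w ∈ unitary (H →L[ℂ] H)) (x : H →L[ℂ] H) :
    ‖w * x * star w‖ ≤ ‖x‖ := by
  rw [CStarRing.norm_mul_mem_unitary _ (Unitary.star_mem hw), CStarRing.norm_mem_unitary_mul _ hw]

/-- The operators on which a sequence of inner automorphisms converges. -/
def limAlg (w : ℕ → H →L[ℂ] H) (hw : ∀ n, w n ∈ unitary (H →L[ℂ] H)) :
    StarSubalgebra ℂ (H →L[ℂ] H) where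
  carrier := {x | ∃ y, Tendsto (fun n => w n * x * star (w n)) atTop (𝓝 y)}
  mul_mem' := by
    rintro x x' ⟨y, hy⟩ ⟨y', hy'⟩
    exact ⟨y * y', by simpa only [conj_mul_conj (hw _)] using hy.mul hy'⟩
  add_mem' := by
    rintro x x' ⟨y, hy⟩ ⟨y', hy'⟩
    exact ⟨y + y', by simpa only [mul_add, add_mul] using hy.add hy'⟩
  algebraMap_mem' c := by
    refine ⟨algebraMap ℂ _ c, ?_⟩
    have : ∀ n, w n * algebraMap ℂ (H →L[ℂ] H) c * star (w n) = algebraMap ℂ _ c := by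
      intro n
      rw [← Algebra.commutes, mul_assoc, (hw n).2, mul_one]
    simp only [this]
    exact tendsto_const_nhds
  star_mem' := by
    rintro x ⟨y, hy⟩
    exact ⟨star y, by simpa only [star_mul, star_star, mul_assoc] using hy.star⟩

variable {w : ℕ → H →L[ℂ] H} {hw : ∀ n, w n ∈ unitary (H →L[ℂ] H)}

lemma mem_limAlg {x : H →L[ℂ] H} :
    x ∈ limAlg w hw ↔ ∃ y, Tendsto (fun n => w n * x * star (w n)) atTop (𝓝 y) := Iff.rfl

/-- Conjugations by unitaries are contractions, so convergence passes to norm limits. It then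
suffices to check convergence on local algebras. -/
lemma isClosed_limAlg : IsClosed (limAlg w hw : Set (H →L[ℂ] H)) := by
  refine isClosed_of_closure_subset fun x hx => ?_
  refine mem_limAlg.2 (cauchySeq_tendsto_of_complete (Metric.cauchySeq_iff'.2 fun ε hε => ?_))
  obtain ⟨x', ⟨y, hy⟩, hxx'⟩ := Metric.mem_closure_iff.1 hx (ε / 4) (by positivity)
  obtain ⟨N, hN⟩ := Metric.cauchySeq_iff'.1 hy.cauchySeq (ε / 4) (by positivity)
  have hd : ∀ n, dist (w n * x * star (w n)) (w n * x' * star (w n)) < ε / 4 := by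
    intro n
    rw [dist_eq_norm, ← sub_mul, ← mul_sub]
    exact (norm_conj_le (hw n) _).trans_lt (by rwa [← dist_eq_norm])
  refine ⟨N, fun n hn => ?_⟩
  calc dist (w n * x * star (w n)) (w N * x * star (w N))
      ≤ dist (w n * x * star (w n)) (w n * x' * star (w n)) +
        dist (w n * x' * star (w n)) (w N * x' * star (w N)) +
        dist (w N * x' * star (w N)) (w N * x * star (w N)) := dist_triangle4 _ _ _ _
    _ < ε := by linarith [hd n, hN n hn, dist_comm (w N * x' * star (w N)) (w N * x * star (w N)) ▸ hd N]

/-- The limit of a sequence of inner automorphisms. -/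
def limHom (w : ℕ → H →L[ℂ] H) (hw : ∀ n, w n ∈ unitary (H →L[ℂ] H)) :
    limAlg w hw →⋆ₐ[ℂ] (H →L[ℂ] H) :=
  have key : ∀ {x : limAlg w hw} {y}, Tendsto (fun n => w n * (x : H →L[ℂ] H) * star (w n)) atTop
      (𝓝 y) → (mem_limAlg.1 x.2).choose = y := fun {x} _ hy =>
    tendsto_nhds_unique (mem_limAlg.1 x.2).choose_spec hy
  { toFun := fun x => (mem_limAlg.1 x.2).choose
    map_one' := key (by simp [fun n => (hw n).2])
    map_zero' := key (by simp)
    map_mul' := fun x x' => key (by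
      simpa only [MulMemClass.coe_mul, conj_mul_conj (hw _)] using
        (mem_limAlg.1 x.2).choose_spec.mul (mem_limAlg.1 x'.2).choose_spec)
    map_add' := fun x x' => key (by
      simpa only [AddMemClass.coe_add, mul_add, add_mul] using
        (mem_limAlg.1 x.2).choose_spec.add (mem_limAlg.1 x'.2).choose_spec)
    commutes' := fun c => key (by
      have : ∀ n, w n * algebraMap ℂ (H →L[ℂ] H) c * star (w n) = algebraMap ℂ _ c := by
        intro n
        rw [← Algebra.commutes, mul_assoc, (hw n).2, mul_one]
      change Tendsto (fun n => w n * algebraMap ℂ (H →L[ℂ] H) c * star (w n)) atTop _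
      simp only [this]
      exact tendsto_const_nhds)
    map_star' := fun x => key (by
      simpa only [StarMemClass.coe_star, star_mul, star_star, mul_assoc] using
        (mem_limAlg.1 x.2).choose_spec.star) }

lemma tendsto_limHom (x : limAlg w hw) :
    Tendsto (fun n => w n * (x : H →L[ℂ] H) * star (w n)) atTop (𝓝 (limHom w hw x)) :=
  (mem_limAlg.1 x.2).choose_spec

lemma limHom_eq {x : limAlg w hw} {y : H →L[ℂ] H} {N : ℕ}
    (h : ∀ n ≥ N, w n * (x : H →L[ℂ] H) * star (w n) = y) : limHom w hw x = y :=
  tendsto_nhds_unique (tendsto_limHom x)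
    (tendsto_const_nhds.congr' (eventually_atTop.2 ⟨N, fun n hn => (h n hn).symm⟩))

lemma mem_limAlg_of_eq {x y : H →L[ℂ] H} {N : ℕ} (h : ∀ n ≥ N, w n * x * star (w n) = y) :
    x ∈ limAlg w hw :=
  ⟨y, tendsto_const_nhds.congr' (eventually_atTop.2 ⟨N, fun n hn => (h n hn).symm⟩)⟩

/-- A unitary conjugation, as a homomorphism. -/
lemma exists_conjHom (S : StarSubalgebra ℂ (H →L[ℂ] H)) {u : H →L[ℂ] H}
    (hu : u ∈ unitary (H →L[ℂ] H)) :
    ∃ σ : S →⋆ₐ[ℂ] (H →L[ℂ] H), ∀ a, σ a = u * a * star u := by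
  have h : ∀ x, x ∈ limAlg (fun _ => u) (fun _ => hu) := fun x => ⟨_, tendsto_const_nhds⟩
  exact ⟨(limHom (fun _ => u) (fun _ => hu)).comp (StarSubalgebra.inclusion fun x _ => h x),
    fun a => limHom_eq (N := 0) fun _ _ => rfl⟩

/-- Conjugation by a unitary commutes with weak closures. -/
lemma mem_weakClosure_conj {S R : StarSubalgebra ℂ (H →L[ℂ] H)} {u : H →L[ℂ] H}
    (hu : u ∈ unitary (H →L[ℂ] H)) (h : ∀ s ∈ S, u * s * star u ∈ R) {x : H →L[ℂ] H}
    (hx : x ∈ weakClosure S) : u * x * star u ∈ weakClosure R := by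
  have h1 : star u * u = 1 := hu.1
  have h2 : u * star u = 1 := hu.2
  refine mem_weakClosure_iff.2 fun y hy => ?_
  have := mem_weakClosure_iff.1 hx (star u * y * u) fun s hs => by
    have := hy _ (h s hs)
    calc s * (star u * y * u) = (star u * u) * s * star u * y * u := by rw [h1]; noncomm_ring
      _ = star u * (u * s * star u * y) * u := by noncomm_ring
      _ = star u * y * u * s * (star u * u) := by rw [this]; noncomm_ring
      _ = _ := by rw [h1]; noncomm_ring
  calc y * (u * x * star u) = (u * star u) * y * u * x * star u := by rw [h2]; noncomm_ring
    _ = u * (star u * y * u * x) * star u := by noncomm_ring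
    _ = u * x * star u * y * (u * star u) := by rw [this]; noncomm_ring
    _ = _ := by rw [h2]; noncomm_ring

end Limits

/-! ### The algebras of regions -/

namespace Net

variable (N : Net H)

lemma isClosed_global : IsClosed (N.global : Set (H →L[ℂ] H)) :=
  StarSubalgebra.isClosed_topologicalClosure _

lemma alg_le_global (O : DoubleCone) : N.alg O ≤ N.global :=
  (le_iSup N.alg O).trans (StarSubalgebra.le_topologicalClosure _)

lemma alg_le_region {O : DoubleCone} {X : Set Spacetime} (h : O.1 ⊆ X) : N.alg O ≤ N.region X :=
  (le_iSup (fun O : {O : DoubleCone // O.1 ⊆ X} => N.alg O.1) ⟨O, h⟩).trans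
    (StarSubalgebra.le_topologicalClosure _)

lemma global_le {S : StarSubalgebra ℂ (H →L[ℂ] H)} (hS : IsClosed (S : Set (H →L[ℂ] H)))
    (h : ∀ O, N.alg O ≤ S) : N.global ≤ S :=
  StarSubalgebra.topologicalClosure_minimal (iSup_le h) hS

lemma region_le {X : Set Spacetime} {S : StarSubalgebra ℂ (H →L[ℂ] H)}
    (hS : IsClosed (S : Set (H →L[ℂ] H))) (h : ∀ O : DoubleCone, O.1 ⊆ X → N.alg O ≤ S) :
    N.region X ≤ S :=
  StarSubalgebra.topologicalClosure_minimal (iSup_le fun O => h O.1 O.2) hS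

variable {τ : ℝ}

lemma region_le_compl {C C₁ : Hypercone τ} (h : C₁.1 ⊆ spacelikeCompl C.1) :
    N.region C₁.1 ≤ N.compl C :=
  (le_iSup (fun C₁ : {C₁ : Hypercone τ // C₁.1 ⊆ spacelikeCompl C.1} => N.region C₁.1.1)
    ⟨C₁, h⟩).trans (StarSubalgebra.le_topologicalClosure _)

lemma compl_le_of_region {C : Hypercone τ} {S : StarSubalgebra ℂ (H →L[ℂ] H)}
    (hS : IsClosed (S : Set (H →L[ℂ] H)))
    (h : ∀ C₁ : Hypercone τ, C₁.1 ⊆ spacelikeCompl C.1 → N.region C₁.1 ≤ S) : N.compl C ≤ S :=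
  StarSubalgebra.topologicalClosure_minimal (iSup_le fun C₁ => h C₁.1 C₁.2) hS

lemma compl_le {C : Hypercone τ} {S : StarSubalgebra ℂ (H →L[ℂ] H)}
    (hS : IsClosed (S : Set (H →L[ℂ] H)))
    (h : ∀ O : DoubleCone, O.1 ⊆ spacelikeCompl C.1 → N.alg O ≤ S) : N.compl C ≤ S :=
  N.compl_le_of_region hS fun _ hC₁ => N.region_le hS fun O hO => h O (hO.trans hC₁)

lemma region_le_global (X : Set Spacetime) : N.region X ≤ N.global :=
  N.region_le N.isClosed_global fun O _ => N.alg_le_global O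

lemma compl_le_global (C : Hypercone τ) : N.compl C ≤ N.global :=
  N.compl_le N.isClosed_global fun O _ => N.alg_le_global O

lemma isClosed_compl (C : Hypercone τ) : IsClosed (N.compl C : Set (H →L[ℂ] H)) :=
  StarSubalgebra.isClosed_topologicalClosure _

lemma compl_anti {C D : Hypercone τ} (h : D.1 ⊆ C.1) : N.compl C ≤ N.compl D :=
  N.compl_le_of_region (N.isClosed_compl D) fun _ hC₁ =>
    N.region_le_compl (hC₁.trans (spacelikeCompl_anti h))

lemma commute_region {O : DoubleCone} {D : Hypercone τ} (h : O.1 ⊆ spacelikeCompl D.1)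
    {a : H →L[ℂ] H} (ha : a ∈ N.alg O) : ∀ x ∈ N.region D.1, x * a = a * x :=
  le_centralizer_iff.1 (N.region_le (isClosed_centralizer _) fun O' hO' =>
    le_centralizer_iff.2 fun x hx =>
      (N.locality O O' (h.trans (spacelikeCompl_anti hO')) a ha x hx).symm)

end Net

namespace Theory

variable {τ : ℝ} {T : Theory τ H}

lemma mem_weakClosure_region_iff {C : Hypercone τ} {x : H →L[ℂ] H} :
    x ∈ weakClosure (T.region C.1) ↔ (∀ a ∈ T.compl C, a * x = x * a) ∧ x ∈ T.globalVN := by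
  rw [← SetLike.mem_coe, ← T.duality C]; rfl

lemma mem_weakClosure_compl_iff {C : Hypercone τ} {x : H →L[ℂ] H} :
    x ∈ weakClosure (T.compl C) ↔ (∀ a ∈ T.region C.1, a * x = x * a) ∧ x ∈ T.globalVN := by
  rw [← SetLike.mem_coe, ← T.duality' C]; rfl

lemma mem_globalVN_of_mem {x : H →L[ℂ] H} (hx : x ∈ T.global) : x ∈ T.globalVN :=
  mem_weakClosure_of_mem hx

lemma isClosed_globalVN : IsClosed (T.globalVN.toStarSubalgebra : Set (H →L[ℂ] H)) :=
  isClosed_weakClosure _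

/-- Morphisms are norm continuous, so their equalizer is a closed algebra, which contains the
generators. The next three lemmas rest on the same principle. -/
lemma mor_ext {σ σ' : T.Mor}
    (h : ∀ O, ∀ a : T.global, (a : H →L[ℂ] H) ∈ T.alg O → σ a = σ' a) : σ = σ' := by
  ext1 a
  have := T.global_le (isClosed_eqAlg T.isClosed_global σ σ') (fun O a ha =>
    mem_eqAlg.2 ⟨T.alg_le_global O ha, h O ⟨a, _⟩ ha⟩) a.2
  exact (mem_eqAlg.1 this).choose_spec

lemma mor_eq_on_compl {σ σ' : T.Mor} {C : Hypercone τ}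
    (h : ∀ O : DoubleCone, O.1 ⊆ spacelikeCompl C.1 →
      ∀ a : T.global, (a : H →L[ℂ] H) ∈ T.alg O → σ a = σ' a)
    (a : T.global) (ha : (a : H →L[ℂ] H) ∈ T.compl C) : σ a = σ' a := by
  have := T.compl_le (isClosed_eqAlg T.isClosed_global σ σ') (fun O hO a ha =>
    mem_eqAlg.2 ⟨T.alg_le_global O ha, h O hO ⟨a, _⟩ ha⟩) ha
  exact (mem_eqAlg.1 this).choose_spec

lemma mor_eq_on_region {σ σ' : T.Mor} {X : Set Spacetime}
    (h : ∀ O : DoubleCone, O.1 ⊆ X →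
      ∀ a : T.global, (a : H →L[ℂ] H) ∈ T.alg O → σ a = σ' a)
    (a : T.global) (ha : (a : H →L[ℂ] H) ∈ T.region X) : σ a = σ' a := by
  have := T.region_le (isClosed_eqAlg T.isClosed_global σ σ') (fun O hO a ha =>
    mem_eqAlg.2 ⟨T.alg_le_global O ha, h O hO ⟨a, _⟩ ha⟩) ha
  exact (mem_eqAlg.1 this).choose_spec

lemma mor_mem {σ : T.Mor} {S : StarSubalgebra ℂ (H →L[ℂ] H)}
    (hS : IsClosed (S : Set (H →L[ℂ] H)))
    (h : ∀ O, ∀ a : T.global, (a : H →L[ℂ] H) ∈ T.alg O → σ a ∈ S) (a : T.global) : σ a ∈ S := by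
  have := T.global_le (isClosed_preAlg T.isClosed_global σ hS) (fun O a ha =>
    mem_preAlg.2 ⟨T.alg_le_global O ha, h O ⟨a, _⟩ ha⟩) a.2
  exact (mem_preAlg.1 this).choose_spec

/-! ### Localized morphisms and their intertwiners -/

/-- Morphisms which are localized in a hypercone. -/
structure IsLocalized (T : Theory τ H) (σ : T.Mor) (C : Hypercone τ) : Prop where
  range_mem : ∀ a, σ a ∈ T.globalVN
  trivial_compl : T.TrivialOnCompl σ C
  weakClosure_image : ∀ C₁ : Hypercone τ, C.1 ⊆ C₁.1 →
    weakClosure (T.image σ C₁) = weakClosure (T.region C₁.1)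

lemma IsSimpleFamily.isLocalized {Q : Set (T.global →ₗ[ℂ] ℂ)} {σ : Hypercone τ → T.Mor}
    (h : T.IsSimpleFamily Q σ) (C : Hypercone τ) : T.IsLocalized (σ C) C :=
  ⟨h.range_mem C, h.trivial_compl C, h.weakClosure_image C⟩

lemma isLocalized_of_mem_Sigma {C : Hypercone τ} {σ : T.Mor} (h : σ ∈ T.Sigma C) :
    T.IsLocalized σ C := by
  obtain ⟨Q, σ, hσ, rfl⟩ := h
  exact hσ.isLocalized C

lemma mem_image {σ : T.Mor} {C : Hypercone τ} {x : H →L[ℂ] H} :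
    x ∈ T.image σ C ↔ ∃ a : T.global, (a : H →L[ℂ] H) ∈ T.region C.1 ∧ σ a = x := by
  rw [image, StarSubalgebra.mem_map]; rfl

lemma IsUnitaryVN.inv {W : H →L[ℂ] H} (h : T.IsUnitaryVN W) : T.IsUnitaryVN (star W) :=
  ⟨Unitary.star_mem h.1, star_mem h.2⟩

lemma IsUnitaryVN.mul {W W' : H →L[ℂ] H} (h : T.IsUnitaryVN W) (h' : T.IsUnitaryVN W') :
    T.IsUnitaryVN (W * W') :=
  ⟨mul_mem h.1 h'.1, mul_mem h.2 h'.2⟩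

lemma IsUnitaryVN.star_mul_self {W : H →L[ℂ] H} (h : T.IsUnitaryVN W) : star W * W = 1 := h.1.1

lemma IsUnitaryVN.mul_star_self {W : H →L[ℂ] H} (h : T.IsUnitaryVN W) : W * star W = 1 := h.1.2

lemma Intertwines.mul_eq {W : H →L[ℂ] H} {σ₁ σ₂ : T.Mor} (h : T.Intertwines W σ₁ σ₂)
    (a : T.global) : W * σ₁ a = σ₂ a * W := by
  rw [← h.2 a, mul_assoc, h.1.star_mul_self, mul_one]

lemma Intertwines.eq_conj {W : H →L[ℂ] H} {σ₁ σ₂ : T.Mor} (h : T.Intertwines W σ₁ σ₂)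
    (a : T.global) : σ₁ a = star W * σ₂ a * W := by
  rw [mul_assoc, ← h.mul_eq, ← mul_assoc, h.1.star_mul_self, one_mul]

lemma Intertwines.symm {W : H →L[ℂ] H} {σ₁ σ₂ : T.Mor} (h : T.Intertwines W σ₁ σ₂) :
    T.Intertwines (star W) σ₂ σ₁ :=
  ⟨h.1.inv, fun a => by rw [star_star, ← h.eq_conj]⟩

lemma Intertwines.trans {W W' : H →L[ℂ] H} {σ₁ σ₂ σ₃ : T.Mor} (h : T.Intertwines W σ₁ σ₂)
    (h' : T.Intertwines W' σ₂ σ₃) : T.Intertwines (W' * W) σ₁ σ₃ :=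
  ⟨h'.1.mul h.1, fun a => by
    rw [star_mul, ← h'.2, ← h.2]; simp only [mul_assoc]⟩

lemma IsSimpleFamily.exists_intertwines {Q : Set (T.global →ₗ[ℂ] ℂ)} {σ : Hypercone τ → T.Mor}
    (h : T.IsSimpleFamily Q σ) (D C : Hypercone τ) : ∃ W, T.Intertwines W (σ D) (σ C) := by
  obtain ⟨U₁, U₂, h₁, h₂, h₁₂⟩ := h.equivalent D C
  refine ⟨star U₂ * U₁, h₂.inv.mul h₁, fun a => ?_⟩
  calc star U₂ * U₁ * σ D a * star (star U₂ * U₁)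
      = star U₂ * (U₁ * σ D a * star U₁) * U₂ := by
        rw [star_mul, star_star]; simp only [mul_assoc]
    _ = (star U₂ * U₂) * σ C a * (star U₂ * U₂) := by rw [h₁₂]; simp only [mul_assoc]
    _ = σ C a := by rw [h₂.star_mul_self, one_mul, mul_one]

/-- Intertwiners between morphisms acting trivially on the spacelike complement of `D` belong to
the von Neumann algebra of `D`. -/
lemma Intertwines.mem_region {V : H →L[ℂ] H} {κ κ' : T.Mor} {D : Hypercone τ}
    (h : T.Intertwines V κ κ') (hκ : T.TrivialOnCompl κ D) (hκ' : T.TrivialOnCompl κ' D) :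
    V ∈ weakClosure (T.region D.1) := by
  refine mem_weakClosure_region_iff.2 ⟨fun a ha => ?_, h.1.2⟩
  have := h.mul_eq ⟨a, T.compl_le_global D ha⟩
  rw [hκ _ ha, hκ' _ ha] at this
  exact this.symm

lemma TrivialOnCompl.mono {σ : T.Mor} {C D : Hypercone τ} (h : T.TrivialOnCompl σ D)
    (hDC : D.1 ⊆ C.1) : T.TrivialOnCompl σ C :=
  fun a ha => h a (T.compl_anti hDC ha)

/-- Transported operators commute with the localization region of the transported morphism. -/
lemma Intertwines.commute_region {W y : H →L[ℂ] H} {κ σ : T.Mor} {C D : Hypercone τ}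
    (h : T.Intertwines W κ σ) (hσ : T.TrivialOnCompl σ C) (hκ : T.IsLocalized κ D)
    (hDC : D.1 ⊆ spacelikeCompl C.1) (hy : ∀ x ∈ T.region D.1, x * y = y * x) {x : H →L[ℂ] H}
    (hx : x ∈ weakClosure (T.region D.1)) : x * (star W * y * W) = star W * y * W * x := by
  -- It suffices to test on `κ b` with `b` in the algebra of `D`. There `κ b = W* b W`, since `σ` is
  -- trivial on `b`, and `b` commutes with `y`.
  rw [← hκ.weakClosure_image D subset_rfl] at hx
  refine commute_weakClosure (fun s hs => ?_) hx
  obtain ⟨b, hb, rfl⟩ := mem_image.1 hs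
  have hσb := hσ b (T.region_le_compl hDC hb)
  calc κ b * (star W * y * W) = star W * σ b * (W * star W) * y * W := by
        rw [h.eq_conj]; noncomm_ring
    _ = star W * (y * σ b) * W := by
        rw [h.1.mul_star_self, hσb, ← hy _ hb]; noncomm_ring
    _ = star W * y * (W * star W) * σ b * W := by rw [h.1.mul_star_self]; noncomm_ring
    _ = _ := by rw [h.eq_conj]; noncomm_ring

/-- The transported operators do not depend on the intertwiner. -/
lemma Intertwines.transport_eq {W W' y : H →L[ℂ] H} {κ κ' σ : T.Mor} {C D D' : Hypercone τ}
    (h : T.Intertwines W κ σ) (h' : T.Intertwines W' κ' σ) (hσ : T.TrivialOnCompl σ C)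
    (hκ : T.IsLocalized κ D) (hκ' : T.TrivialOnCompl κ' D') (hD : D'.1 ⊆ D.1)
    (hDC : D.1 ⊆ spacelikeCompl C.1) (hy : ∀ x ∈ T.region D.1, x * y = y * x) :
    star W' * y * W' = star W * y * W := by
  -- The unitary `W'* W` relating the two transports belongs to the von Neumann algebra of `D`,
  -- hence commutes with `W* y W`.
  have hV := h.trans h'.symm
  have hcomm := h.commute_region hσ hκ hDC hy
    (hV.mem_region hκ.trivial_compl (hκ'.mono hD))
  calc star W' * y * W' = star W' * (W * star W) * y * W * (star W * W') := by
        rw [h.1.mul_star_self, mul_assoc _ W, ← mul_assoc W, h.1.mul_star_self]; noncomm_ring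
    _ = (star W' * W * (star W * y * W)) * (star W * W') := by noncomm_ring
    _ = star W * y * W * (star W' * (W * star W) * W') := by rw [hcomm]; noncomm_ring
    _ = star W * y * W := by rw [h.1.mul_star_self, mul_one, h'.1.star_mul_self, mul_one]

section Family

variable {Q : Set (T.global →ₗ[ℂ] ℂ)} {σ : Hypercone τ → T.Mor}

/-- Members of simple families act trivially on the double cones in the spacelike complement. -/
lemma IsSimpleFamily.apply_of_subset_compl (h : T.IsSimpleFamily Q σ) {D : Hypercone τ}
    {O : DoubleCone} (hO : O.1 ⊆ spacelikeCompl D.1) {a : T.global}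
    (ha : (a : H →L[ℂ] H) ∈ T.alg O) : σ D a = a := by
  -- `T.compl D` is generated by hypercones, so it need not visibly contain the algebra of `O`. For
  -- a smaller `D'` a hypercone containing `O` is spacelike to `D'`, and the intertwiner back to `σ
  -- D` commutes with `a`.
  obtain ⟨D', B, hD', hOB, hDB⟩ := exists_separated T.tau_pos D O
  obtain ⟨V, hV⟩ := h.exists_intertwines D' D
  have h1 : σ D' a = a := h.trivial_compl D' a
    (T.region_le_compl (Hypercone.subset_compl_symm hDB) (T.alg_le_region hOB ha))
  have h2 := commute_weakClosure (T.commute_region hO ha)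
    (hV.mem_region ((h.trivial_compl D').mono hD') (h.trivial_compl D))
  rw [← hV.2, h1, h2, mul_assoc, hV.1.mul_star_self, mul_one]

/-- The local operators transported to spacelike infinity do not depend on the chosen direction. -/
lemma IsSimpleFamily.transport_eq (h : T.IsSimpleFamily Q σ) {C : Hypercone τ} {O : DoubleCone}
    {a : H →L[ℂ] H} (ha : a ∈ T.alg O) {D D' : Hypercone τ} (hD : D.1 ⊆ spacelikeCompl C.1)
    (hOD : O.1 ⊆ spacelikeCompl D.1) (hD' : D'.1 ⊆ spacelikeCompl C.1)
    (hOD' : O.1 ⊆ spacelikeCompl D'.1) {κ κ' : T.Mor} (hκ : T.IsLocalized κ D)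
    (hκ' : T.IsLocalized κ' D') {W W' : H →L[ℂ] H} (hW : T.Intertwines W κ (σ C))
    (hW' : T.Intertwines W' κ' (σ C)) : star W * a * W = star W' * a * W' := by
  choose V hV using fun D => h.exists_intertwines D C
  have htriv := h.trivial_compl C
  -- Inside the family the transport is unchanged under inclusions of directions, hence the same in
  -- all admissible directions. Arbitrary `κ`, `κ'` are then compared with the family member in the
  -- same direction.
  have hloc := eq_of_locally_constant T.tau_pos C O (fun D => star (V D) * a * V D)
    (fun D₁ D₂ h₁₂ h₂ hO₂ => (hV D₂).transport_eq (hV D₁) htriv (h.isLocalized D₂)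
      (h.trivial_compl D₁) h₁₂ h₂ (T.commute_region hO₂ ha)) hD hOD hD' hOD'
  rw [← hW.transport_eq (hV D) htriv hκ (h.trivial_compl D) subset_rfl hD
    (T.commute_region hOD ha), hloc, hW'.transport_eq (hV D') htriv hκ' (h.trivial_compl D')
    subset_rfl hD' (T.commute_region hOD' ha)]

/-- The morphism obtained by transporting `σ` to spacelike infinity. -/
def IsConj (T : Theory τ H) (C : Hypercone τ) (σ σ' : T.Mor) : Prop :=
  ∀ (O : DoubleCone) (a : T.global), (a : H →L[ℂ] H) ∈ T.alg O → ∀ D : Hypercone τ,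
    D.1 ⊆ spacelikeCompl C.1 → O.1 ⊆ spacelikeCompl D.1 → ∀ κ, T.IsLocalized κ D →
    ∀ W, T.Intertwines W κ σ → σ' a = star W * a * W

lemma IsSimpleFamily.exists_isConj (h : T.IsSimpleFamily Q σ) (C : Hypercone τ) :
    ∃ σ' : T.Mor, T.IsConj C (σ C) σ' := by
  obtain ⟨B, D, hB, hCB, hD, hDB⟩ := exists_exhaustion_funnel T.tau_pos C
  choose W hW using fun n => h.exists_intertwines (D n) C
  have hDC : ∀ n, (D n).1 ⊆ spacelikeCompl C.1 :=
    fun n => (hDB n).trans (spacelikeCompl_anti (hCB n))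
  have hw : ∀ n, star (W n) ∈ unitary (H →L[ℂ] H) := fun n => (hW n).1.inv.1
  have key : ∀ (O : DoubleCone) (a : T.global), (a : H →L[ℂ] H) ∈ T.alg O → ∃ N,
      ∀ E : Hypercone τ, E.1 ⊆ spacelikeCompl C.1 → O.1 ⊆ spacelikeCompl E.1 →
      ∀ κ, T.IsLocalized κ E → ∀ V, T.Intertwines V κ (σ C) →
      ∀ n ≥ N, star (W n) * (a : H →L[ℂ] H) * star (star (W n)) = star V * a * V := by
    intro O a ha
    -- From `N` on, `O` is spacelike to `D n`, and the transported operator equals the one in any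
    -- other admissible direction.
    obtain ⟨N, hN⟩ := hD.eventually_subset O
    exact ⟨N, fun E hE hOE κ hκ V hV n hn => by
      rw [star_star]
      exact h.transport_eq ha (hDC n) (hN n hn) hE hOE (h.isLocalized _) hκ (hW n) hV⟩
  have hle : T.global ≤ limAlg (fun n => star (W n)) hw :=
    T.global_le isClosed_limAlg fun O a ha => by
      obtain ⟨N, hN⟩ := key O ⟨a, T.alg_le_global O ha⟩ ha
      obtain ⟨M, hM⟩ := hD.eventually_subset O
      exact mem_limAlg_of_eq (N := N)
        (hN (D M) (hDC M) (hM M le_rfl) _ (h.isLocalized _) _ (hW M))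
  refine ⟨(limHom _ hw).comp (StarSubalgebra.inclusion hle), fun O a ha E hE hOE κ hκ V hV => ?_⟩
  obtain ⟨N, hN⟩ := key O a ha
  exact limHom_eq (N := N) (hN E hE hOE κ hκ V hV)

end Family

end Theory

/-! ### Conjugate families -/

lemma exists_direction {τ : ℝ} (hτ : 0 < τ) (C : Hypercone τ) (O : DoubleCone) :
    ∃ D : Hypercone τ, D.1 ⊆ spacelikeCompl C.1 ∧ O.1 ⊆ spacelikeCompl D.1 := by
  obtain ⟨B, D, -, hCB, hD, hDB⟩ := exists_exhaustion_funnel hτ C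
  obtain ⟨n, hn⟩ := hD.eventually_subset O
  exact ⟨D n, (hDB n).trans (spacelikeCompl_anti (hCB n)), hn n le_rfl⟩

lemma norm_inner_apply_sub_le (b : H →L[ℂ] H) {x y : H} (hx : ‖x‖ = 1) (hy : ‖y‖ = 1) :
    ‖⟪x, b x⟫_ℂ - ⟪y, b y⟫_ℂ‖ ≤ 2 * ‖x - y‖ * ‖b‖ := by
  have h : ⟪x, b x⟫_ℂ - ⟪y, b y⟫_ℂ = ⟪x - y, b x⟫_ℂ + ⟪y, b (x - y)⟫_ℂ := by
    rw [inner_sub_left, map_sub, inner_sub_right]; ring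
  have h1 : ‖⟪x - y, b x⟫_ℂ‖ ≤ ‖x - y‖ * (‖b‖ * 1) :=
    (norm_inner_le_norm _ _).trans (by gcongr; simpa [hx] using b.le_opNorm x)
  have h2 : ‖⟪y, b (x - y)⟫_ℂ‖ ≤ 1 * (‖b‖ * ‖x - y‖) :=
    (norm_inner_le_norm _ _).trans (by rw [hy]; gcongr; exact b.le_opNorm _)
  rw [h]
  linarith [norm_add_le ⟪x - y, b x⟫_ℂ ⟪y, b (x - y)⟫_ℂ]

lemma apply_mem_closure {S : StarSubalgebra ℂ (H →L[ℂ] H)} {x : H →L[ℂ] H}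
    (hx : x ∈ weakClosure S) (ξ : H) :
    x ξ ∈ closure ((fun a : H →L[ℂ] H => a ξ) '' (S : Set (H →L[ℂ] H))) := by
  have hc : Continuous fun θ : SqSummable H => θ 0 := by
    have := (component H 0).adjoint.continuous
    exact this.congr fun θ => adjoint_component 0 θ
  refine map_mem_closure (f := fun θ : SqSummable H => θ 0) hc (amplify_mem_closure hx (consSq ξ 0)) ?_
  rintro _ ⟨a, ha, rfl⟩
  exact ⟨a, ha, rfl⟩

namespace Theory

variable {τ : ℝ} {T : Theory τ H} {Q : Set (T.global →ₗ[ℂ] ℂ)} {σ σ' : Hypercone τ → T.Mor}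

lemma IsSimpleFamily.apply_eq_conj (h : T.IsSimpleFamily Q σ) {C D : Hypercone τ} {O : DoubleCone}
    (hO : O.1 ⊆ spacelikeCompl D.1) {W : H →L[ℂ] H} (hW : T.Intertwines W (σ D) (σ C))
    {a : T.global} (ha : (a : H →L[ℂ] H) ∈ T.alg O) : σ C a = W * a * star W := by
  rw [← hW.2, h.apply_of_subset_compl hO ha]

lemma IsConj.range_mem {C : Hypercone τ} {ρ : T.Mor} (h : T.IsSimpleFamily Q σ)
    (hc : T.IsConj C (σ C) ρ) (a : T.global) : ρ a ∈ T.globalVN :=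
  mor_mem isClosed_globalVN (fun O a ha => by
    obtain ⟨D, hD, hO⟩ := exists_direction T.tau_pos C O
    obtain ⟨W, hW⟩ := h.exists_intertwines D C
    rw [hc O a ha D hD hO _ (h.isLocalized D) W hW]
    exact mul_mem (mul_mem (star_mem hW.1.2) (mem_globalVN_of_mem a.2)) hW.1.2) a

/-- For `O` spacelike to both `C` and `D`, both `σ D` and `σ C` are trivial on the algebra of `O`.
The intertwiner then commutes with it. -/
lemma IsConj.trivialOnCompl {C : Hypercone τ} {ρ : T.Mor} (h : T.IsSimpleFamily Q σ)
    (hc : T.IsConj C (σ C) ρ) : T.TrivialOnCompl ρ C := by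
  refine mor_eq_on_compl (σ' := T.idMor) fun O hOC a ha => ?_
  obtain ⟨D, hD, hO⟩ := exists_direction T.tau_pos C O
  obtain ⟨W, hW⟩ := h.exists_intertwines D C
  have h1 : (a : H →L[ℂ] H) = W * a * star W := by
    rw [← h.apply_eq_conj hO hW ha, h.apply_of_subset_compl hOC ha]
  have h2 := hW.eq_conj a
  rw [h.apply_of_subset_compl hO ha, h.apply_of_subset_compl hOC ha] at h2
  rw [hc O a ha D hD hO _ (h.isLocalized D) W hW, ← h2]
  rfl

/-- On the algebras of regions which are spacelike to `D`, the morphism and its conjugate are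
inverse inner automorphisms. -/
lemma IsConj.eq_on_region {C D : Hypercone τ} {ρ : T.Mor} (h : T.IsSimpleFamily Q σ)
    (hc : T.IsConj C (σ C) ρ) (hD : D.1 ⊆ spacelikeCompl C.1) {X : Set Spacetime}
    (hX : X ⊆ spacelikeCompl D.1) {W : H →L[ℂ] H} (hW : T.Intertwines W (σ D) (σ C))
    {a : T.global} (ha : (a : H →L[ℂ] H) ∈ T.region X) :
    σ C a = W * a * star W ∧ ρ a = star W * a * W := by
  obtain ⟨φ, hφ⟩ := exists_conjHom T.global hW.1.1
  obtain ⟨ψ, hψ⟩ := exists_conjHom T.global hW.1.inv.1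
  rw [← hφ]
  have h2 := hψ a
  rw [star_star] at h2
  rw [← h2]
  refine ⟨mor_eq_on_region (fun O hO a ha => ?_) a ha, mor_eq_on_region (fun O hO a ha => ?_) a ha⟩
  · rw [hφ, h.apply_eq_conj (hO.trans hX) hW ha]
  · rw [hψ, star_star, hc O a ha D hD (hO.trans hX) _ (h.isLocalized D) W hW]

/-- Choose `D` spacelike to the larger hypercone `C₁`. On its algebra `σ C` is `Ad W` and `ρ` is `Ad
W*`, so the localization property of `σ C` makes `Ad W` an automorphism of the von Neumann algebra
of `C₁`, and its inverse inherits the property. -/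
lemma IsConj.weakClosure_image {C C₁ : Hypercone τ} {ρ : T.Mor} (h : T.IsSimpleFamily Q σ)
    (hc : T.IsConj C (σ C) ρ) (hC : C.1 ⊆ C₁.1) :
    weakClosure (T.image ρ C₁) = weakClosure (T.region C₁.1) := by
  obtain ⟨D, hD⟩ := exists_subset_compl T.tau_pos C₁
  obtain ⟨W, hW⟩ := h.exists_intertwines D C
  have key : ∀ a : T.global, (a : H →L[ℂ] H) ∈ T.region C₁.1 →
      σ C a = W * a * star W ∧ ρ a = star W * a * W := fun a ha =>
    hc.eq_on_region h (hD.trans (spacelikeCompl_anti hC)) (Hypercone.subset_compl_symm hD) hW ha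
  have hu := hW.1.inv.1
  have hw := hW.1.star_mul_self
  have hw' := hW.1.mul_star_self
  have h1 : ∀ x ∈ weakClosure (T.region C₁.1), star W * x * W ∈ weakClosure (T.region C₁.1) := by
    intro x hx
    rw [← h.weakClosure_image C C₁ hC] at hx
    have := mem_weakClosure_conj hu (R := T.region C₁.1) (fun s hs => ?_) hx
    · rwa [star_star] at this
    · obtain ⟨b, hb, rfl⟩ := mem_image.1 hs
      rw [(key b hb).1, star_star]
      have : star W * (W * b * star W) * W = (star W * W) * b * (star W * W) := by noncomm_ring
      rwa [this, hw, one_mul, mul_one]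
  have h2 : ∀ x ∈ weakClosure (T.region C₁.1), star W * x * W ∈ weakClosure (T.image ρ C₁) := by
    intro x hx
    have := mem_weakClosure_conj hu (R := T.image ρ C₁) (fun s hs => ?_) hx
    · rwa [star_star] at this
    · have hs' := T.region_le_global _ hs
      rw [star_star]
      exact mem_image.2 ⟨⟨s, hs'⟩, hs, (key ⟨s, hs'⟩ hs).2⟩
  refine SetLike.ext fun x => ⟨fun hx => weakClosure_le (fun s hs => ?_) hx,
    fun hx => weakClosure_le (fun s hs => ?_) hx⟩
  · obtain ⟨b, hb, rfl⟩ := mem_image.1 hs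
    rw [(key b hb).2]
    exact h1 _ (mem_weakClosure_of_mem hb)
  · have hs' := T.region_le_global _ hs
    have h3 : W * s * star W ∈ weakClosure (T.region C₁.1) := by
      rw [← h.weakClosure_image C C₁ hC, ← (key ⟨s, hs'⟩ hs).1]
      exact mem_weakClosure_of_mem (mem_image.2 ⟨_, hs, rfl⟩)
    have h4 : star W * (W * s * star W) * W = (star W * W) * s * (star W * W) := by noncomm_ring
    have := h2 _ h3
    rwa [h4, hw, one_mul, mul_one] at this

lemma IsConj.isLocalized {C : Hypercone τ} {ρ : T.Mor} (h : T.IsSimpleFamily Q σ)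
    (hc : T.IsConj C (σ C) ρ) : T.IsLocalized ρ C :=
  ⟨hc.range_mem h, hc.trivialOnCompl h, fun _ => hc.weakClosure_image h⟩

/-- Conjugates of morphisms with a common spacelike complement are equivalent. -/
lemma exists_intertwines_of_common_compl (h : T.IsSimpleFamily Q σ)
    (hc : ∀ C, T.IsConj C (σ C) (σ' C)) {C₁ C₂ D : Hypercone τ}
    (h₁ : D.1 ⊆ spacelikeCompl C₁.1) (h₂ : D.1 ⊆ spacelikeCompl C₂.1) :
    ∃ Z, T.Intertwines Z (σ' C₁) (σ' C₂) := by
  obtain ⟨U, hU⟩ := h.exists_intertwines C₁ C₂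
  obtain ⟨W, hW⟩ := h.exists_intertwines D C₁
  -- Both morphisms are trivial on the algebra of `D`. Hence `U*` can be transported like a local
  -- operator, and `W* U* W` is unchanged when `D` shrinks.
  have hUD : ∀ x ∈ T.region D.1, x * star U = star U * x := by
    intro x hx
    have := hU.symm.mul_eq ⟨x, T.region_le_global _ hx⟩
    rw [h.trivial_compl C₁ _ (T.region_le_compl h₁ hx),
      h.trivial_compl C₂ _ (T.region_le_compl h₂ hx)] at this
    exact this.symm
  have hZ : T.IsUnitaryVN (star W * star U * W) := (hW.1.inv.mul hU.1.inv).mul hW.1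
  obtain ⟨z, hz⟩ : ∃ z, z = star W * star U * W := ⟨_, rfl⟩
  rw [← hz] at hZ
  refine ⟨z, hZ, fun a => ?_⟩
  let ψ : T.Mor := (limHom (fun _ => z) (fun _ => hZ.1)).comp
    ((σ' C₁).codRestrict (limAlg (fun _ => z) (fun _ => hZ.1)) fun a =>
      mem_limAlg_of_eq (N := 0) fun _ _ => rfl)
  have hψ : ∀ a, ψ a = z * σ' C₁ a * star z := fun a => limHom_eq (N := 0) fun _ _ => rfl
  rw [← hψ]
  refine DFunLike.congr_fun (mor_ext fun O a ha => ?_) a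
  obtain ⟨D', B, hD', hOB, hDB⟩ := exists_separated T.tau_pos D O
  have hOD : O.1 ⊆ spacelikeCompl D'.1 := hOB.trans (Hypercone.subset_compl_symm hDB)
  obtain ⟨W', hW'⟩ := h.exists_intertwines D' C₁
  -- The direction `D'` is adapted to `O`, while `z` is fixed. As `U W'` intertwines `σ D'` and `σ
  -- C₂`, both conjugates are computed on the algebra of `O` with `D'`.
  have hz' : z = star W' * star U * W' := hz.trans (hW.transport_eq hW' (h.trivial_compl C₁)
    (h.isLocalized D) (h.trivial_compl D') hD' h₁ hUD).symm
  have e := hW'.1.mul_star_self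
  rw [hψ, hc C₁ O a ha D' (hD'.trans h₁) hOD _ (h.isLocalized D') W' hW',
    hc C₂ O a ha D' (hD'.trans h₂) hOD _ (h.isLocalized D') (U * W') (hW'.trans hU), hz']
  simp only [star_mul, star_star]
  calc star W' * star U * W' * (star W' * a * W') * (star W' * (U * W'))
      = star W' * star U * (W' * star W') * a * (W' * star W') * U * W' := by noncomm_ring
    _ = _ := by rw [e]; noncomm_ring

lemma exists_intertwines_conj (h : T.IsSimpleFamily Q σ)
    (hc : ∀ C, T.IsConj C (σ C) (σ' C)) (C₁ C₂ : Hypercone τ) :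
    ∃ Z, T.Intertwines Z (σ' C₁) (σ' C₂) := by
  obtain ⟨E₁, E₂, D, hE₁, hE₂, hD₁, hD₂⟩ := exists_common_compl T.tau_pos C₁ C₂
  obtain ⟨D₁, hDC₁⟩ := exists_subset_compl T.tau_pos C₁
  obtain ⟨D₂, hDC₂⟩ := exists_subset_compl T.tau_pos C₂
  obtain ⟨Z₁, h1⟩ := exists_intertwines_of_common_compl h hc hDC₁
    (hDC₁.trans (spacelikeCompl_anti hE₁))
  obtain ⟨Z₂, h2⟩ := exists_intertwines_of_common_compl h hc hD₁ hD₂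
  obtain ⟨Z₃, h3⟩ := exists_intertwines_of_common_compl h hc
    (hDC₂.trans (spacelikeCompl_anti hE₂)) hDC₂
  exact ⟨_, (h1.trans h2).trans h3⟩

/-- The weak closure of the range contains the von Neumann algebras of an exhausting sequence of
hypercones above `C`, hence all local algebras. -/
lemma IsLocalized.weakClosure_range {ρ : T.Mor} {C : Hypercone τ} (h : T.IsLocalized ρ C) :
    weakClosure ρ.range = T.globalVN := by
  obtain ⟨B, -, hB, hCB, -⟩ := exists_exhaustion_funnel T.tau_pos C
  refine SetLike.ext fun x => ⟨fun hx => weakClosure_le ?_ hx, fun hx => weakClosure_le ?_ hx⟩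
  · rintro _ ⟨a, rfl⟩
    exact h.range_mem a
  · refine T.global_le (isClosed_weakClosure _) fun O a ha => ?_
    obtain ⟨n, hn⟩ := hB.eventually_subset O
    have h1 := mem_weakClosure_of_mem (T.alg_le_region (hn n le_rfl) ha)
    rw [← h.weakClosure_image _ (hCB n)] at h1
    refine weakClosure_mono (fun s hs => ?_) h1
    obtain ⟨b, -, rfl⟩ := mem_image.1 hs
    exact ⟨b, rfl⟩

/-- The GNS representation is `ρ` itself on `H`: its range is weakly dense in the global von Neumann
algebra, so `Ω` is cyclic and the type is that of the vacuum. -/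
lemma IsLocalized.isElemental {ρ : T.Mor} {C : Hypercone τ} (h : T.IsLocalized ρ C) :
    T.IsElemental (T.vacuumComp ρ) := by
  refine ⟨H, _, _, inferInstance, ρ, T.Ω, T.norm_Ω, ?_, fun a => rfl, ?_⟩
  · obtain ⟨O, -⟩ := exists_doubleCone_mem (y := Pi.single 0 1) (by simp [forwardCone, mink])
    refine Dense.of_closure ((T.cyclic O).mono ?_)
    rintro _ ⟨a, ha, rfl⟩
    have ha' : a ∈ weakClosure ρ.range := by
      rw [h.weakClosure_range]; exact mem_globalVN_of_mem (T.alg_le_global O ha)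
    refine closure_mono ?_ (apply_mem_closure ha' T.Ω)
    rintro _ ⟨_, ⟨b, rfl⟩, rfl⟩
    exact ⟨b, rfl⟩
  · rw [h.weakClosure_range]
    exact T.typeIIIOne

/-- Equivalent localized morphisms belong to the same charge class. -/
lemma IsLocalized.mem_chargeClass {ρ ρ' : T.Mor} {C : Hypercone τ} (h : T.IsLocalized ρ C)
    {Z : H →L[ℂ] H} (hZ : T.Intertwines Z ρ ρ') :
    T.vacuumComp ρ' ∈ T.chargeClass (T.vacuumComp ρ) := by
  intro ε hε
  have hcl : IsClosed (T.global : Set (H →L[ℂ] H)) := T.isClosed_global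
  have hmem : star Z ∈ weakClosure ρ.range := by rw [h.weakClosure_range]; exact hZ.1.inv.2
  -- The state of `ρ'` is the vector state of `Z* Ω` in the representation `ρ`. Norm approximation
  -- of this vector by `ρ u Ω` gives norm approximation of states, with a factor `2`.
  obtain ⟨u, hu, hlt⟩ := exists_unitary_approx ρ hmem hZ.1.inv.1 T.Ω (half_pos hε)
  refine ⟨star u, Unitary.star_mem hu, fun a => ?_⟩
  have hn : ∀ {v : H →L[ℂ] H}, v ∈ unitary (H →L[ℂ] H) → ‖v T.Ω‖ = 1 := fun {v} hv => by
    rw [ContinuousLinearMap.norm_map_of_mem_unitary hv, T.norm_Ω]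
  have h1 : T.vacuumComp ρ' a = ⟪star Z T.Ω, ρ a (star Z T.Ω)⟫_ℂ := by
    change ⟪T.Ω, ρ' a T.Ω⟫_ℂ = _
    rw [← hZ.2, ContinuousLinearMap.star_eq_adjoint, ContinuousLinearMap.adjoint_inner_left]
    rfl
  have h2 : T.vacuumComp ρ (star u * a * star (star u)) = ⟪ρ u T.Ω, ρ a (ρ u T.Ω)⟫_ℂ := by
    change ⟪T.Ω, ρ _ T.Ω⟫_ℂ = _
    rw [star_star, map_mul, map_mul, map_star, ← ContinuousLinearMap.adjoint_inner_right,
      ContinuousLinearMap.star_eq_adjoint]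
    rfl
  rw [h1, h2]
  calc _ ≤ 2 * ‖star Z T.Ω - ρ u T.Ω‖ * ‖ρ a‖ :=
        norm_inner_apply_sub_le _ (hn hZ.1.inv.1) (hn (Unitary.map_mem ρ hu))
    _ ≤ ε * ‖a‖ := by
        rw [norm_sub_rev]
        exact mul_le_mul (by linarith) (norm_starAlgHom_le hcl ρ a) (norm_nonneg _) hε.le

/-- The conjugates of a simple family form a simple family. -/
theorem IsSimpleFamily.conj (h : T.IsSimpleFamily Q σ) (hc : ∀ C, T.IsConj C (σ C) (σ' C)) :
    ∃ Q', T.IsSimpleFamily Q' σ' := by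
  obtain ⟨C₀⟩ := nonempty_hypercone τ
  have hloc : ∀ C, T.IsLocalized (σ' C) C := fun C => (hc C).isLocalized h
  refine ⟨T.chargeClass (T.vacuumComp (σ' C₀)), ⟨_, (hloc C₀).isElemental, rfl⟩,
    fun C => (hloc C).range_mem, fun C => ?_, fun C => (hloc C).trivial_compl,
    fun C => (hloc C).weakClosure_image, fun C₁ C₂ => ?_⟩
  · obtain ⟨Z, hZ⟩ := exists_intertwines_conj h hc C₀ C
    exact (hloc C₀).mem_chargeClass hZ
  · obtain ⟨Z, hZ⟩ := exists_intertwines_conj h hc C₁ C₂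
    exact ⟨Z, 1, hZ.1, ⟨one_mem _, one_mem _⟩, fun a => by rw [hZ.2, star_one, one_mul, mul_one]⟩

end Theory

/-! ### Extensions and products -/

lemma inner_conj (W x : H →L[ℂ] H) (η : H) :
    ⟪η, (W * x * star W) η⟫_ℂ = ⟪star W η, x (star W η)⟫_ℂ := by
  rw [ContinuousLinearMap.star_eq_adjoint, ContinuousLinearMap.adjoint_inner_left]
  rfl

lemma normalFunctional_consSq (η : H) (x : H →L[ℂ] H) :
    normalFunctional (consSq η 0) x = ⟪η, x η⟫_ℂ := by
  rw [normalFunctional, tsum_eq_single 0]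
  · rfl
  · intro n hn
    obtain ⟨k, rfl⟩ := Nat.exists_eq_succ_of_ne_zero hn
    have : (consSq η 0 : SqSummable H) (k + 1) = 0 := rfl
    rw [Nat.succ_eq_add_one, this, inner_zero_left]

lemma ext_inner_apply {x y : H →L[ℂ] H} (h : ∀ η, ⟪η, x η⟫_ℂ = ⟪η, y η⟫_ℂ) : x = y := by
  refine ContinuousLinearMap.coe_injective ((ext_inner_map _ _).1 fun η => ?_)
  have := congrArg (starRingEnd ℂ) (h η)
  rwa [inner_conj_symm, inner_conj_symm] at this

namespace Theory

variable {τ : ℝ} {T : Theory τ H} {Q Q' : Set (T.global →ₗ[ℂ] ℂ)} {σ σ' : Hypercone τ → T.Mor}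

/-- Locality and duality place the algebra of `O` in the von Neumann algebra of the complement, even
if `O` lies in no hypercone spacelike to `D`. -/
lemma alg_le_weakClosure_compl {O : DoubleCone} {D : Hypercone τ}
    (h : O.1 ⊆ spacelikeCompl D.1) {a : H →L[ℂ] H} (ha : a ∈ T.alg O) :
    a ∈ weakClosure (T.compl D) :=
  mem_weakClosure_compl_iff.2
    ⟨T.commute_region h ha, mem_globalVN_of_mem (T.alg_le_global O ha)⟩

lemma isClosed_funnelAlg (D : ℕ → Hypercone τ) :
    IsClosed (T.funnelAlg D : Set (H →L[ℂ] H)) :=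
  StarSubalgebra.isClosed_topologicalClosure _

lemma mem_funnelAlg {D : ℕ → Hypercone τ} (n : ℕ) {x : H →L[ℂ] H}
    (hx : x ∈ weakClosure (T.compl (D n))) : x ∈ T.funnelAlg D :=
  StarSubalgebra.le_topologicalClosure _
    (le_iSup (fun n => (weakClosure (T.compl (D n))).toStarSubalgebra) n hx)

lemma funnelAlg_le {D : ℕ → Hypercone τ} {S : StarSubalgebra ℂ (H →L[ℂ] H)}
    (hS : IsClosed (S : Set (H →L[ℂ] H)))
    (h : ∀ n, ∀ x ∈ weakClosure (T.compl (D n)), x ∈ S) : T.funnelAlg D ≤ S :=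
  StarSubalgebra.topologicalClosure_minimal (iSup_le fun n _ hx => h n _ hx) hS

lemma global_le_funnelAlg {D : ℕ → Hypercone τ} (hD : IsFunnel D) : T.global ≤ T.funnelAlg D :=
  T.global_le (isClosed_funnelAlg D) fun O _ ha =>
    let ⟨n, hn⟩ := hD.eventually_subset O
    mem_funnelAlg n (alg_le_weakClosure_compl (hn n le_rfl) ha)

/-- `W* W'` belongs to the von Neumann algebra of `D`, which commutes with that of its complement.
-/
lemma IsSimpleFamily.conj_eq_of_mem_weakClosure_compl (h : T.IsSimpleFamily Q σ)
    {C D D' : Hypercone τ} (hD : D'.1 ⊆ D.1) {W W' x : H →L[ℂ] H} (hW : T.Intertwines W (σ D) (σ C))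
    (hW' : T.Intertwines W' (σ D') (σ C)) (hx : x ∈ weakClosure (T.compl D)) :
    W' * x * star W' = W * x * star W := by
  have hc := commute_weakClosure (mem_weakClosure_compl_iff.1 hx).1
    ((hW'.trans hW.symm).mem_region ((h.trivial_compl D').mono hD) (h.trivial_compl D))
  have e := hW.1.mul_star_self
  have e' := hW'.1.mul_star_self
  calc W' * x * star W' = (W * star W) * W' * x * star W' := by rw [e, one_mul]
    _ = W * (star W * W' * x) * star W' := by noncomm_ring
    _ = W * x * star W * (W' * star W') := by rw [hc]; noncomm_ring
    _ = _ := by rw [e', mul_one]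

/-- The extension is the limit of `Ad (W n)` along a funnel. On the von Neumann algebra of the
complement of `D n` it is constant from index `n` on, so it is unitarily implemented there and
therefore normal. -/
lemma IsSimpleFamily.exists_isExtension (h : T.IsSimpleFamily Q σ) (C : Hypercone τ) :
    ∃ D ς, T.IsExtension (σ C) D ς ∧ ∃ m, C.1 ⊆ spacelikeCompl (D m).1 := by
  obtain ⟨B, D, hB, hCB, hD, hDB⟩ := exists_exhaustion_funnel T.tau_pos C
  choose W hW using fun n => h.exists_intertwines (D n) C
  have hw : ∀ n, W n ∈ unitary (H →L[ℂ] H) := fun n => (hW n).1.1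
  have const : ∀ m, ∀ x ∈ weakClosure (T.compl (D m)), ∀ n ≥ m,
      W n * x * star (W n) = W m * x * star (W m) := fun m x hx n hn =>
    h.conj_eq_of_mem_weakClosure_compl (hD.1 m n hn) (hW m) (hW n) hx
  have hle : T.funnelAlg D ≤ limAlg W hw :=
    funnelAlg_le isClosed_limAlg fun m x hx => mem_limAlg_of_eq (const m x hx)
  have hg : T.global ≤ T.funnelAlg D := global_le_funnelAlg hD
  have hVN : T.funnelAlg D ≤ T.globalVN.toStarSubalgebra :=
    funnelAlg_le isClosed_globalVN fun m x hx => (mem_weakClosure_compl_iff.1 hx).2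
  obtain ⟨ς, hς⟩ : ∃ ς : T.funnelAlg D →⋆ₐ[ℂ] (H →L[ℂ] H),
      ∀ a, ς a = limHom W hw ⟨a, hle a.2⟩ :=
    ⟨(limHom W hw).comp (StarSubalgebra.inclusion hle), fun _ => rfl⟩
  refine ⟨D, ς, ⟨hD, hg, fun a => ?_, fun a => ?_,
    fun n η => ⟨consSq (star (W n) η) 0, fun a ha => ?_⟩⟩,
    0, Hypercone.subset_compl_symm ((hDB 0).trans (spacelikeCompl_anti (hCB 0)))⟩
  · obtain ⟨φ, hφ⟩ : ∃ φ : T.Mor, ∀ a : T.global, φ a = ς ⟨a, hg a.2⟩ :=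
      ⟨ς.comp (StarSubalgebra.inclusion hg), fun _ => rfl⟩
    have : φ = σ C := by
      refine mor_ext fun O a ha => ?_
      obtain ⟨n, hn⟩ := hD.eventually_subset O
      rw [hφ, hς, limHom_eq (x := ⟨a, hle (hg a.2)⟩) (N := n) fun k hk =>
        (h.apply_eq_conj (hn k hk) (hW k) ha).symm]
    rw [← hφ, this]
  · rw [hς]
    exact isClosed_globalVN.mem_of_tendsto (tendsto_limHom (hw := hw) ⟨a, hle a.2⟩)
      (Eventually.of_forall fun n => mul_mem (mul_mem (hW n).1.2 (hVN a.2)) (star_mem (hW n).1.2))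
  · rw [normalFunctional_consSq, ← inner_conj, hς,
      limHom_eq (x := ⟨a, hle a.2⟩) (N := n) fun k hk => const n _ ha k hk]

/-- Normality determines an extension which is inner on the algebra of a spacelike complement. -/
lemma IsExtension.apply_eq_conj {ρ : T.Mor} {D : ℕ → Hypercone τ}
    {ς : T.funnelAlg D →⋆ₐ[ℂ] (H →L[ℂ] H)} (h : T.IsExtension ρ D ς) {n : ℕ} {W : H →L[ℂ] H}
    (hW : ∀ a : T.global, (a : H →L[ℂ] H) ∈ T.compl (D n) → ρ a = W * a * star W)
    {x : H →L[ℂ] H} (hx : x ∈ weakClosure (T.compl (D n))) :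
    ς ⟨x, mem_funnelAlg n hx⟩ = W * x * star W := by
  -- The expectation values of both sides in `η` are normal functionals of `x`. They agree on the
  -- C*-algebra of the complement, hence on its weak closure.
  refine ext_inner_apply fun η => ?_
  obtain ⟨ξ, hξ⟩ := h.normal n η
  rw [hξ _ hx, inner_conj]
  refine normalFunctional_eq_inner (fun a ha => ?_) hx
  have hg := T.compl_le_global _ ha
  rw [← hξ ⟨a, h.le hg⟩ (mem_weakClosure_of_mem ha), ← inner_conj, h.extends_mor ⟨a, hg⟩,
    hW ⟨a, hg⟩ ha]

/-- Morphisms which, locally, are inner and inverse to each other have a trivial product. -/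
lemma isProduct_idMor {ρ κ : T.Mor} {C : Hypercone τ}
    (hext : ∃ D ς, T.IsExtension ρ D ς ∧ ∃ m, C.1 ⊆ spacelikeCompl (D m).1)
    (h : ∀ D : Hypercone τ, D.1 ⊆ spacelikeCompl C.1 → ∃ W, T.IsUnitaryVN W ∧
      ∀ O : DoubleCone, O.1 ⊆ spacelikeCompl D.1 → ∀ a : T.global, (a : H →L[ℂ] H) ∈ T.alg O →
        κ a ∈ weakClosure (T.compl D) ∧ ρ a = W * a * star W ∧ κ a = star W * a * W) :
    T.IsProduct ρ κ C T.idMor := by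
  refine ⟨hext, fun D ς hς ⟨m, hm⟩ => ?_⟩
  have key : ∀ O, ∀ a : T.global, (a : H →L[ℂ] H) ∈ T.alg O →
      ∃ hκ : κ a ∈ T.funnelAlg D, ς ⟨κ a, hκ⟩ = a := by
    intro O a ha
    obtain ⟨k, hk⟩ := hς.isFunnel.eventually_subset O
    -- From `k` on, `D n` is spacelike to `O`; from `m` on, it is spacelike to `C`.
    obtain ⟨n, hkn, hmn⟩ : ∃ n, k ≤ n ∧ m ≤ n := ⟨max k m, le_max_left _ _, le_max_right _ _⟩
    obtain ⟨W, hW, hloc⟩ := h (D n)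
      ((hς.isFunnel.1 m n hmn).trans (Hypercone.subset_compl_symm hm))
    obtain ⟨h1, -, h3⟩ := hloc O (hk n hkn) a ha
    refine ⟨mem_funnelAlg n h1, ?_⟩
    obtain ⟨φ, hφ⟩ := exists_conjHom T.global hW.1
    have e := hW.mul_star_self
    rw [hς.apply_eq_conj (fun b hb => ?_) h1, h3]
    · calc W * (star W * a * W) * star W = (W * star W) * a * (W * star W) := by noncomm_ring
        _ = a := by rw [e, one_mul, mul_one]
    · rw [← hφ]
      exact mor_eq_on_compl (fun O' hO' b hb => by rw [hφ, (hloc O' hO' b hb).2.1]) b hb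
  have hmem : ∀ a, κ a ∈ T.funnelAlg D :=
    mor_mem (isClosed_funnelAlg D) fun O a ha => (key O a ha).choose
  have heq : ς.comp (κ.codRestrict _ hmem) = T.idMor :=
    mor_ext fun O a ha => (key O a ha).choose_spec
  exact fun a => ⟨hmem a, DFunLike.congr_fun heq a⟩

/-- `σ C a` commutes with the algebra of `D`: apply `σ C`, which is trivial there, to the
commutation relation with `a`. That the conjugate has extensions requires that it belongs to a
simple family. -/
lemma IsConj.isProduct_left (h : T.IsSimpleFamily Q σ) (h' : T.IsSimpleFamily Q' σ')
    {C : Hypercone τ} (hc : T.IsConj C (σ C) (σ' C)) :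
    T.IsProduct (σ' C) (σ C) C T.idMor := by
  refine isProduct_idMor (h'.exists_isExtension C) fun D hD => ?_
  obtain ⟨W, hW⟩ := h.exists_intertwines D C
  refine ⟨star W, hW.1.inv, fun O hO a ha => ⟨mem_weakClosure_compl_iff.2 ⟨fun b hb => ?_,
    h.range_mem C a⟩, ?_, ?_⟩⟩
  · obtain ⟨b, rfl⟩ : ∃ b' : T.global, (b' : H →L[ℂ] H) = b := ⟨⟨b, T.region_le_global _ hb⟩, rfl⟩
    have hba : b * a = a * b := Subtype.ext (T.commute_region hO ha b hb)
    have := congrArg (σ C) hba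
    rwa [map_mul, map_mul, h.trivial_compl C b (T.region_le_compl hD hb)] at this
  · rw [star_star, hc O a ha D hD hO _ (h.isLocalized D) W hW]
  · rw [star_star, h.apply_eq_conj hO hW ha]

/-- The conjugate is `W* a W` locally, and such transported operators commute with the algebra of
`D`, so they lie in the domain where the extension of `σ C` is `Ad W`. -/
lemma IsConj.isProduct_right (h : T.IsSimpleFamily Q σ) {C : Hypercone τ} {ρ : T.Mor}
    (hc : T.IsConj C (σ C) ρ) : T.IsProduct (σ C) ρ C T.idMor := by
  refine isProduct_idMor (h.exists_isExtension C) fun D hD => ?_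
  obtain ⟨W, hW⟩ := h.exists_intertwines D C
  refine ⟨W, hW.1, fun O hO a ha => ?_⟩
  have hρ := hc O a ha D hD hO _ (h.isLocalized D) W hW
  refine ⟨mem_weakClosure_compl_iff.2 ⟨fun b hb => ?_, hc.range_mem h a⟩,
    h.apply_eq_conj hO hW ha, hρ⟩
  rw [hρ]
  exact hW.commute_region (h.trivial_compl C) (h.isLocalized D) hD (T.commute_region hO ha)
    (mem_weakClosure_of_mem hb)

/-- Conjugates are limits of inner automorphisms. -/
lemma IsConj.isTransportLimit (h : T.IsSimpleFamily Q σ) {C : Hypercone τ} {ρ : T.Mor}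
    (hc : T.IsConj C (σ C) ρ) : T.IsTransportLimit C (σ C) ρ := by
  constructor
  · obtain ⟨B, D, hB, hCB, hD, hDB⟩ := exists_exhaustion_funnel T.tau_pos C
    choose W hW using fun n => h.exists_intertwines (D n) C
    exact ⟨W, B, D, hB, hCB, hD, hDB, fun n => σ (D n), fun n => ⟨⟨Q, σ, h, rfl⟩, hW n⟩⟩
  · rintro W ⟨B, D, hB, hCB, hD, hDB, κ, hκ⟩ a
    have hw : ∀ n, star (W n) ∈ unitary (H →L[ℂ] H) := fun n => (hκ n).2.1.inv.1
    have key : ∀ O, ∀ a : T.global, (a : H →L[ℂ] H) ∈ T.alg O → ∃ N, ∀ n ≥ N,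
        star (W n) * (a : H →L[ℂ] H) * star (star (W n)) = ρ a := by
      intro O a ha
      obtain ⟨N, hN⟩ := hD.eventually_subset O
      refine ⟨N, fun n hn => ?_⟩
      -- The `κ n` may come from different simple families. Only their localization and the
      -- intertwining relation enter.
      rw [star_star, hc O a ha (D n) ((hDB n).trans (spacelikeCompl_anti (hCB n))) (hN n hn)
        (κ n) (isLocalized_of_mem_Sigma (hκ n).1) (W n) (hκ n).2]
    have hle : T.global ≤ limAlg (fun n => star (W n)) hw :=
      T.global_le isClosed_limAlg fun O a ha =>
        mem_limAlg_of_eq (key O ⟨a, T.alg_le_global O ha⟩ ha).choose_spec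
    have heq : (limHom _ hw).comp (StarSubalgebra.inclusion hle) = ρ :=
      mor_ext fun O a ha => limHom_eq (key O a ha).choose_spec
    have := tendsto_limHom (StarSubalgebra.inclusion hle a)
    rw [← heq]
    simp only [star_star] at this
    exact this

/-- Simple families have conjugate simple families. -/
theorem IsSimpleFamily.exists_conjugate (h : T.IsSimpleFamily Q σ) :
    ∃ Q' σ', T.IsSimpleFamily Q' σ' ∧ ∀ C, T.IsProduct (σ' C) (σ C) C T.idMor ∧
      T.IsProduct (σ C) (σ' C) C T.idMor ∧ T.IsTransportLimit C (σ C) (σ' C) := by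
  choose σ' hc using h.exists_isConj
  obtain ⟨Q', h'⟩ := h.conj hc
  exact ⟨Q', σ', h', fun C => ⟨(hc C).isProduct_left h h', (hc C).isProduct_right h,
    (hc C).isTransportLimit h⟩⟩

end Theory

end LightCone

end

theorem mainTheorem6 {τ : ℝ} {H : Type*} [NormedAddCommGroup H] [InnerProductSpace ℂ H]
    [CompleteSpace H] (T : LightCone.Theory τ H) :
    (∀ (C : LightCone.Hypercone τ), ∀ σ ∈ T.Sigma C, ∃ σ' ∈ T.Sigma C,
      T.IsProduct σ' σ C T.idMor ∧ T.IsProduct σ σ' C T.idMor ∧ T.IsTransportLimit C σ σ') ∧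
    (∀ (Q : Set (T.global →ₗ[ℂ] ℂ)) (σ : LightCone.Hypercone τ → T.Mor),
      T.IsSimpleFamily Q σ →
      ∃ (Q' : Set (T.global →ₗ[ℂ] ℂ)) (σ' : LightCone.Hypercone τ → T.Mor),
        T.IsSimpleFamily Q' σ' ∧
        ∀ C, T.IsProduct (σ' C) (σ C) C T.idMor ∧ T.IsProduct (σ C) (σ' C) C T.idMor ∧
          T.IsTransportLimit C (σ C) (σ' C)) := by
  refine ⟨fun C σ hσ => ?_, fun Q σ h => h.exists_conjugate⟩
  obtain ⟨Q, σ, h, rfl⟩ := hσ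
  obtain ⟨Q', σ', h', hσ'⟩ := h.exists_conjugate
  exact ⟨σ' C, ⟨Q', σ', h', rfl⟩, hσ' C⟩
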